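/- Let $X$ be a K3 surface (a compact, simply connected complex surface with a nowhere vanishing holomorphic $2$-form $\eta$) and let $f:X\to X$ be an automorphism whose special eigenvalue $\delta=\delta(f)$, defined by $f^*\eta=\delta\,\eta$, is conjugate over $\mathbb Q$ to a Salem number (an algebraic integer $\lambda>1$ conjugate to $\lambda^{-1}$ whose remaining conjugates lie on the unit circle). **Definitions.** Let $h$ be $f$ or one of its iterates. An *$h$-invariant curve* is a smooth rational curve $E\cong\mathbb P^1$ in $X$ with $h(E)=E$; write $h_E:=h|_E$. For a fixed point $p$ of $h$ and local coordinates $z=(z_1,z_2)$ centred at $p$ in which $h$ is represented by $(h_1,h_2)$, the *multiplicity* is $$\mu_p(h)=\dim_{\mathbb C}\mathbb C\{z_1,z_2\}/(z_1-h_1,\,z_2-h_2),$$ and, if it is finite, the *holomorphic index* $\nu_p(h)$ is the Grothendieck residue at $p$ of $$\frac{dz_1\wedge dz_2}{(z_1-h_1(z))(z_2-h_2(z))}.$$ The point $p$ is *exceptional* for $h$ if $2\le\mu_p(h)<\infty$ and $p$ lies on an $h$-invariant curve. An exceptional fixed point $p$ of $h$ is *of type II* if no $h$-invariant curve $E\ni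 p$ has $(dh_E)_p=1$, but some $h$-invariant curve $E\ni p$ has $(dh_E)_p=\delta(h)$. **Theorem.** Let $p$ be an exceptional fixed point of type II of $f$ with $\mu_p(f)=2$. Then for every $n\ge1$, $p$ is an exceptional fixed point of type II of $f^n$ and $\mu_p(f^n)=2$. Moreover, let $E\ni p$ be an $f$-invariant curve with $(df_E)_p=\delta$, and let $z=(z_1,z_2)$ be a chart centred at $p$ in which $E=\{z_1=0\}$ and $f$ is represented near the origin by $$f_1(z)=z_1\{1+g_1(z)\},\qquad f_2(z)=\delta\{z_2+z_1g_2(z)\},$$ with convergent power series $$g_1=\sum_{i,j\ge0}a_{ij}z_1^iz_2^j,\qquad g_2=\sum_{i,j\ge0}b_{ij}z_1^iz_2^j,\qquad a_{00}=b_{00}=0.$$ Then $a_{10}\ne0$ and, for every $n\ge1$, $$\nu_p(f^n)=\frac{n-1+(n+1)\delta^n+(1+\delta+\cdots+\delta^{n-1})\,\theta}{n(1-\delta^n)^2},\qquad\text{where}\quad \theta=\frac{(1-\delta)a_{20}+\delta\,a_{01}b_{10}}{a_{10}^2}.$$ -/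

import Mathlib

open scoped Manifold ContDiff Topology

noncomputable section

namespace K3Dyn

/-! ### Convergent power series, multiplicity and residue of a pair of germs at `0 ∈ ℂ²` -/

/-- The (constant-wise) `ℂ`-algebra structure on germs at the origin of functions `ℂ² → ℂ`. -/
instance germAlgebra : Algebra ℂ (Filter.Germ (𝓝 (0 : ℂ × ℂ)) ℂ) :=
  Algebra.ofModule
    (by
      intro r x y
      induction x using Filter.Germ.inductionOn
      induction y using Filter.Germ.inductionOn
      simp only [← Filter.Germ.coe_smul, ← Filter.Germ.coe_mul, smul_mul_assoc])
    (by
      intro r x y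
      induction x using Filter.Germ.inductionOn
      induction y using Filter.Germ.inductionOn
      simp only [← Filter.Germ.coe_smul, ← Filter.Germ.coe_mul, mul_smul_comm])

/-- The ring `ℂ{z₁, z₂}` of convergent power series, realised as the ring of germs at the origin
of functions on `ℂ²` that are analytic at the origin. -/
def convergentSeries : Subalgebra ℂ (Filter.Germ (𝓝 (0 : ℂ × ℂ)) ℂ) where
  carrier := {φ | ∃ h : ℂ × ℂ → ℂ, AnalyticAt ℂ h 0 ∧ φ = (h : Filter.Germ (𝓝 (0 : ℂ × ℂ)) ℂ)}
  mul_mem' := by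
    rintro _ _ ⟨h, hh, rfl⟩ ⟨k, hk, rfl⟩
    exact ⟨h * k, hh.mul hk, rfl⟩
  add_mem' := by
    rintro _ _ ⟨h, hh, rfl⟩ ⟨k, hk, rfl⟩
    exact ⟨h + k, hh.add hk, rfl⟩
  algebraMap_mem' := by
    intro r
    refine ⟨fun _ => r, analyticAt_const, ?_⟩
    rw [Algebra.algebraMap_eq_smul_one]
    change ((r • (1 : ℂ × ℂ → ℂ) : ℂ × ℂ → ℂ) : Filter.Germ (𝓝 (0 : ℂ × ℂ)) ℂ) = _
    congr 1
    funext z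
    simp

/-- The ideal `(z₁ - F₁, z₂ - F₂)` of `ℂ{z₁, z₂}`, for a germ `F = (F₁, F₂)` of an analytic map. -/
def fixedIdeal (F : ℂ × ℂ → ℂ × ℂ) : Ideal convergentSeries :=
  Ideal.span {φ : convergentSeries |
    (φ : Filter.Germ (𝓝 (0 : ℂ × ℂ)) ℂ) = ((fun z : ℂ × ℂ => z.1 - (F z).1 : ℂ × ℂ → ℂ)) ∨
    (φ : Filter.Germ (𝓝 (0 : ℂ × ℂ)) ℂ) = ((fun z : ℂ × ℂ => z.2 - (F z).2 : ℂ × ℂ → ℂ))}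

/-- `dim_ℂ ℂ{z₁, z₂} / (z₁ - F₁, z₂ - F₂)`, with value `⊤` if it is infinite. -/
def localMultiplicity (F : ℂ × ℂ → ℂ × ℂ) : ℕ∞ :=
  Cardinal.toENat (Module.rank ℂ (convergentSeries ⧸ fixedIdeal F))

/-- The coefficient of `z₁ ^ i * z₂ ^ j` in the Taylor expansion at the origin of a function `h`
which is analytic at the origin. -/
def taylorCoeff (h : ℂ × ℂ → ℂ) (i j : ℕ) : ℂ :=
  iteratedDeriv i (fun x : ℂ => iteratedDeriv j (fun y : ℂ => h (x, y)) 0) 0 /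
    ((i.factorial : ℂ) * (j.factorial : ℂ))

/-- `HasResidue h G₁ G₂ R`: the Grothendieck residue at the origin of
`h dz₁ ∧ dz₂ / (G₁ G₂)` is `R`.

For monomial denominators the residue of `k dz₁ ∧ dz₂ / (z₁ ^ (N₁ + 1) * z₂ ^ (N₂ + 1))` is the
coefficient of `z₁ ^ N₁ * z₂ ^ N₂` in `k`.  In general some powers of the coordinates lie in the
ideal `(G₁, G₂)`, say `z₁ ^ (N₁ + 1) = A₁₁ G₁ + A₁₂ G₂` and `z₂ ^ (N₂ + 1) = A₂₁ G₁ + A₂₂ G₂`, and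
the residue is that of `h det A dz₁ ∧ dz₂ / (z₁ ^ (N₁ + 1) * z₂ ^ (N₂ + 1))`; the result does not
depend on the choice of `N₁`, `N₂` and `A`. -/
def HasResidue (h G₁ G₂ : ℂ × ℂ → ℂ) (R : ℂ) : Prop :=
  ∃ (N₁ N₂ : ℕ) (A₁₁ A₁₂ A₂₁ A₂₂ : ℂ × ℂ → ℂ),
    AnalyticAt ℂ A₁₁ 0 ∧ AnalyticAt ℂ A₁₂ 0 ∧ AnalyticAt ℂ A₂₁ 0 ∧ AnalyticAt ℂ A₂₂ 0 ∧
    (∀ᶠ z in 𝓝 (0 : ℂ × ℂ), z.1 ^ (N₁ + 1) = A₁₁ z * G₁ z + A₁₂ z * G₂ z) ∧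
    (∀ᶠ z in 𝓝 (0 : ℂ × ℂ), z.2 ^ (N₂ + 1) = A₂₁ z * G₁ z + A₂₂ z * G₂ z) ∧
    taylorCoeff (fun z => h z * (A₁₁ z * A₂₂ z - A₁₂ z * A₂₁ z)) N₁ N₂ = R

/-! ### K3 surfaces and their automorphisms -/

variable {X : Type*} [TopologicalSpace X] [ChartedSpace (ℂ × ℂ) X]

/-- A differential form of type `(2, 0)` on `X`: an alternating complex bilinear form on each
holomorphic tangent space. -/
abbrev TwoForm (X : Type*) [TopologicalSpace X] [ChartedSpace (ℂ × ℂ) X] :=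
  ∀ x : X, TangentSpace 𝓘(ℂ, ℂ × ℂ) x [⋀^Fin 2]→ₗ[ℂ] ℂ

/-- The coefficient of `dz₁ ∧ dz₂` in the expression of a form in a chart `c`. -/
def TwoForm.coeff (η : TwoForm X) (c : OpenPartialHomeomorph X (ℂ × ℂ)) (z : ℂ × ℂ) : ℂ :=
  η (c.symm z) ![mfderiv 𝓘(ℂ, ℂ × ℂ) 𝓘(ℂ, ℂ × ℂ) c.symm z ((1, 0) : ℂ × ℂ),
    mfderiv 𝓘(ℂ, ℂ × ℂ) 𝓘(ℂ, ℂ × ℂ) c.symm z ((0, 1) : ℂ × ℂ)]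

/-- A holomorphic 2-form: its coefficients in the charts of the atlas are holomorphic. -/
def TwoForm.IsHolomorphic (η : TwoForm X) : Prop :=
  ∀ c ∈ atlas (ℂ × ℂ) X, DifferentiableOn ℂ (η.coeff c) c.target

/-- A K3 surface: a compact, simply connected complex manifold of dimension 2 that carries a
nowhere vanishing holomorphic 2-form. -/
class IsK3Surface (X : Type*) [TopologicalSpace X] [ChartedSpace (ℂ × ℂ) X] : Prop extends
    IsManifold 𝓘(ℂ, ℂ × ℂ) ω X, T2Space X, CompactSpace X, SimplyConnectedSpace X where
  exists_form : ∃ η : TwoForm X, η.IsHolomorphic ∧ ∀ x, η x ≠ 0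

/-- `δ` is the special eigenvalue (the determinant) of the holomorphic map `f`:
`f^* η = δ η` for a nowhere vanishing holomorphic 2-form `η`. -/
def IsSpecialEigenvalue (f : X → X) (δ : ℂ) : Prop :=
  ∃ η : TwoForm X, η.IsHolomorphic ∧ (∀ x, η x ≠ 0) ∧
    ∀ (x : X) (v w : TangentSpace 𝓘(ℂ, ℂ × ℂ) x),
      η (f x) ![mfderiv 𝓘(ℂ, ℂ × ℂ) 𝓘(ℂ, ℂ × ℂ) f x v, mfderiv 𝓘(ℂ, ℂ × ℂ) 𝓘(ℂ, ℂ × ℂ) f x w] =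
        δ * η x ![v, w]

/-- A Salem number: an algebraic integer `l > 1` conjugate to `l⁻¹`, whose remaining
conjugates lie on the unit circle. -/
def IsSalemNumber (l : ℝ) : Prop :=
  1 < l ∧ IsIntegral ℤ l ∧ IsConjRoot ℚ (l : ℂ) ((l : ℂ)⁻¹) ∧
    ∀ z : ℂ, IsConjRoot ℚ (l : ℂ) z → z = (l : ℂ) ∨ z = (l : ℂ)⁻¹ ∨ ‖z‖ = 1

/-- A chart of the complex manifold `X` centred at `p`. -/
structure IsCentredChart (c : OpenPartialHomeomorph X (ℂ × ℂ)) (p : X) : Prop where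
  mem_maximalAtlas : c ∈ IsManifold.maximalAtlas 𝓘(ℂ, ℂ × ℂ) ω X
  mem_source : p ∈ c.source
  map_eq_zero : c p = 0

/-- The local representation of `f` in a chart `c`. -/
def localRep (c : OpenPartialHomeomorph X (ℂ × ℂ)) (f : X → X) (z : ℂ × ℂ) : ℂ × ℂ :=
  c (f (c.symm z))

/-- The multiplicity `μ_p(f)` of a fixed point `p` of `f`, computed in the coordinates given by
the preferred chart at `p`, translated so that `p` becomes the origin. -/
def multiplicity (f : X → X) (p : X) : ℕ∞ :=
  localMultiplicity fun z =>
    localRep (chartAt (ℂ × ℂ) p) f (z + chartAt (ℂ × ℂ) p p) - chartAt (ℂ × ℂ) p p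

/-- `HasHolomorphicIndex f p ν`: the holomorphic local index `ν_p(f)` of `f` at `p` is `ν`, that
is, `ν` is the Grothendieck residue at `p` of `dz₁ ∧ dz₂ / ((z₁ - f₁(z)) (z₂ - f₂(z)))`, where
`(f₁, f₂)` represents `f` in a chart `z` centred at `p`.  (The residue does not depend
on the chart.) -/
def HasHolomorphicIndex (f : X → X) (p : X) (ν : ℂ) : Prop :=
  ∃ c : OpenPartialHomeomorph X (ℂ × ℂ), IsCentredChart c p ∧
    HasResidue (fun _ => 1) (fun z => z.1 - (localRep c f z).1)
      (fun z => z.2 - (localRep c f z).2) ν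

/-! ### Curves -/

/-- The point with coordinate `w = 1 / z` of the Riemann sphere `ℂ ∪ {∞}`. -/
def sphereInv (w : ℂ) : OnePoint ℂ :=
  open Classical in if w = 0 then OnePoint.infty else ((w⁻¹ : ℂ) : OnePoint ℂ)

/-- `ι` is a holomorphic embedding of the Riemann sphere `ℙ¹ = ℂ ∪ {∞}` with image `E`: an
injective map which, in both of the coordinates `z` and `w = 1 / z`, is holomorphic with nowhere
vanishing differential. -/
structure IsParametrization (ι : OnePoint ℂ → X) (E : Set X) : Prop where
  injective : Function.Injective ι
  range_eq : Set.range ι = E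
  holomorphic : ContMDiff 𝓘(ℂ, ℂ) 𝓘(ℂ, ℂ × ℂ) ω fun z : ℂ => ι (z : OnePoint ℂ)
  immersion : ∀ z : ℂ, mfderiv 𝓘(ℂ, ℂ) 𝓘(ℂ, ℂ × ℂ) (fun z : ℂ => ι (z : OnePoint ℂ)) z ≠ 0
  holomorphic_infty : ContMDiff 𝓘(ℂ, ℂ) 𝓘(ℂ, ℂ × ℂ) ω fun w : ℂ => ι (sphereInv w)
  immersion_infty : ∀ w : ℂ, mfderiv 𝓘(ℂ, ℂ) 𝓘(ℂ, ℂ × ℂ) (fun w : ℂ => ι (sphereInv w)) w ≠ 0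

/-- An `f`-invariant curve: a smooth rational curve `E ≅ ℙ¹` in `X` with `f(E) = E`.  (On a K3
surface the smooth rational curves are the `(-2)`-curves.) -/
def IsInvariantCurve (f : X → X) (E : Set X) : Prop :=
  (∃ ι : OnePoint ℂ → X, IsParametrization ι E) ∧ f '' E = E

/-- `(df_E)_p = m` for an invariant curve `E` of `f` through the fixed point `p`: the restriction
of `f` to `E`, written in a coordinate of `E ≅ ℙ¹` that vanishes at `p`, has derivative `m`
at `0`. -/
def HasCurveDeriv (f : X → X) (E : Set X) (p : X) (m : ℂ) : Prop :=
  ∃ ι : OnePoint ℂ → X, IsParametrization ι E ∧ ι ((0 : ℂ) : OnePoint ℂ) = p ∧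
    ∃ u : ℂ → ℂ, (∀ᶠ z : ℂ in 𝓝 (0 : ℂ), f (ι (z : OnePoint ℂ)) = ι ((u z : ℂ) : OnePoint ℂ)) ∧
      HasDerivAt u m 0

/-! ### Exceptional fixed points -/

/-- An exceptional fixed point: `2 ≤ μ_p(f) < ∞` and `p` lies on an `f`-invariant curve. -/
def IsExceptional (f : X → X) (p : X) : Prop :=
  f p = p ∧ 2 ≤ multiplicity f p ∧ multiplicity f p ≠ ⊤ ∧
    ∃ E : Set X, IsInvariantCurve f E ∧ p ∈ E

/-- An exceptional fixed point is of type I if it lies on an invariant curve `E` with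
`(df_E)_p = 1`. -/
def IsTypeI (f : X → X) (p : X) : Prop :=
  IsExceptional f p ∧ ∃ E : Set X, IsInvariantCurve f E ∧ p ∈ E ∧ HasCurveDeriv f E p 1

/-- An exceptional fixed point is of type II if it lies on no invariant curve `E` with
`(df_E)_p = 1`, but on an invariant curve `E` with `(df_E)_p = δ(f)`. -/
def IsTypeII (f : X → X) (p : X) : Prop :=
  IsExceptional f p ∧ ¬ IsTypeI f p ∧
    ∃ E : Set X, IsInvariantCurve f E ∧ p ∈ E ∧
      ∃ δ : ℂ, IsSpecialEigenvalue f δ ∧ HasCurveDeriv f E p δ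

/-- `c = (z₁, z₂)` is a chart centred at `p`, adapted to the invariant curve `E`, in which
`E = {z₁ = 0}` and
`f₁(z) = z₁ (1 + g₁(z))`, `f₂(z) = δ (z₂ + z₁ g₂(z))`, `g₁(0) = g₂(0) = 0`,
with convergent power series `g₁`, `g₂`.  In particular `z₁` is in the eigendirection of
eigenvalue `1` and `f_E` is normalised as `f_E(z₂) = δ z₂`. -/
structure IsNormalForm (f : X → X) (p : X) (E : Set X) (δ : ℂ)
    (c : OpenPartialHomeomorph X (ℂ × ℂ)) (g₁ g₂ : ℂ × ℂ → ℂ) : Prop where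
  centred : IsCentredChart c p
  curve : ∀ x ∈ c.source, x ∈ E ↔ (c x).1 = 0
  analytic_fst : AnalyticAt ℂ g₁ 0
  analytic_snd : AnalyticAt ℂ g₂ 0
  fst_zero : g₁ 0 = 0
  snd_zero : g₂ 0 = 0
  rep : ∀ᶠ z in 𝓝 (0 : ℂ × ℂ),
    localRep c f z = (z.1 * (1 + g₁ z), δ * (z.2 + z.1 * g₂ z))

/-- The number `θ = ((1 - δ) a₂₀ + δ a₀₁ b₁₀) / a₁₀²`, where `aᵢⱼ` and `bᵢⱼ` are the Taylor
coefficients of `g₁` and `g₂`. -/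
def theta (δ : ℂ) (g₁ g₂ : ℂ × ℂ → ℂ) : ℂ :=
  ((1 - δ) * taylorCoeff g₁ 2 0 + δ * taylorCoeff g₁ 0 1 * taylorCoeff g₂ 1 0) /
    (taylorCoeff g₁ 1 0) ^ 2

end K3Dyn

end

noncomputable section

namespace K3Dyn

/-! ### Division of convergent power series in two variables -/

/-! Give `x = z₁` weight one and `y = z₂` weight two. In coordinates where the differential at `p`
is diagonal with eigenvalues `1` and `δ`, the map is `(x + a x² + c x³ + m x y, b x² + d x³ + y (δ +
e x))` up to terms that do not matter (`HasMapJet`). The weights are natural because `y = F₂` is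
solved by `y ≈ b x² / (1 - δ)`. The parabolas `(t, s t²)` probe exactly these coefficients.
Following them through `n` steps and comparing two values of `s` gives the jet of `F^[n]`
(`HasMapJet.iterate`): `a` becomes `n a`, `δ` becomes `δ ^ n`, and the other coefficients involve
geometric sums.

If `a ≠ 0` and `δ ≠ 1`, Cramer's rule puts `x²` and `y` in the ideal of `x - F₁` and `y - F₂`. So
the multiplicity is two, and the residue is read off from the inverse determinant: `(c (1 - δ) - a e
+ m b) / (a² (1 - δ)²)`. If `a = 0`, the parabola with `s = b / (1 - δ)` is fixed to third order and
the multiplicity is at least three. Thus multiplicity two forces `a ≠ 0`. No power `δ ^ n` with `n ≥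
1` is `1`, since a conjugate of `δ` exceeds `1`, so the same argument applies to `F^[n]`. The
invariant two-form gives `e = -2 a δ` (`HasMapJet.eq_of_volume`), and summing geometric series
yields the formula (`index_formula`).

For type II to persist, `f^[n]` must have no invariant curve through `p` with multiplier `1`. Near
`p` such a curve is a graph `y = φ(x)`. Since `F` commutes with `F^[n]`, the deviation of the
`F`-image of the arc from the graph is asymptotically multiplied by `δ ^ n` under a
reparametrization tangent to the identity. Its leading term is multiplied by `1`, so the deviation
vanishes (`HasMapJet.exists_reparametrization`). By the identity theorem the whole curve is
`f`-invariant, and its multiplier is `1`, which type II excludes for `f`. -/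

/-- The linear map `(x, y) ↦ (x, s y)`. -/
def scaleSnd (s : ℂ) : ℂ × ℂ →L[ℂ] ℂ × ℂ :=
  (ContinuousLinearMap.fst ℂ ℂ ℂ).prod (s • ContinuousLinearMap.snd ℂ ℂ ℂ)

@[simp] lemma scaleSnd_apply (s : ℂ) (z : ℂ × ℂ) : scaleSnd s z = (z.1, s * z.2) := rfl

lemma norm_scaleSnd_le {s : ℂ} (hs : ‖s‖ ≤ 1) : ‖scaleSnd s‖ ≤ 1 := by
  refine ContinuousLinearMap.opNorm_le_bound _ zero_le_one fun z => ?_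
  rw [one_mul, scaleSnd_apply, Prod.norm_def]
  refine max_le (norm_fst_le z) ?_
  rw [norm_mul]
  exact (mul_le_of_le_one_left (norm_nonneg _) hs).trans (norm_snd_le z)

lemma continuous_scaleSnd : Continuous scaleSnd := by
  have : scaleSnd = fun s => (ContinuousLinearMap.inl ℂ ℂ ℂ).comp (ContinuousLinearMap.fst ℂ ℂ ℂ)
      + s • (ContinuousLinearMap.inr ℂ ℂ ℂ).comp (ContinuousLinearMap.snd ℂ ℂ ℂ) := by
    funext s
    ext <;> simp
  rw [this]
  fun_prop

lemma norm_ofReal_le_one {s : ℝ} (hs : s ∈ Set.uIoc (0 : ℝ) 1) : ‖(s : ℂ)‖ ≤ 1 := by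
  rw [Set.uIoc_of_le zero_le_one] at hs
  rw [Complex.norm_real, Real.norm_eq_abs, abs_of_pos hs.1]
  exact hs.2

/-- The power series can be integrated term by term: `scaleSnd s` is a contraction for `0 ≤ s ≤ 1`,
so the integrated coefficients are bounded by the original ones and the radius does not shrink. -/
lemma analyticAt_integral_scaleSnd {k : ℂ × ℂ → ℂ} (hk : AnalyticAt ℂ k 0) :
    AnalyticAt ℂ (fun z => ∫ s in (0 : ℝ)..1, k (scaleSnd s z)) 0 := by
  obtain ⟨p, r, hp⟩ := hk
  let Q : ∀ n : ℕ, ℝ → ContinuousMultilinearMap ℂ (fun _ : Fin n => ℂ × ℂ) ℂ :=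
    fun n s => (p n).compContinuousLinearMap fun _ => scaleSnd s
  have hQc : ∀ n, Continuous (Q n) := fun n => by
    have h1 : Continuous fun s : ℝ => fun _ : Fin n => scaleSnd (s : ℂ) :=
      continuous_pi fun _ => continuous_scaleSnd.comp Complex.continuous_ofReal
    have h2 := (ContinuousMultilinearMap.compContinuousLinearMapContinuousMultilinear ℂ
      (fun _ : Fin n => ℂ × ℂ) (fun _ : Fin n => ℂ × ℂ) ℂ).cont.comp h1
    exact (ContinuousLinearMap.apply ℂ _ (p n)).continuous.comp h2
  have hQn : ∀ n, ∀ s ∈ Set.uIoc (0 : ℝ) 1, ‖Q n s‖ ≤ ‖p n‖ := fun n s hs => by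
    refine (ContinuousMultilinearMap.norm_compContinuousLinearMap_le _ _).trans ?_
    refine mul_le_of_le_one_right (norm_nonneg _) ?_
    exact Finset.prod_le_one (fun _ _ => norm_nonneg _)
      fun _ _ => norm_scaleSnd_le (norm_ofReal_le_one hs)
  let q : FormalMultilinearSeries ℂ (ℂ × ℂ) ℂ := fun n => ∫ s in (0 : ℝ)..1, Q n s
  have hqn : ∀ n, ‖q n‖ ≤ ‖p n‖ := fun n => by
    have := intervalIntegral.norm_integral_le_of_norm_le_const (hQn n)
    simpa using this
  refine ⟨q, r, hp.r_le.trans (FormalMultilinearSeries.radius_le_of_le hqn), hp.r_pos, ?_⟩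
  intro y hy
  rw [zero_add]
  have hqy : ∀ n, q n (fun _ => y) = ∫ s in (0 : ℝ)..1, Q n s (fun _ => y) := fun n =>
    ((ContinuousMultilinearMap.apply ℂ (fun _ : Fin n => ℂ × ℂ) ℂ
      (fun _ => y)).intervalIntegral_comp_comm ((hQc n).intervalIntegrable 0 1)).symm
  simp_rw [hqy]
  have hysum : Summable fun n => ‖p n‖ * ‖y‖ ^ n := by
    have : (‖y‖₊ : ENNReal) < p.radius := by
      refine lt_of_lt_of_le ?_ hp.r_le
      simpa [Metric.mem_eball, edist_zero_right, enorm] using hy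
    simpa using p.summable_norm_mul_pow this
  refine intervalIntegral.hasSum_integral_of_dominated_convergence
    (fun n _ => ‖p n‖ * ‖y‖ ^ n) ?_ ?_ ?_ ?_ ?_
  · intro n
    exact ((ContinuousMultilinearMap.apply ℂ (fun _ : Fin n => ℂ × ℂ) ℂ
      (fun _ => y)).continuous.comp (hQc n)).aestronglyMeasurable
  · intro n
    refine Filter.Eventually.of_forall fun s hs => ?_
    refine (ContinuousMultilinearMap.le_opNorm _ _).trans ?_
    rw [Finset.prod_const, Finset.card_univ, Fintype.card_fin]
    gcongr
    exact hQn n s hs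
  · exact Filter.Eventually.of_forall fun s _ => hysum
  · exact intervalIntegrable_const
  · refine Filter.Eventually.of_forall fun s hs => ?_
    have hs' : scaleSnd s y ∈ Metric.eball (0 : ℂ × ℂ) r := by
      rw [Metric.mem_eball, edist_zero_right] at hy ⊢
      refine lt_of_le_of_lt ?_ hy
      rw [enorm_le_iff_norm_le]
      exact (ContinuousLinearMap.le_of_opNorm_le _
        (norm_scaleSnd_le (norm_ofReal_le_one hs)) y).trans (by rw [one_mul])
    have := hp.hasSum hs'
    rw [zero_add] at this
    exact this

/-- Division by the second coordinate. -/
lemma exists_division_snd {h : ℂ × ℂ → ℂ} (hh : AnalyticAt ℂ h 0) :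
    ∃ A : ℂ × ℂ → ℂ, AnalyticAt ℂ A 0 ∧ ∀ᶠ z in 𝓝 (0 : ℂ × ℂ), h z = h (z.1, 0) + z.2 * A z := by
  -- Hadamard's formula: the quotient is the integral over `0 ≤ s ≤ 1` of the `y`-derivative of `h`
  -- at `(x, s y)`.
  let k : ℂ × ℂ → ℂ := fun z => fderiv ℂ h z (0, 1)
  have hk : AnalyticAt ℂ k 0 :=
    ((ContinuousLinearMap.apply ℂ ℂ ((0, 1) : ℂ × ℂ)).analyticAt _).comp hh.fderiv
  refine ⟨_, analyticAt_integral_scaleSnd hk, ?_⟩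
  obtain ⟨ε, hε, hb⟩ := Metric.eventually_nhds_iff_ball.1
    (hh.eventually_analyticAt.and hk.eventually_analyticAt)
  filter_upwards [Metric.ball_mem_nhds _ hε] with z hz
  have hmem : ∀ s ∈ Set.uIcc (0 : ℝ) 1, scaleSnd s z ∈ Metric.ball (0 : ℂ × ℂ) ε := by
    intro s hs
    rw [Set.uIcc_of_le zero_le_one] at hs
    have h1 : ‖(s : ℂ)‖ ≤ 1 := by
      rw [Complex.norm_real, Real.norm_eq_abs, abs_of_nonneg hs.1]
      exact hs.2
    rw [mem_ball_zero_iff] at hz ⊢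
    exact ((ContinuousLinearMap.le_of_opNorm_le _ (norm_scaleSnd_le h1) z).trans
      (by rw [one_mul])).trans_lt hz
  have hd : ∀ s ∈ Set.uIcc (0 : ℝ) 1, HasDerivAt (fun s : ℝ => h (scaleSnd s z))
      (z.2 * k (scaleSnd s z)) s := by
    intro s hs
    have h1 : HasFDerivAt h (fderiv ℂ h (scaleSnd s z)) (scaleSnd s z) :=
      (hb _ (hmem s hs)).1.differentiableAt.hasFDerivAt
    have h2 : HasDerivAt (fun s : ℝ => scaleSnd (s : ℂ) z) ((0 : ℂ), z.2) s := by
      refine HasDerivAt.prodMk (hasDerivAt_const _ _) ?_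
      simpa using (Complex.ofRealCLM.hasDerivAt (x := s)).mul_const z.2
    have h3 := (h1.restrictScalars ℝ).comp_hasDerivAt s h2
    refine h3.congr_deriv ?_
    have : ((0 : ℂ), z.2) = z.2 • ((0 : ℂ), (1 : ℂ)) := by ext <;> simp
    rw [this]
    exact (fderiv ℂ h (scaleSnd s z)).map_smul z.2 (0, 1)
  have hc : ContinuousOn (fun s : ℝ => z.2 * k (scaleSnd s z)) (Set.uIcc (0 : ℝ) 1) := by
    refine continuousOn_const.mul fun s hs => ?_
    refine ContinuousAt.continuousWithinAt ?_
    have h1 : ContinuousAt k (scaleSnd s z) := (hb _ (hmem s hs)).2.continuousAt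
    refine ContinuousAt.comp (f := fun s : ℝ => scaleSnd (s : ℂ) z) h1 ?_
    simp only [scaleSnd_apply]
    fun_prop
  have := intervalIntegral.integral_eq_sub_of_hasDerivAt hd hc.intervalIntegrable
  rw [intervalIntegral.integral_const_mul] at this
  rw [this]
  simp

/-- Division by the coordinate in one variable. -/
lemma exists_division {k : ℂ → ℂ} (hk : AnalyticAt ℂ k 0) :
    ∃ B : ℂ → ℂ, AnalyticAt ℂ B 0 ∧ ∀ x, k x = k 0 + x * B x := by
  obtain ⟨p, hp⟩ := hk
  refine ⟨dslope k 0, ⟨_, hp.has_fpower_series_dslope_fslope⟩, fun x => ?_⟩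
  have := sub_smul_dslope k 0 x
  simp only [sub_zero, smul_eq_mul] at this
  rw [this]; ring

/-! ### Weighted jets -/

/-- `h` has the expansion `h₁ x + h₂ x² + h₃ x³ + y (k₀ + k₁ x)` up to terms of weight four, where
`x` has weight one and `y` has weight two. -/
def HasWeightedJet (h : ℂ × ℂ → ℂ) (h₁ h₂ h₃ k₀ k₁ : ℂ) : Prop :=
  ∃ (C M : ℂ → ℂ) (N : ℂ × ℂ → ℂ), AnalyticAt ℂ C 0 ∧ AnalyticAt ℂ M 0 ∧ AnalyticAt ℂ N 0 ∧
    ∀ᶠ z in 𝓝 (0 : ℂ × ℂ), h z = h₁ * z.1 + h₂ * z.1 ^ 2 + h₃ * z.1 ^ 3 + z.1 ^ 4 * C z.1 +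
      z.2 * (k₀ + k₁ * z.1 + z.1 ^ 2 * M z.1 + z.2 * N z)

/-- `φ t = c₁ t + c₂ t² + c₃ t³ + O(t⁴)`. -/
def HasJet (φ : ℂ → ℂ) (c₁ c₂ c₃ : ℂ) : Prop :=
  ∃ ξ : ℂ → ℂ, ContinuousAt ξ 0 ∧
    ∀ᶠ t in 𝓝 (0 : ℂ), φ t = c₁ * t + c₂ * t ^ 2 + c₃ * t ^ 3 + t ^ 4 * ξ t

lemma analyticAt_slice_fst {h : ℂ × ℂ → ℂ} (hh : AnalyticAt ℂ h 0) :
    AnalyticAt ℂ (fun x : ℂ => h (x, 0)) 0 :=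
  AnalyticAt.fun_comp (f := fun x : ℂ => (x, (0 : ℂ))) (by exact hh)
    (analyticAt_id.prod analyticAt_const)

lemma exists_hasWeightedJet {h : ℂ × ℂ → ℂ} (hh : AnalyticAt ℂ h 0) (h0 : h 0 = 0) :
    ∃ h₁ h₂ h₃ k₀ k₁, HasWeightedJet h h₁ h₂ h₃ k₀ k₁ := by
  obtain ⟨A, hA, hA'⟩ := exists_division_snd hh
  obtain ⟨N, hN, hN'⟩ := exists_division_snd hA
  obtain ⟨B₁, hB₁, e₁⟩ := exists_division (analyticAt_slice_fst hh)
  obtain ⟨B₂, hB₂, e₂⟩ := exists_division hB₁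
  obtain ⟨B₃, hB₃, e₃⟩ := exists_division hB₂
  obtain ⟨C, hC, e₄⟩ := exists_division hB₃
  obtain ⟨M₁, hM₁, f₁⟩ := exists_division (analyticAt_slice_fst hA)
  obtain ⟨M, hM, f₂⟩ := exists_division hM₁
  refine ⟨B₁ 0, B₂ 0, B₃ 0, A (0, 0), M₁ 0, C, M, N, hC, hM, hN, ?_⟩
  filter_upwards [hA', hN'] with z hz hz'
  rw [hz, hz', e₁ z.1, e₂ z.1, e₃ z.1, e₄ z.1, f₁ z.1, f₂ z.1]
  have : h ((0 : ℂ), (0 : ℂ)) = 0 := h0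
  simp only [this]
  ring

lemma HasJet.eval_zero {φ : ℂ → ℂ} {c₁ c₂ c₃ : ℂ} (h : HasJet φ c₁ c₂ c₃) : φ 0 = 0 := by
  obtain ⟨ξ, -, h⟩ := h
  simpa using h.self_of_nhds

lemma HasJet.continuousAt {φ : ℂ → ℂ} {c₁ c₂ c₃ : ℂ} (h : HasJet φ c₁ c₂ c₃) :
    ContinuousAt φ 0 := by
  obtain ⟨ξ, hξ, h⟩ := h
  refine ContinuousAt.congr ?_ (Filter.EventuallyEq.symm h)
  fun_prop

lemma HasJet.congr {φ ψ : ℂ → ℂ} {c₁ c₂ c₃ : ℂ} (h : HasJet φ c₁ c₂ c₃) (e : φ =ᶠ[𝓝 0] ψ) :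
    HasJet ψ c₁ c₂ c₃ := by
  obtain ⟨ξ, hξ, h⟩ := h
  exact ⟨ξ, hξ, by filter_upwards [h, e] with t h e; rw [← e, h]⟩

lemma HasWeightedJet.congr {φ ψ : ℂ × ℂ → ℂ} {h₁ h₂ h₃ k₀ k₁ : ℂ}
    (h : HasWeightedJet φ h₁ h₂ h₃ k₀ k₁) (e : φ =ᶠ[𝓝 0] ψ) :
    HasWeightedJet ψ h₁ h₂ h₃ k₀ k₁ := by
  obtain ⟨C, M, N, hC, hM, hN, h⟩ := h
  exact ⟨C, M, N, hC, hM, hN, by filter_upwards [h, e] with t h e; rw [← e, h]⟩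

/-- Along an arc with `x = t + …` and `y = O(t²)`, every term of weight at least four is `O(t⁴)`, so
the listed coefficients determine the composite through order three. -/
lemma HasWeightedJet.comp {h : ℂ × ℂ → ℂ} {h₁ h₂ h₃ k₀ k₁ : ℂ}
    (hh : HasWeightedJet h h₁ h₂ h₃ k₀ k₁) {γ : ℂ → ℂ × ℂ} {α β σ τ : ℂ}
    (hx : HasJet (fun t => (γ t).1) 1 α β) (hy : HasJet (fun t => (γ t).2) 0 σ τ) :
    HasJet (fun t => h (γ t)) h₁ (h₁ * α + h₂ + k₀ * σ)
      (h₁ * β + 2 * h₂ * α + h₃ + k₀ * τ + k₁ * σ) := by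
  have hγ0 : γ 0 = 0 := Prod.ext hx.eval_zero hy.eval_zero
  have hγ : ContinuousAt γ 0 := hx.continuousAt.prodMk hy.continuousAt
  obtain ⟨ξ, hξ, hx⟩ := hx
  obtain ⟨η, hη, hy⟩ := hy
  obtain ⟨C, M, N, hC, hM, hN, hh⟩ := hh
  have hx1 : ContinuousAt (fun t => (γ t).1) 0 := hγ.fst
  have hC' : ContinuousAt (fun t => C (γ t).1) 0 :=
    ContinuousAt.comp_of_eq hC.continuousAt hx1 (by rw [hγ0]; rfl)
  have hM' : ContinuousAt (fun t => M (γ t).1) 0 :=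
    ContinuousAt.comp_of_eq hM.continuousAt hx1 (by rw [hγ0]; rfl)
  have hN' : ContinuousAt (fun t => N (γ t)) 0 :=
    ContinuousAt.comp_of_eq hN.continuousAt hγ hγ0
  have hγt : Filter.Tendsto γ (𝓝 0) (𝓝 0) := by
    have := hγ.tendsto
    rwa [hγ0] at this
  -- The composites become opaque continuous functions. The witness below is the rest of the
  -- expansion after division by `t⁴`.
  generalize eC : (fun t => C (γ t).1) = C' at hC'
  generalize eM : (fun t => M (γ t).1) = M' at hM'
  generalize eN : (fun t => N (γ t)) = N' at hN'
  refine ⟨fun t => h₁ * ξ t + h₂ * (2 * (β + t * ξ t) + (α + β * t + t ^ 2 * ξ t) ^ 2) +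
    h₃ * (α + β * t + t ^ 2 * ξ t) * ((1 + α * t + β * t ^ 2 + t ^ 3 * ξ t) ^ 2 +
      (1 + α * t + β * t ^ 2 + t ^ 3 * ξ t) + 1) +
    (1 + α * t + β * t ^ 2 + t ^ 3 * ξ t) ^ 4 * C' t + k₀ * η t +
    k₁ * ((α + β * t + t ^ 2 * ξ t) * (σ + τ * t + t ^ 2 * η t) + (τ + t * η t)) +
    (1 + α * t + β * t ^ 2 + t ^ 3 * ξ t) ^ 2 * (σ + τ * t + t ^ 2 * η t) * M' t +
    (σ + τ * t + t ^ 2 * η t) ^ 2 * N' t, by fun_prop, ?_⟩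
  filter_upwards [hx, hy, hγt.eventually hh] with t ex ey eh
  rw [eh, show C (γ t).1 = C' t from congrFun eC t, show M (γ t).1 = M' t from congrFun eM t,
    show N (γ t) = N' t from congrFun eN t, ex, ey]
  ring

lemma eq_zero_of_eventually_punctured {ζ : ℂ → ℂ} (hζ : ContinuousAt ζ 0)
    (h : ∀ᶠ t in 𝓝[≠] (0 : ℂ), ζ t = 0) : ζ 0 = 0 := by
  have h1 : Filter.Tendsto ζ (𝓝[≠] 0) (𝓝 (ζ 0)) := hζ.tendsto.mono_left nhdsWithin_le_nhds
  have h2 : Filter.Tendsto ζ (𝓝[≠] 0) (𝓝 0) := (Filter.tendsto_congr' h).2 tendsto_const_nhds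
  exact tendsto_nhds_unique h1 h2

/-- Coefficients are peeled off one at a time: divide by `t` off the origin and let `t → 0`, using
only continuity of the remainders. -/
lemma HasJet.unique {φ : ℂ → ℂ} {c₁ c₂ c₃ d₁ d₂ d₃ : ℂ} (hc : HasJet φ c₁ c₂ c₃)
    (hd : HasJet φ d₁ d₂ d₃) : c₁ = d₁ ∧ c₂ = d₂ ∧ c₃ = d₃ := by
  obtain ⟨ξ, hξ, hc⟩ := hc
  obtain ⟨η, hη, hd⟩ := hd
  have h0 : ∀ᶠ t in 𝓝[≠] (0 : ℂ), t ≠ 0 := self_mem_nhdsWithin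
  have h1 : ∀ᶠ t in 𝓝[≠] (0 : ℂ), (c₁ - d₁) + (c₂ - d₂) * t + (c₃ - d₃) * t ^ 2 +
      t ^ 3 * (ξ t - η t) = 0 := by
    filter_upwards [hc.filter_mono nhdsWithin_le_nhds, hd.filter_mono nhdsWithin_le_nhds, h0]
      with t e f ht
    refine (mul_eq_zero.1 ?_).resolve_left ht
    linear_combination f - e
  have e1 : c₁ - d₁ = 0 := by
    have := eq_zero_of_eventually_punctured (by fun_prop) h1
    simpa using this
  have h2 : ∀ᶠ t in 𝓝[≠] (0 : ℂ), (c₂ - d₂) + (c₃ - d₃) * t + t ^ 2 * (ξ t - η t) = 0 := by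
    filter_upwards [h1, h0] with t e ht
    refine (mul_eq_zero.1 ?_).resolve_left ht
    linear_combination e - e1
  have e2 : c₂ - d₂ = 0 := by
    have := eq_zero_of_eventually_punctured (by fun_prop) h2
    simpa using this
  have h3 : ∀ᶠ t in 𝓝[≠] (0 : ℂ), (c₃ - d₃) + t * (ξ t - η t) = 0 := by
    filter_upwards [h2, h0] with t e ht
    refine (mul_eq_zero.1 ?_).resolve_left ht
    linear_combination e - e2
  have e3 : c₃ - d₃ = 0 := by
    have := eq_zero_of_eventually_punctured (by fun_prop) h3
    simpa using this
  exact ⟨sub_eq_zero.1 e1, sub_eq_zero.1 e2, sub_eq_zero.1 e3⟩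

lemma hasJet_id : HasJet (fun t => t) 1 0 0 :=
  ⟨fun _ => 0, continuousAt_const, Filter.Eventually.of_forall fun t => by ring⟩

lemma hasJet_sq (s : ℂ) : HasJet (fun t => s * t ^ 2) 0 s 0 :=
  ⟨fun _ => 0, continuousAt_const, Filter.Eventually.of_forall fun t => by ring⟩

/-- The components of `F` have weighted jets `x + a x² + c x³ + m x y` and
`b x² + d x³ + y (δ + e x)`. -/
structure HasMapJet (F : ℂ × ℂ → ℂ × ℂ) (δ a b c d e m : ℂ) : Prop where
  fst : HasWeightedJet (fun z => (F z).1) 1 a c 0 m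
  snd : HasWeightedJet (fun z => (F z).2) 0 b d δ e

lemma HasMapJet.congr {F G : ℂ × ℂ → ℂ × ℂ} {δ a b c d e m : ℂ} (h : HasMapJet F δ a b c d e m)
    (h' : F =ᶠ[𝓝 0] G) : HasMapJet G δ a b c d e m :=
  ⟨h.1.congr (h'.fun_comp Prod.fst), h.2.congr (h'.fun_comp Prod.snd)⟩

lemma analyticAt_iterate {F : ℂ × ℂ → ℂ × ℂ} (hF : AnalyticAt ℂ F 0) (h0 : F 0 = 0) (n : ℕ) :
    AnalyticAt ℂ F^[n] 0 := by
  induction n with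
  | zero => exact analyticAt_id
  | succ n ih =>
    rw [Function.iterate_succ']
    refine AnalyticAt.comp ?_ ih
    rwa [Function.iterate_fixed h0]

/-- The image of a parabola is again of the form `(t + …, O(t²))`, so the jets satisfy a recursion
in `n`. Keeping `s` free separates the pure powers of `x` from the terms linear in `y`. The constant
`dn` stays implicit because the residue does not involve it. -/
lemma HasMapJet.iterate_curve {F : ℂ × ℂ → ℂ × ℂ} {δ a b c d e m : ℂ}
    (h : HasMapJet F δ a b c d e m) (n : ℕ) :
    ∃ dn : ℂ, ∀ s : ℂ,
      HasJet (fun t => (F^[n] (t, s * t ^ 2)).1) 1 (n * a)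
        ((n * (n - 1) * a ^ 2 + n * c + m * b * ∑ k ∈ Finset.range n, ∑ j ∈ Finset.range k, δ ^ j) +
          m * (∑ j ∈ Finset.range n, δ ^ j) * s) ∧
      HasJet (fun t => (F^[n] (t, s * t ^ 2)).2) 0 (b * (∑ j ∈ Finset.range n, δ ^ j) + δ ^ n * s)
        (dn + n * e * δ ^ (n - 1) * s) := by
  induction n with
  | zero =>
    refine ⟨0, fun s => ⟨?_, ?_⟩⟩
    · simpa using hasJet_id
    · simpa using hasJet_sq s
  | succ n ih =>
    obtain ⟨dn, ih⟩ := ih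
    -- The part of the new `t³` coefficient of the second component that is free of `s`.
    refine ⟨d + 2 * b * (n * a) + δ * dn + e * (b * ∑ j ∈ Finset.range n, δ ^ j), fun s => ?_⟩
    have h1 := h.1.comp (γ := fun t => F^[n] (t, s * t ^ 2)) (ih s).1 (ih s).2
    have h2 := h.2.comp (γ := fun t => F^[n] (t, s * t ^ 2)) (ih s).1 (ih s).2
    simp only [Function.iterate_succ', Function.comp_apply]
    constructor
    · convert h1 using 1
      · push_cast; ring
      · rw [Finset.sum_range_succ, Finset.sum_range_succ (fun j => δ ^ j)]
        push_cast; ring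
    · have hT : ∑ j ∈ Finset.range (n + 1), δ ^ j = 1 + δ * ∑ j ∈ Finset.range n, δ ^ j := by
        rw [Finset.sum_range_succ', Finset.mul_sum, add_comm]
        simp [pow_succ']
      convert h2 using 1
      · rw [hT]; ring
      -- At `n = 0` the truncated exponent `n - 1` is harmless, since its term carries the factor
      -- `n`.
      · rcases n with _ | n
        · simp
        · simp only [Nat.add_sub_cancel]
          push_cast; ring

lemma HasMapJet.iterate {F : ℂ × ℂ → ℂ × ℂ} {δ a b c d e m : ℂ}
    (h : HasMapJet F δ a b c d e m) (hF : AnalyticAt ℂ F 0) (h0 : F 0 = 0) (n : ℕ) :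
    ∃ dn : ℂ, HasMapJet F^[n] (δ ^ n) (n * a) (b * ∑ j ∈ Finset.range n, δ ^ j)
      (n * (n - 1) * a ^ 2 + n * c + m * b * ∑ k ∈ Finset.range n, ∑ j ∈ Finset.range k, δ ^ j) dn
      (n * e * δ ^ (n - 1)) (m * ∑ j ∈ Finset.range n, δ ^ j) := by
  obtain ⟨dn, hn⟩ := h.iterate_curve n
  have hFn := analyticAt_iterate hF h0 n
  have hFn0 : F^[n] 0 = 0 := Function.iterate_fixed h0 n
  have h1 : AnalyticAt ℂ (fun z => (F^[n] z).1) 0 := analyticAt_fst.comp hFn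
  have h2 : AnalyticAt ℂ (fun z => (F^[n] z).2) 0 := analyticAt_snd.comp hFn
  obtain ⟨p₁, p₂, p₃, q₀, q₁, hp⟩ := exists_hasWeightedJet h1 (by rw [hFn0]; rfl)
  obtain ⟨u₁, u₂, u₃, v₀, v₁, hu⟩ := exists_hasWeightedJet h2 (by rw [hFn0]; rfl)
  have key1 := fun s => (hp.comp (γ := fun t => (t, s * t ^ 2)) hasJet_id (hasJet_sq s)).unique
    (hn s).1
  have key2 := fun s => (hu.comp (γ := fun t => (t, s * t ^ 2)) hasJet_id (hasJet_sq s)).unique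
    (hn s).2
  -- The value `s = 0` gives the coefficients of the powers of `x`; subtracting it from `s = 1`
  -- gives those of `y` and `x y`.
  obtain ⟨a1, a2, a3⟩ := key1 0
  obtain ⟨-, b2, b3⟩ := key1 1
  obtain ⟨c1, c2, c3⟩ := key2 0
  obtain ⟨-, d2, d3⟩ := key2 1
  simp only [mul_zero, add_zero, zero_add, mul_one] at a2 a3 b2 b3 c2 c3 d2 d3
  have hq₀ : q₀ = 0 := by linear_combination b2 - a2
  have hq₁ : q₁ = m * ∑ j ∈ Finset.range n, δ ^ j := by linear_combination b3 - a3
  have hv₀ : v₀ = δ ^ n := by linear_combination d2 - c2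
  have hv₁ : v₁ = n * e * δ ^ (n - 1) := by linear_combination d3 - c3
  refine ⟨dn, ?_, ?_⟩
  · rw [← a2, ← a3, ← hq₀, ← hq₁, ← a1]
    exact hp
  · rw [← c2, ← c3, ← hv₀, ← hv₁, ← c1]
    exact hu

/-! ### The residue of a map with a given weighted jet -/

lemma hasDerivAt_affine_add_sq_mul (p q : ℂ) {R : ℂ → ℂ} (hR : AnalyticAt ℂ R 0) :
    HasDerivAt (fun x => p + q * x + x ^ 2 * R x) q 0 := by
  have h1 := ((hasDerivAt_id (0 : ℂ)).const_mul q).const_add p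
  have h2 := (hasDerivAt_pow 2 (0 : ℂ)).mul hR.differentiableAt.hasDerivAt
  exact (h1.add h2).congr_deriv (by simp)

/-- The two functions `z - F z` are combinations of `x²` and `y` whose matrix has determinant `D`
with `D 0 = -a (1 - δ) ≠ 0`. Inverting it puts `x²` and `y` in the ideal. The inverse matrix has
determinant `1 / D`, and its derivative along the `x`-axis will be the residue. -/
lemma HasMapJet.exists_inverse {F : ℂ × ℂ → ℂ × ℂ} {δ a b c d e m : ℂ}
    (h : HasMapJet F δ a b c d e m) (ha : a ≠ 0) (hδ : δ ≠ 1) :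
    ∃ A₁₁ A₁₂ A₂₁ A₂₂ : ℂ × ℂ → ℂ,
      AnalyticAt ℂ A₁₁ 0 ∧ AnalyticAt ℂ A₁₂ 0 ∧ AnalyticAt ℂ A₂₁ 0 ∧ AnalyticAt ℂ A₂₂ 0 ∧
      (∀ᶠ z in 𝓝 (0 : ℂ × ℂ),
        z.1 ^ 2 = A₁₁ z * (z.1 - (F z).1) + A₁₂ z * (z.2 - (F z).2)) ∧
      (∀ᶠ z in 𝓝 (0 : ℂ × ℂ),
        z.2 = A₂₁ z * (z.1 - (F z).1) + A₂₂ z * (z.2 - (F z).2)) ∧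
      HasDerivAt (fun x => A₁₁ (x, 0) * A₂₂ (x, 0) - A₁₂ (x, 0) * A₂₁ (x, 0))
        ((c * (1 - δ) - a * e + m * b) / (a ^ 2 * (1 - δ) ^ 2)) 0 := by
  obtain ⟨⟨C₁, M₁, N₁, hC₁, hM₁, hN₁, h₁⟩, ⟨C₂, M₂, N₂, hC₂, hM₂, hN₂, h₂⟩⟩ := h
  have hδ' : 1 - δ ≠ 0 := sub_ne_zero.2 (Ne.symm hδ)
  have lift : ∀ {C : ℂ → ℂ}, AnalyticAt ℂ C 0 → AnalyticAt ℂ (fun z : ℂ × ℂ => C z.1) 0 :=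
    fun hC => AnalyticAt.fun_comp (g := _) (f := Prod.fst) (by exact hC) analyticAt_fst
  have hx : AnalyticAt ℂ (fun z : ℂ × ℂ => z.1) 0 := analyticAt_fst
  have hy : AnalyticAt ℂ (fun z : ℂ × ℂ => z.2) 0 := analyticAt_snd
  let B₁ : ℂ × ℂ → ℂ := fun z => -(a + c * z.1 + z.1 ^ 2 * C₁ z.1)
  let B₂ : ℂ × ℂ → ℂ := fun z => -(b + d * z.1 + z.1 ^ 2 * C₂ z.1)
  let A₁ : ℂ × ℂ → ℂ := fun z => -(m * z.1 + z.1 ^ 2 * M₁ z.1 + z.2 * N₁ z)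
  let A₂ : ℂ × ℂ → ℂ := fun z => 1 - (δ + e * z.1 + z.1 ^ 2 * M₂ z.1 + z.2 * N₂ z)
  have hB₁ : AnalyticAt ℂ B₁ 0 :=
    ((analyticAt_const.add (analyticAt_const.mul hx)).add ((hx.pow 2).mul (lift hC₁))).neg
  have hB₂ : AnalyticAt ℂ B₂ 0 :=
    ((analyticAt_const.add (analyticAt_const.mul hx)).add ((hx.pow 2).mul (lift hC₂))).neg
  have hA₁ : AnalyticAt ℂ A₁ 0 :=
    (((analyticAt_const.mul hx).add ((hx.pow 2).mul (lift hM₁))).add (hy.mul hN₁)).neg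
  have hA₂ : AnalyticAt ℂ A₂ 0 :=
    analyticAt_const.sub (((analyticAt_const.add (analyticAt_const.mul hx)).add
      ((hx.pow 2).mul (lift hM₂))).add (hy.mul hN₂))
  let D : ℂ × ℂ → ℂ := fun z => B₁ z * A₂ z - A₁ z * B₂ z
  have hD : AnalyticAt ℂ D 0 := (hB₁.mul hA₂).sub (hA₁.mul hB₂)
  have hD0' : D (0, 0) = -(a * (1 - δ)) := by simp [D, B₁, B₂, A₁, A₂]
  have hD0 : D 0 ≠ 0 := by
    change D (0, 0) ≠ 0
    rw [hD0']
    exact neg_ne_zero.2 (mul_ne_zero ha hδ')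
  have hDne : ∀ᶠ z in 𝓝 (0 : ℂ × ℂ), D z ≠ 0 := hD.continuousAt.eventually_ne hD0
  -- Cramer's rule for the matrix with rows `(B₁, A₁)` and `(B₂, A₂)`.
  refine ⟨fun z => A₂ z / D z, fun z => -A₁ z / D z, fun z => -B₂ z / D z, fun z => B₁ z / D z,
    hA₂.div hD hD0, hA₁.neg.div hD hD0, hB₂.neg.div hD hD0, hB₁.div hD hD0, ?_, ?_, ?_⟩
  · filter_upwards [h₁, h₂, hDne] with z e₁ e₂ hz
    have f₁ : z.1 - (F z).1 = z.1 ^ 2 * B₁ z + z.2 * A₁ z := by rw [e₁]; simp only [B₁, A₁]; ring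
    have f₂ : z.2 - (F z).2 = z.1 ^ 2 * B₂ z + z.2 * A₂ z := by rw [e₂]; simp only [B₂, A₂]; ring
    rw [f₁, f₂]
    field_simp
    simp only [D]
    ring
  · filter_upwards [h₁, h₂, hDne] with z e₁ e₂ hz
    have f₁ : z.1 - (F z).1 = z.1 ^ 2 * B₁ z + z.2 * A₁ z := by rw [e₁]; simp only [B₁, A₁]; ring
    have f₂ : z.2 - (F z).2 = z.1 ^ 2 * B₂ z + z.2 * A₂ z := by rw [e₂]; simp only [B₂, A₂]; ring
    rw [f₁, f₂]
    field_simp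
    simp only [D]
    ring
  · let R : ℂ → ℂ := fun x => -C₁ x * (1 - δ - e * x - x ^ 2 * M₂ x) + (a + c * x) * M₂ x + c * e -
      (m * (d + x * C₂ x) + M₁ x * (b + d * x + x ^ 2 * C₂ x))
    have hR : AnalyticAt ℂ R 0 := by fun_prop
    have hDx : (fun x : ℂ => D (x, 0)) =
        fun x => -(a * (1 - δ)) + (a * e - c * (1 - δ) - m * b) * x + x ^ 2 * R x := by
      funext x
      simp only [D, B₁, B₂, A₁, A₂, R]
      ring
    have hDd : HasDerivAt (fun x : ℂ => D (x, 0)) (a * e - c * (1 - δ) - m * b) 0 := by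
      rw [hDx]
      exact hasDerivAt_affine_add_sq_mul _ _ hR
    have hinv := hDd.fun_inv hD0
    have hcont : Filter.Tendsto (fun x : ℂ => (x, (0 : ℂ))) (𝓝 0) (𝓝 0) :=
      (by fun_prop : Continuous fun x : ℂ => (x, (0 : ℂ))).tendsto' _ _ rfl
    refine HasDerivAt.congr_of_eventuallyEq (hinv.congr_deriv ?_) ?_
    · rw [hD0']
      field_simp
      ring
    · filter_upwards [hcont.eventually hDne] with x hx
      field_simp
      simp only [D]
      ring

lemma taylorCoeff_one_zero (h : ℂ × ℂ → ℂ) : taylorCoeff h 1 0 = deriv (fun x => h (x, 0)) 0 := by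
  simp [taylorCoeff]

lemma HasMapJet.hasResidue {F : ℂ × ℂ → ℂ × ℂ} {δ a b c d e m : ℂ}
    (h : HasMapJet F δ a b c d e m) (ha : a ≠ 0) (hδ : δ ≠ 1) :
    HasResidue (fun _ => 1) (fun z => z.1 - (F z).1) (fun z => z.2 - (F z).2)
      ((c * (1 - δ) - a * e + m * b) / (a ^ 2 * (1 - δ) ^ 2)) := by
  obtain ⟨A₁₁, A₁₂, A₂₁, A₂₂, h₁₁, h₁₂, h₂₁, h₂₂, e₁, e₂, hd⟩ := h.exists_inverse ha hδ
  -- The monomial denominators are `x²` and `y`, so the residue is the coefficient of `x` in the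
  -- determinant.
  refine ⟨1, 0, A₁₁, A₁₂, A₂₁, A₂₂, h₁₁, h₁₂, h₂₁, h₂₂, e₁, ?_, ?_⟩
  · simpa using e₂
  · rw [taylorCoeff_one_zero]
    simpa using hd.deriv

/-! ### Taylor coefficients -/

lemma exists_taylor_expansion {g : ℂ × ℂ → ℂ} (hg : AnalyticAt ℂ g 0) (h0 : g 0 = 0) :
    ∃ (C M : ℂ → ℂ) (N : ℂ × ℂ → ℂ), AnalyticAt ℂ C 0 ∧ AnalyticAt ℂ M 0 ∧ AnalyticAt ℂ N 0 ∧
      ∀ᶠ z in 𝓝 (0 : ℂ × ℂ), g z = taylorCoeff g 1 0 * z.1 + taylorCoeff g 2 0 * z.1 ^ 2 +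
        z.1 ^ 3 * C z.1 + z.2 * (taylorCoeff g 0 1 + z.1 * M z.1 + z.2 * N z) := by
  obtain ⟨A, hA, hA'⟩ := exists_division_snd hg
  obtain ⟨N, hN, hN'⟩ := exists_division_snd hA
  obtain ⟨B₁, hB₁, e₁⟩ := exists_division (analyticAt_slice_fst hg)
  obtain ⟨B₂, hB₂, e₂⟩ := exists_division hB₁
  obtain ⟨C, hC, e₃⟩ := exists_division hB₂
  obtain ⟨M, hM, f₁⟩ := exists_division (analyticAt_slice_fst hA)
  have h00 : g ((0 : ℂ), (0 : ℂ)) = 0 := h0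
  have hslice : (fun x => g (x, 0)) = fun x => 0 + B₁ 0 * x + x ^ 2 * B₂ x := by
    funext x
    rw [e₁ x, e₂ x, h00]
    ring
  have t10 : taylorCoeff g 1 0 = B₁ 0 := by
    rw [taylorCoeff_one_zero, hslice]
    exact (hasDerivAt_affine_add_sq_mul _ _ hB₂).deriv
  have t20 : taylorCoeff g 2 0 = B₂ 0 := by
    have hd : deriv (fun x => g (x, 0)) =ᶠ[𝓝 0]
        fun x => B₁ 0 + x * (2 * B₂ x + x * deriv B₂ x) := by
      rw [hslice]
      filter_upwards [hB₂.eventually_analyticAt] with x hx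
      have h1 := ((hasDerivAt_id x).const_mul (B₁ 0)).const_add (0 : ℂ)
      have h2 := (hasDerivAt_pow 2 x).mul hx.differentiableAt.hasDerivAt
      refine (h1.add h2).deriv.trans ?_
      push_cast
      ring
    have hd2 : HasDerivAt (fun x => B₁ 0 + x * (2 * B₂ x + x * deriv B₂ x)) (2 * B₂ 0) 0 := by
      have hq : AnalyticAt ℂ (fun x => 2 * B₂ x + x * deriv B₂ x) 0 :=
        (analyticAt_const.mul hB₂).add (analyticAt_id.mul hB₂.deriv)
      have := ((hasDerivAt_id (0 : ℂ)).mul hq.differentiableAt.hasDerivAt).const_add (B₁ 0)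
      simpa using this
    have : iteratedDeriv 2 (fun x => g (x, 0)) 0 = 2 * B₂ 0 := by
      rw [iteratedDeriv_succ, iteratedDeriv_one, hd.deriv_eq, hd2.deriv]
    simp [taylorCoeff, this]
  have t01 : taylorCoeff g 0 1 = A (0, 0) := by
    have hcont : Filter.Tendsto (fun y : ℂ => ((0 : ℂ), y)) (𝓝 0) (𝓝 0) :=
      (by fun_prop : Continuous fun y : ℂ => ((0 : ℂ), y)).tendsto' _ _ rfl
    have he : (fun y : ℂ => g (0, y)) =ᶠ[𝓝 0] fun y => y * A (0, y) := by
      filter_upwards [hcont.eventually hA'] with y hy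
      rw [hy]
      simp [h00]
    have hAy : AnalyticAt ℂ (fun y : ℂ => A (0, y)) 0 :=
      AnalyticAt.fun_comp (f := fun y : ℂ => ((0 : ℂ), y)) (by exact hA)
        (analyticAt_const.prod analyticAt_id)
    have hd := (hasDerivAt_id (0 : ℂ)).mul hAy.differentiableAt.hasDerivAt
    have hd' : deriv (fun y : ℂ => y * A (0, y)) 0 = A (0, 0) := by
      refine hd.deriv.trans ?_
      simp
    simp [taylorCoeff, he.deriv_eq, hd']
  refine ⟨C, M, N, hC, hM, hN, ?_⟩
  filter_upwards [hA', hN'] with z hz hz'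
  rw [hz, hz', e₁ z.1, e₂ z.1, e₃ z.1, f₁ z.1, t10, t20, t01, h00]
  ring

lemma hasMapJet_of_eventuallyEq {F : ℂ × ℂ → ℂ × ℂ} {δ : ℂ} {g₁ g₂ : ℂ × ℂ → ℂ}
    (h₁ : AnalyticAt ℂ g₁ 0) (h₂ : AnalyticAt ℂ g₂ 0) (h₁0 : g₁ 0 = 0) (h₂0 : g₂ 0 = 0)
    (h : ∀ᶠ z in 𝓝 (0 : ℂ × ℂ), F z = (z.1 * (1 + g₁ z), δ * (z.2 + z.1 * g₂ z))) :
    HasMapJet F δ (taylorCoeff g₁ 1 0) (δ * taylorCoeff g₂ 1 0) (taylorCoeff g₁ 2 0)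
      (δ * taylorCoeff g₂ 2 0) (δ * taylorCoeff g₂ 0 1) (taylorCoeff g₁ 0 1) := by
  obtain ⟨C₁, M₁, N₁, hC₁, hM₁, hN₁, e₁⟩ := exists_taylor_expansion h₁ h₁0
  obtain ⟨C₂, M₂, N₂, hC₂, hM₂, hN₂, e₂⟩ := exists_taylor_expansion h₂ h₂0
  refine ⟨⟨C₁, M₁, fun z => z.1 * N₁ z, hC₁, hM₁, analyticAt_fst.mul hN₁, ?_⟩,
    ⟨fun x => δ * C₂ x, fun x => δ * M₂ x, fun z => δ * (z.1 * N₂ z), analyticAt_const.mul hC₂,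
      analyticAt_const.mul hM₂, analyticAt_const.mul (analyticAt_fst.mul hN₂), ?_⟩⟩
  · filter_upwards [h, e₁] with z hz ez
    rw [hz, ez]
    ring
  · filter_upwards [h, e₂] with z hz ez
    rw [hz, ez]
    ring

/-! ### Volume forms -/

/-- The determinant of an endomorphism of `ℂ²`. -/
def det₂ (L : ℂ × ℂ →L[ℂ] ℂ × ℂ) : ℂ := (L (1, 0)).1 * (L (0, 1)).2 - (L (0, 1)).1 * (L (1, 0)).2

/-- Supplies the Jacobian to first order along the `x`-axis, where the volume relation is tested. -/
lemma HasWeightedJet.exists_fderiv {h : ℂ × ℂ → ℂ} {h₁ h₂ h₃ k₀ k₁ : ℂ}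
    (hj : HasWeightedJet h h₁ h₂ h₃ k₀ k₁) (hh : AnalyticAt ℂ h 0) :
    ∃ R S : ℂ → ℂ, AnalyticAt ℂ R 0 ∧ AnalyticAt ℂ S 0 ∧ ∀ᶠ t in 𝓝 (0 : ℂ),
      fderiv ℂ h (t, 0) (1, 0) = h₁ + 2 * h₂ * t + t ^ 2 * R t ∧
      fderiv ℂ h (t, 0) (0, 1) = k₀ + k₁ * t + t ^ 2 * S t := by
  obtain ⟨C, M, N, hC, hM, hN, hj⟩ := hj
  refine ⟨fun t => 3 * h₃ + 4 * t * C t + t ^ 2 * deriv C t, M, ?_, hM, ?_⟩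
  · have := hC.deriv
    fun_prop
  have hcont : Filter.Tendsto (fun x : ℂ => (x, (0 : ℂ))) (𝓝 0) (𝓝 0) :=
    (by fun_prop : Continuous fun x : ℂ => (x, (0 : ℂ))).tendsto' _ _ rfl
  filter_upwards [hcont.eventually hj.eventually_nhds, hcont.eventually hh.eventually_analyticAt,
    hcont.eventually hN.eventually_analyticAt, hC.eventually_analyticAt] with t ht hht hNt hCt
  constructor
  · have h1 : HasDerivAt (fun x : ℂ => (x, (0 : ℂ))) (1, 0) t :=
      (hasDerivAt_id t).prodMk (hasDerivAt_const _ _)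
    have h2 := (hht.differentiableAt.hasFDerivAt).comp_hasDerivAt t h1
    have h3 : HasDerivAt (fun x => h₁ * x + h₂ * x ^ 2 + h₃ * x ^ 3 + x ^ 4 * C x)
        (h₁ * 1 + h₂ * (2 * t) + h₃ * (3 * t ^ 2) + (4 * t ^ 3 * C t + t ^ 4 * deriv C t)) t := by
      have p2 : HasDerivAt (fun x : ℂ => x ^ 2) (2 * t) t := by simpa using hasDerivAt_pow 2 t
      have p3 : HasDerivAt (fun x : ℂ => x ^ 3) (3 * t ^ 2) t := by simpa using hasDerivAt_pow 3 t
      have p4 : HasDerivAt (fun x : ℂ => x ^ 4) (4 * t ^ 3) t := by simpa using hasDerivAt_pow 4 t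
      exact ((((hasDerivAt_id t).const_mul h₁).add (p2.const_mul h₂)).add (p3.const_mul h₃)).add
        (p4.mul hCt.differentiableAt.hasDerivAt)
    have hc : Filter.Tendsto (fun x : ℂ => (x, (0 : ℂ))) (𝓝 t) (𝓝 (t, 0)) :=
      (by fun_prop : Continuous fun x : ℂ => (x, (0 : ℂ))).tendsto _
    have h4 := h3.congr_of_eventuallyEq (f₁ := fun x => h (x, 0)) (by
      filter_upwards [hc.eventually ht] with x hx
      rw [hx]
      simp)
    rw [h2.unique h4]
    ring
  · have h1 : HasDerivAt (fun y : ℂ => (t, y)) (0, 1) 0 :=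
      (hasDerivAt_const _ _).prodMk (hasDerivAt_id 0)
    have h2 := (hht.differentiableAt.hasFDerivAt).comp_hasDerivAt (0 : ℂ) h1
    have hc : Filter.Tendsto (fun y : ℂ => (t, y)) (𝓝 0) (𝓝 (t, 0)) :=
      (by fun_prop : Continuous fun y : ℂ => (t, y)).tendsto _
    have hN1 : HasDerivAt (fun y => N (t, y)) (fderiv ℂ N (t, 0) (0, 1)) 0 :=
      (hNt.differentiableAt.hasFDerivAt).comp_hasDerivAt (0 : ℂ) h1
    have h3 := (((hasDerivAt_id (0 : ℂ)).mul
      (((hasDerivAt_id (0 : ℂ)).mul hN1).const_add (k₀ + k₁ * t + t ^ 2 * M t)))).const_add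
      (h₁ * t + h₂ * t ^ 2 + h₃ * t ^ 3 + t ^ 4 * C t)
    have h4 := h3.congr_of_eventuallyEq (f₁ := fun y => h (t, y)) (by
      filter_upwards [hc.eventually ht] with y hy
      rw [hy]
      simp)
    rw [h2.unique h4]
    simp

lemma fderiv_fst_apply {F : ℂ × ℂ → ℂ × ℂ} {z : ℂ × ℂ} (hF : DifferentiableAt ℂ F z) (v : ℂ × ℂ) :
    (fderiv ℂ F z v).1 = fderiv ℂ (fun z => (F z).1) z v := by
  rw [fderiv.fst hF]
  rfl

lemma fderiv_snd_apply {F : ℂ × ℂ → ℂ × ℂ} {z : ℂ × ℂ} (hF : DifferentiableAt ℂ F z) (v : ℂ × ℂ) :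
    (fderiv ℂ F z v).2 = fderiv ℂ (fun z => (F z).2) z v := by
  rw [fderiv.snd hF]
  rfl

/-- A map which multiplies the volume form `w dx ∧ dy` by `δ` satisfies a relation between
its second order coefficients. -/
lemma HasMapJet.eq_of_volume {F : ℂ × ℂ → ℂ × ℂ} {δ a b c d e m : ℂ}
    (h : HasMapJet F δ a b c d e m) (hF : AnalyticAt ℂ F 0) (hF0 : F 0 = 0) {w : ℂ × ℂ → ℂ}
    (hw : DifferentiableAt ℂ w 0) (hw0 : w 0 ≠ 0)
    (hvol : ∀ᶠ z in 𝓝 (0 : ℂ × ℂ), w (F z) * det₂ (fderiv ℂ F z) = δ * w z) :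
    e = -2 * a * δ := by
  obtain ⟨R₁, S₁, hR₁, hS₁, h₁⟩ := h.1.exists_fderiv (analyticAt_fst.comp hF)
  obtain ⟨R₂, S₂, hR₂, hS₂, h₂⟩ := h.2.exists_fderiv (analyticAt_snd.comp hF)
  have hcont : Filter.Tendsto (fun x : ℂ => (x, (0 : ℂ))) (𝓝 0) (𝓝 0) :=
    (by fun_prop : Continuous fun x : ℂ => (x, (0 : ℂ))).tendsto' _ _ rfl
  let R : ℂ → ℂ := fun t => (2 * a) * e + (1 + 2 * a * t) * S₂ t + R₁ t * (δ + e * t + t ^ 2 * S₂ t)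
    - (m + t * S₁ t) * (2 * b + t * R₂ t)
  have hR : AnalyticAt ℂ R 0 := by fun_prop
  have hdet : (fun t : ℂ => det₂ (fderiv ℂ F (t, 0))) =ᶠ[𝓝 0]
      fun t => δ + (e + 2 * a * δ) * t + t ^ 2 * R t := by
    filter_upwards [h₁, h₂, hcont.eventually hF.eventually_analyticAt] with t e₁ e₂ ht
    have hd := ht.differentiableAt
    rw [det₂, fderiv_fst_apply hd, fderiv_fst_apply hd, fderiv_snd_apply hd, fderiv_snd_apply hd,
      e₁.1, e₁.2, e₂.1, e₂.2]
    simp only [R]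
    ring
  have hdetd : HasDerivAt (fun t : ℂ => det₂ (fderiv ℂ F (t, 0))) (e + 2 * a * δ) 0 :=
    (hasDerivAt_affine_add_sq_mul _ _ hR).congr_of_eventuallyEq hdet
  have hdet0 : det₂ (fderiv ℂ F (0, 0)) = δ := by simpa using hdet.self_of_nhds
  have hx : HasDerivAt (fun x : ℂ => (x, (0 : ℂ))) (1, 0) 0 :=
    (hasDerivAt_id _).prodMk (hasDerivAt_const _ _)
  have hw1 : HasDerivAt (fun t : ℂ => w (t, 0)) (fderiv ℂ w 0 (1, 0)) 0 :=
    HasFDerivAt.comp_hasDerivAt (0 : ℂ) (f := fun x : ℂ => (x, (0 : ℂ))) hw.hasFDerivAt hx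
  have hF1 : HasDerivAt (fun t : ℂ => F (t, 0)) (fderiv ℂ F 0 (1, 0)) 0 :=
    HasFDerivAt.comp_hasDerivAt (0 : ℂ) (f := fun x : ℂ => (x, (0 : ℂ)))
      hF.differentiableAt.hasFDerivAt hx
  -- The differential fixes the `x`-direction, so `w ∘ F` and `w` have the same derivative along the
  -- axis. These derivatives cancel in the first-order volume relation, leaving `w 0 * (e + 2 a δ) =
  -- 0`.
  have hF1' : fderiv ℂ F 0 (1, 0) = (1, 0) := by
    refine Prod.ext ?_ ?_
    · rw [fderiv_fst_apply hF.differentiableAt]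
      exact h₁.self_of_nhds.1.trans (by simp)
    · rw [fderiv_snd_apply hF.differentiableAt]
      exact h₂.self_of_nhds.1.trans (by simp)
  rw [hF1'] at hF1
  have hF00 : F (0, 0) = 0 := hF0
  have hw2 : HasDerivAt (fun t : ℂ => w (F (t, 0))) (fderiv ℂ w 0 (1, 0)) 0 :=
    HasFDerivAt.comp_hasDerivAt (0 : ℂ) (f := fun x : ℂ => F (x, 0))
      (by rw [hF00]; exact hw.hasFDerivAt) hF1
  have h3 := (hw2.mul hdetd).unique ((hw1.const_mul δ).congr_of_eventuallyEq (by
    filter_upwards [hcont.eventually hvol] with t ht using ht))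
  rw [hdet0, hF00] at h3
  have h4 : w 0 * (e + 2 * a * δ) = 0 := by linear_combination h3
  linear_combination (mul_eq_zero.1 h4).resolve_left hw0

/-! ### Bounds for the local multiplicity -/

/-- The germ of an analytic function, as a convergent power series. -/
def germOf (h : ℂ × ℂ → ℂ) (hh : AnalyticAt ℂ h 0) : convergentSeries :=
  ⟨(h : Filter.Germ (𝓝 (0 : ℂ × ℂ)) ℂ), h, hh, rfl⟩

lemma mem_fixedIdeal {F : ℂ × ℂ → ℂ × ℂ} (hF : AnalyticAt ℂ F 0) {h : ℂ × ℂ → ℂ}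
    (hh : AnalyticAt ℂ h 0) : germOf h hh ∈ fixedIdeal F ↔
      ∃ A B : ℂ × ℂ → ℂ, AnalyticAt ℂ A 0 ∧ AnalyticAt ℂ B 0 ∧
        ∀ᶠ z in 𝓝 (0 : ℂ × ℂ), h z = A z * (z.1 - (F z).1) + B z * (z.2 - (F z).2) := by
  have h₁ : AnalyticAt ℂ (fun z : ℂ × ℂ => z.1 - (F z).1) 0 :=
    analyticAt_fst.sub (analyticAt_fst.comp hF)
  have h₂ : AnalyticAt ℂ (fun z : ℂ × ℂ => z.2 - (F z).2) 0 :=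
    analyticAt_snd.sub (analyticAt_snd.comp hF)
  have hspan : fixedIdeal F = Ideal.span {germOf _ h₁, germOf _ h₂} := by
    rw [fixedIdeal]
    congr 1
    ext φ
    simp only [Set.mem_ofPred_eq, Set.mem_insert_iff, Set.mem_singleton_iff, Subtype.ext_iff]
    rfl
  rw [hspan, Ideal.mem_span_pair]
  constructor
  · rintro ⟨⟨_, A, hA, rfl⟩, ⟨_, B, hB, rfl⟩, e⟩
    refine ⟨A, B, hA, hB, ?_⟩
    have e' := congrArg Subtype.val e
    have e'' : ((fun z => A z * (z.1 - (F z).1) + B z * (z.2 - (F z).2) : ℂ × ℂ → ℂ) :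
      Filter.Germ (𝓝 (0 : ℂ × ℂ)) ℂ) = (h : Filter.Germ (𝓝 (0 : ℂ × ℂ)) ℂ) := e'
    exact (Filter.Germ.coe_eq.1 e'').symm
  · rintro ⟨A, B, hA, hB, e⟩
    exact ⟨germOf A hA, germOf B hB, Subtype.ext (Filter.Germ.coe_eq.2 (Filter.EventuallyEq.symm e))⟩

/-- Here `u` is comparable to `t`. The constant term vanishes in the limit, and dividing by `u`
lowers the order by one, which drives the induction. -/
lemma eq_zero_of_sum_pow_isBigO {u : ℂ → ℂ} {u' : ℂ} (hu : HasDerivAt u u' 0) (hu' : u' ≠ 0)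
    (hu0 : u 0 = 0) (k : ℕ) (g : ℕ → ℂ)
    (h : (fun t => ∑ i ∈ Finset.range k, g i * u t ^ i) =O[𝓝[≠] 0] fun t : ℂ => t ^ k) :
    ∀ i < k, g i = 0 := by
  induction k generalizing g with
  | zero => intro i hi; omega
  | succ k ih =>
    have hut : (fun t : ℂ => t) =O[𝓝[≠] 0] u := by
      have h1 := hu.tendsto_slope_zero
      simp only [zero_add, hu0, sub_zero, smul_eq_mul] at h1
      have h2 := ((h1.inv₀ hu').isBigO_one ℂ).mul (Asymptotics.isBigO_refl u (𝓝[≠] 0))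
      simp only [one_mul] at h2
      refine h2.congr' ?_ Filter.EventuallyEq.rfl
      filter_upwards [self_mem_nhdsWithin, h1.eventually_ne hu'] with t ht ht'
      have : u t ≠ 0 := fun h => ht' (by rw [h, mul_zero])
      have ht0 : t ≠ 0 := ht
      field_simp
    have hsum : ∀ t, ∑ i ∈ Finset.range (k + 1), g i * u t ^ i =
        g 0 + u t * ∑ i ∈ Finset.range k, g (i + 1) * u t ^ i := by
      intro t
      rw [Finset.sum_range_succ', Finset.mul_sum, add_comm]
      congr 1
      · simp
      · exact Finset.sum_congr rfl fun i _ => by ring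
    simp_rw [hsum] at h
    have hg0 : g 0 = 0 := by
      have hc : ContinuousAt
          (fun t => g 0 + u t * ∑ i ∈ Finset.range k, g (i + 1) * u t ^ i) 0 := by
        have := hu.continuousAt
        fun_prop
      have t1 := h.trans_tendsto (((continuous_pow (k + 1)).tendsto' (0 : ℂ) 0
        (by simp)).mono_left nhdsWithin_le_nhds)
      have t2 := tendsto_nhds_unique (hc.tendsto.mono_left nhdsWithin_le_nhds) t1
      simpa [hu0] using t2
    simp only [hg0, zero_add] at h
    have h2 : (fun t => t * ∑ i ∈ Finset.range k, g (i + 1) * u t ^ i) =O[𝓝[≠] 0]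
        fun t : ℂ => t ^ (k + 1) :=
      (hut.mul (Asymptotics.isBigO_refl _ _)).trans h
    have h3 : (fun t => ∑ i ∈ Finset.range k, g (i + 1) * u t ^ i) =O[𝓝[≠] 0]
        fun t : ℂ => t ^ k := by
      obtain ⟨K, hK⟩ := h2.bound
      refine Asymptotics.IsBigO.of_bound K ?_
      filter_upwards [hK, self_mem_nhdsWithin] with t ht ht0
      rw [norm_mul, pow_succ', norm_mul, mul_left_comm] at ht
      exact le_of_mul_le_mul_left ht (norm_pos_iff.2 ht0)
    intro i hi
    rcases i with _ | i
    · exact hg0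
    · exact ih _ h3 i (by omega)

/-- If a smooth arc `γ` is fixed by `F` up to order `k`, then the multiplicity is at least `k`. -/
lemma le_localMultiplicity {F : ℂ × ℂ → ℂ × ℂ} (hF : AnalyticAt ℂ F 0) {γ : ℂ → ℂ × ℂ}
    {v : ℂ × ℂ} (hγ : HasDerivAt γ v 0) (hγ0 : γ 0 = 0) (hv : v ≠ 0) (k : ℕ)
    (hk : (fun t => γ t - F (γ t)) =O[𝓝 0] fun t : ℂ => t ^ k) :
    (k : ℕ∞) ≤ localMultiplicity F := by
  -- A coordinate `L` that serves as a parameter on the arc. Elements of the ideal are `O(t^k)`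
  -- along `γ`, so `1, L, …, L^(k-1)` are independent modulo it.
  obtain ⟨L, hL⟩ : ∃ L : ℂ × ℂ →L[ℂ] ℂ, L v ≠ 0 := by
    by_cases h1 : v.1 = 0
    · exact ⟨ContinuousLinearMap.snd ℂ ℂ ℂ, fun h2 => hv (Prod.ext h1 h2)⟩
    · exact ⟨ContinuousLinearMap.fst ℂ ℂ ℂ, h1⟩
  have hLγ : HasDerivAt (fun t => L (γ t)) (L v) 0 := L.hasFDerivAt.comp_hasDerivAt (0 : ℂ) hγ
  have hγt : Filter.Tendsto γ (𝓝 0) (𝓝 0) := by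
    have := hγ.continuousAt.tendsto
    rwa [hγ0] at this
  let l := germOf L (L.analyticAt 0)
  have hli : LinearIndependent ℂ fun i : Fin k => (Ideal.Quotient.mkₐ ℂ (fixedIdeal F) l) ^ (i : ℕ) := by
    rw [Fintype.linearIndependent_iff]
    intro g hg
    let g' : ℕ → ℂ := fun i => if hi : i < k then g ⟨i, hi⟩ else 0
    have hP : AnalyticAt ℂ (fun z : ℂ × ℂ => ∑ i ∈ Finset.range k, g' i * L z ^ i) 0 :=
      Finset.analyticAt_fun_sum _ fun i _ => analyticAt_const.mul ((L.analyticAt 0).pow i)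
    have hmem : germOf _ hP ∈ fixedIdeal F := by
      rw [← Ideal.Quotient.eq_zero_iff_mem, ← hg]
      have : germOf _ hP = ∑ i : Fin k, g i • l ^ (i : ℕ) := by
        refine Subtype.ext ?_
        rw [AddSubmonoidClass.coe_finsetSum]
        have e1 : (fun z : ℂ × ℂ => ∑ i ∈ Finset.range k, g' i * L z ^ i) =
            ∑ i : Fin k, g i • (L : ℂ × ℂ → ℂ) ^ (i : ℕ) := by
          funext z
          rw [Finset.sum_apply, Finset.sum_range]
          exact Finset.sum_congr rfl fun i _ => by simp [g']
        have e2 : ((∑ i : Fin k, g i • (L : ℂ × ℂ → ℂ) ^ (i : ℕ) : ℂ × ℂ → ℂ) :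
            Filter.Germ (𝓝 (0 : ℂ × ℂ)) ℂ) =
            ∑ i : Fin k, ((g i • (L : ℂ × ℂ → ℂ) ^ (i : ℕ) : ℂ × ℂ → ℂ) :
              Filter.Germ (𝓝 (0 : ℂ × ℂ)) ℂ) :=
          map_sum (Filter.Germ.coeAddHom (M := ℂ) (𝓝 (0 : ℂ × ℂ))) _ _
        change ((fun z : ℂ × ℂ => ∑ i ∈ Finset.range k, g' i * L z ^ i : ℂ × ℂ → ℂ) :
          Filter.Germ (𝓝 (0 : ℂ × ℂ)) ℂ) = _
        rw [e1, e2]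
        rfl
      rw [this, ← Ideal.Quotient.mkₐ_eq_mk ℂ, map_sum]
      exact Finset.sum_congr rfl fun i _ => by rw [map_smul, map_pow]
    obtain ⟨A, B, hA, hB, e⟩ := (mem_fixedIdeal hF hP).1 hmem
    have hO : (fun t => ∑ i ∈ Finset.range k, g' i * L (γ t) ^ i) =O[𝓝 0] fun t : ℂ => t ^ k := by
      have k1 := Asymptotics.isBigO_fst_prod.trans hk
      have k2 := Asymptotics.isBigO_snd_prod.trans hk
      have a1 : (fun t => A (γ t)) =O[𝓝 0] fun _ : ℂ => (1 : ℂ) :=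
        (hA.continuousAt.tendsto.comp hγt).isBigO_one ℂ
      have b1 : (fun t => B (γ t)) =O[𝓝 0] fun _ : ℂ => (1 : ℂ) :=
        (hB.continuousAt.tendsto.comp hγt).isBigO_one ℂ
      have := (a1.mul k1).add (b1.mul k2)
      simp only [one_mul] at this
      refine this.congr' ?_ Filter.EventuallyEq.rfl
      filter_upwards [hγt.eventually e] with t ht
      rw [ht]
    have := eq_zero_of_sum_pow_isBigO hLγ hL (by simp [hγ0]) k g' (hO.mono nhdsWithin_le_nhds)
    intro i
    simpa [g'] using this i i.2
  have := hli.cardinal_le_rank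
  rw [Cardinal.mk_fin] at this
  exact Cardinal.natCast_le_toENat.2 this

/-- Transport of `le_localMultiplicity` along a change of coordinates. -/
lemma le_localMultiplicity_of_semiconj {F G φ : ℂ × ℂ → ℂ × ℂ} (hG : AnalyticAt ℂ G 0)
    (hφ : AnalyticAt ℂ φ 0) (hφ0 : φ 0 = 0) (hφ' : Function.Injective (fderiv ℂ φ 0))
    (hF : ContinuousAt F 0) (hF0 : F 0 = 0)
    (hconj : ∀ᶠ z in 𝓝 (0 : ℂ × ℂ), G (φ z) = φ (F z)) {γ : ℂ → ℂ × ℂ}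
    {v : ℂ × ℂ} (hγ : HasDerivAt γ v 0) (hγ0 : γ 0 = 0) (hv : v ≠ 0) (k : ℕ)
    (hk : (fun t => γ t - F (γ t)) =O[𝓝 0] fun t : ℂ => t ^ k) :
    (k : ℕ∞) ≤ localMultiplicity G := by
  have hγt : Filter.Tendsto γ (𝓝 0) (𝓝 0) := by
    have := hγ.continuousAt.tendsto
    rwa [hγ0] at this
  have hFt : Filter.Tendsto F (𝓝 0) (𝓝 0) := by
    have := hF.tendsto
    rwa [hF0] at this
  refine le_localMultiplicity hG (γ := fun t => φ (γ t)) (v := fderiv ℂ φ 0 v) ?_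
    (by rw [hγ0, hφ0]) (fun h => hv (hφ' (h.trans (map_zero _).symm))) k ?_
  · exact HasFDerivAt.comp_hasDerivAt (0 : ℂ) (f := γ)
      (by rw [hγ0]; exact hφ.differentiableAt.hasFDerivAt) hγ
  -- Strict differentiability makes `φ` Lipschitz near `0`, so `φ (γ t) - φ (F (γ t))` has the same
  -- order of vanishing.
  · have h1 : Filter.Tendsto (fun t => (γ t, F (γ t))) (𝓝 0) (𝓝 ((0 : ℂ × ℂ), (0 : ℂ × ℂ))) :=
      hγt.prodMk_nhds (hFt.comp hγt)
    have h2 := (hφ.hasStrictFDerivAt.isBigO_sub.comp_tendsto h1).trans hk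
    refine h2.congr' ?_ Filter.EventuallyEq.rfl
    filter_upwards [hγt.eventually hconj] with t ht
    simp [ht]

lemma HasJet.isBigO_sq {φ : ℂ → ℂ} {c₁ c₂ c₃ d₂ d₃ : ℂ} {ψ : ℂ → ℂ} (h : HasJet φ c₁ c₂ c₃)
    (h' : HasJet ψ c₁ d₂ d₃) : (fun t => ψ t - φ t) =O[𝓝 0] fun t => t ^ 2 := by
  obtain ⟨ξ, hξ, h⟩ := h
  obtain ⟨η, hη, h'⟩ := h'
  have hc : ContinuousAt (fun t => (d₂ - c₂) + (d₃ - c₃) * t + t ^ 2 * (η t - ξ t)) 0 := by fun_prop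
  have := (Asymptotics.isBigO_refl (fun t : ℂ => t ^ 2) (𝓝 0)).mul (hc.tendsto.isBigO_one ℂ)
  simp only [mul_one] at this
  refine this.congr' ?_ Filter.EventuallyEq.rfl
  filter_upwards [h, h'] with t e e'
  rw [e, e']
  ring

lemma HasJet.isBigO_cube {φ : ℂ → ℂ} {c₁ c₂ c₃ d₃ : ℂ} {ψ : ℂ → ℂ} (h : HasJet φ c₁ c₂ c₃)
    (h' : HasJet ψ c₁ c₂ d₃) : (fun t => ψ t - φ t) =O[𝓝 0] fun t => t ^ 3 := by
  obtain ⟨ξ, hξ, h⟩ := h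
  obtain ⟨η, hη, h'⟩ := h'
  have hc : ContinuousAt (fun t => (d₃ - c₃) + t * (η t - ξ t)) 0 := by fun_prop
  have := (Asymptotics.isBigO_refl (fun t : ℂ => t ^ 3) (𝓝 0)).mul (hc.tendsto.isBigO_one ℂ)
  simp only [mul_one] at this
  refine this.congr' ?_ Filter.EventuallyEq.rfl
  filter_upwards [h, h'] with t e e'
  rw [e, e']
  ring

lemma hasDerivAt_parabola (s : ℂ) : HasDerivAt (fun t : ℂ => (t, s * t ^ 2)) (1, 0) 0 :=
  (hasDerivAt_id _).prodMk (by simpa using (hasDerivAt_pow 2 (0 : ℂ)).const_mul s)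

/-- If the multiplicity is two, the second order coefficient `a` does not vanish. -/
lemma HasMapJet.ne_zero_of_localMultiplicity {F G φ : ℂ × ℂ → ℂ × ℂ} {δ a b c d e m : ℂ}
    (h : HasMapJet F δ a b c d e m) (hδ : δ ≠ 1) (hG : AnalyticAt ℂ G 0)
    (hφ : AnalyticAt ℂ φ 0) (hφ0 : φ 0 = 0) (hφ' : Function.Injective (fderiv ℂ φ 0))
    (hF : ContinuousAt F 0) (hF0 : F 0 = 0)
    (hconj : ∀ᶠ z in 𝓝 (0 : ℂ × ℂ), G (φ z) = φ (F z)) (hG2 : localMultiplicity G = 2) :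
    a ≠ 0 := by
  rintro rfl
  have hδ' : 1 - δ ≠ 0 := sub_ne_zero.2 (Ne.symm hδ)
  -- This solves `b + δ s = s`. With `a = 0`, the parabola is fixed up to `O(t³)` in both
  -- coordinates, which would force multiplicity at least three.
  let s := b / (1 - δ)
  have hs : b + δ * s = s := by simp only [s]; field_simp; ring
  have h1 := h.1.comp (γ := fun t => (t, s * t ^ 2)) hasJet_id (hasJet_sq s)
  have h2 := h.2.comp (γ := fun t => (t, s * t ^ 2)) hasJet_id (hasJet_sq s)
  simp only [mul_zero, zero_mul, add_zero, zero_add, hs] at h1 h2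
  have := le_localMultiplicity_of_semiconj hG hφ hφ0 hφ' hF hF0 hconj (hasDerivAt_parabola s)
    (by simp) (by simp) 3 ((h1.isBigO_cube hasJet_id).prod_left (h2.isBigO_cube (hasJet_sq s)))
  rw [hG2] at this
  exact absurd this (by decide)

/-- The `x`-axis, the parabola with `s = 0`, is fixed to second order. -/
lemma HasMapJet.two_le_localMultiplicity {F G φ : ℂ × ℂ → ℂ × ℂ} {δ a b c d e m : ℂ}
    (h : HasMapJet F δ a b c d e m) (hG : AnalyticAt ℂ G 0)
    (hφ : AnalyticAt ℂ φ 0) (hφ0 : φ 0 = 0) (hφ' : Function.Injective (fderiv ℂ φ 0))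
    (hF : ContinuousAt F 0) (hF0 : F 0 = 0)
    (hconj : ∀ᶠ z in 𝓝 (0 : ℂ × ℂ), G (φ z) = φ (F z)) : 2 ≤ localMultiplicity G := by
  have h1 := h.1.comp (γ := fun t => (t, 0 * t ^ 2)) hasJet_id (hasJet_sq 0)
  have h2 := h.2.comp (γ := fun t => (t, 0 * t ^ 2)) hasJet_id (hasJet_sq 0)
  exact le_localMultiplicity_of_semiconj hG hφ hφ0 hφ' hF hF0 hconj (hasDerivAt_parabola 0)
    (by simp) (by simp) 2 ((h1.isBigO_sq hasJet_id).prod_left (h2.isBigO_sq (hasJet_sq 0)))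

/-- Since `x²` and `y` lie in the ideal of `F`, its quotient is spanned by `1` and `x`. The linear
change `T` mixes the two generators linearly, so this passes to `G`. -/
lemma HasMapJet.localMultiplicity_le_two {F G : ℂ × ℂ → ℂ × ℂ} {δ a b c d e m : ℂ}
    (h : HasMapJet F δ a b c d e m) (ha : a ≠ 0) (hδ : δ ≠ 1) (hG : AnalyticAt ℂ G 0)
    (T : (ℂ × ℂ) ≃L[ℂ] (ℂ × ℂ)) (hconj : ∀ᶠ z in 𝓝 (0 : ℂ × ℂ), F (T z) = T (G z)) :
    localMultiplicity G ≤ 2 := by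
  obtain ⟨A₁₁, A₁₂, A₂₁, A₂₂, h₁₁, h₁₂, h₂₁, h₂₂, e₁, e₂, -⟩ := h.exists_inverse ha hδ
  have hT : ∀ {A : ℂ × ℂ → ℂ}, AnalyticAt ℂ A 0 → AnalyticAt ℂ (fun z => A (T z)) 0 := by
    intro A hA
    refine AnalyticAt.fun_comp (f := T) ?_ (T.toContinuousLinearMap.analyticAt 0)
    rwa [map_zero]
  have hTt : Filter.Tendsto T (𝓝 0) (𝓝 0) := T.continuous.tendsto' _ _ (map_zero T)
  have hu : AnalyticAt ℂ (fun z => (T z).1) 0 := hT analyticAt_fst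
  let q := Ideal.Quotient.mkₐ ℂ (fixedIdeal G)
  have htop : (⊤ : Submodule ℂ (convergentSeries ⧸ fixedIdeal G)) ≤
      Submodule.span ℂ {1, q (germOf _ hu)} := by
    rintro x -
    obtain ⟨⟨_, f, hf, rfl⟩, rfl⟩ := Ideal.Quotient.mkₐ_surjective ℂ (fixedIdeal G) x
    have hfT : AnalyticAt ℂ (fun z => f (T.symm z)) 0 := by
      refine AnalyticAt.fun_comp (f := T.symm) ?_ (T.symm.toContinuousLinearMap.analyticAt 0)
      rwa [map_zero]
    obtain ⟨A, hA, eA⟩ := exists_division_snd hfT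
    obtain ⟨B₁, hB₁, eB₁⟩ := exists_division (analyticAt_slice_fst hfT)
    obtain ⟨B₂, hB₂, eB₂⟩ := exists_division hB₁
    have hB : AnalyticAt ℂ (fun z : ℂ × ℂ => B₂ z.1) 0 :=
      AnalyticAt.fun_comp (g := B₂) (f := Prod.fst) (by exact hB₂) analyticAt_fst
    set p := f (T.symm (0, 0))
    have hr : AnalyticAt ℂ (fun z => f z - (p + B₁ 0 * (T z).1)) 0 :=
      hf.sub (analyticAt_const.add (analyticAt_const.mul hu))
    have hmem : germOf _ hr ∈ fixedIdeal G := by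
      -- Coefficients of `x² B₂ + y A`, the part of the function beyond `p + B₁(0) x`, in terms of
      -- the generators for `F`.
      let P : ℂ × ℂ → ℂ := fun z => B₂ z.1 * A₁₁ z + A z * A₂₁ z
      let Q : ℂ × ℂ → ℂ := fun z => B₂ z.1 * A₁₂ z + A z * A₂₂ z
      have hP : AnalyticAt ℂ P 0 := (hB.mul h₁₁).add (hA.mul h₂₁)
      have hQ : AnalyticAt ℂ Q 0 := (hB.mul h₁₂).add (hA.mul h₂₂)
      refine (mem_fixedIdeal hG hr).2
        ⟨fun z => P (T z) * (T (1, 0)).1 + Q (T z) * (T (1, 0)).2,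
          fun z => P (T z) * (T (0, 1)).1 + Q (T z) * (T (0, 1)).2,
          ((hT hP).mul analyticAt_const).add ((hT hQ).mul analyticAt_const),
          ((hT hP).mul analyticAt_const).add ((hT hQ).mul analyticAt_const), ?_⟩
      filter_upwards [hTt.eventually e₁, hTt.eventually e₂, hTt.eventually eA, hconj]
        with z e₁ e₂ eA ez
      have hz : T z - F (T z) = (z.1 - (G z).1) • T (1, 0) + (z.2 - (G z).2) • T (0, 1) := by
        rw [ez, ← map_sub, ← map_smul, ← map_smul, ← map_add]
        congr 1
        ext <;> simp
      have hz₁ := congrArg Prod.fst hz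
      have hz₂ := congrArg Prod.snd hz
      simp only [Prod.fst_sub, Prod.snd_sub, Prod.fst_add, Prod.snd_add, Prod.smul_fst,
        Prod.smul_snd, smul_eq_mul] at hz₁ hz₂
      rw [hz₁, hz₂] at e₁ e₂
      rw [ContinuousLinearEquiv.symm_apply_apply, eB₁ (T z).1, eB₂ (T z).1] at eA
      rw [eA]
      simp only [P, Q]
      linear_combination B₂ (T z).1 * e₁ + A (T z) * e₂
    have hx : germOf f hf = p • (1 : convergentSeries) + B₁ 0 • germOf _ hu + germOf _ hr := by
      refine Subtype.ext ?_
      change (f : Filter.Germ (𝓝 (0 : ℂ × ℂ)) ℂ) =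
        ((fun z => p • (1 : ℂ) + B₁ 0 • (T z).1 + (f z - (p + B₁ 0 * (T z).1)) : ℂ × ℂ → ℂ) :
          Filter.Germ (𝓝 (0 : ℂ × ℂ)) ℂ)
      congr 1
      funext z
      simp
    have hx' : q (germOf f hf) = p • 1 + B₁ 0 • q (germOf _ hu) := by
      have : q (germOf _ hr) = 0 := Ideal.Quotient.eq_zero_iff_mem.2 hmem
      rw [hx, map_add, map_add, map_smul, map_smul, map_one, this, add_zero]
    change q (germOf f hf) ∈ _
    rw [hx']
    exact Submodule.mem_span_pair.2 ⟨_, _, rfl⟩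
  have hrank : Module.rank ℂ (convergentSeries ⧸ fixedIdeal G) ≤ 2 := by
    rw [← rank_top, ← top_le_iff.1 htop]
    refine (rank_span_le _).trans ((Cardinal.mk_insert_le).trans ?_)
    rw [Cardinal.mk_singleton]
    norm_num
  exact Cardinal.toENat_le_natCast.2 hrank

/-! ### Local representations in charts -/

section Charts

variable {X : Type*} [TopologicalSpace X]

lemma eventually_symm_chart_comp {E : Type*} [TopologicalSpace E]
    {c : OpenPartialHomeomorph X (ℂ × ℂ)} {κ : E → X} {z : E}
    (hκ : ContinuousAt κ z) (hz : κ z ∈ c.source) : ∀ᶠ w in 𝓝 z, c.symm (c (κ w)) = κ w := by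
  filter_upwards [hκ.eventually (c.open_source.mem_nhds hz)] with w hw using c.left_inv hw

/-- A chart followed by an affine change of coordinates which sends the image of `p` to `0`. -/
def centredChart (c : OpenPartialHomeomorph X (ℂ × ℂ)) (p : X) (T : (ℂ × ℂ) ≃L[ℂ] (ℂ × ℂ)) :
    OpenPartialHomeomorph X (ℂ × ℂ) :=
  c.transHomeomorph ((Homeomorph.addRight (-c p)).trans T.toHomeomorph)

lemma centredChart_apply (c : OpenPartialHomeomorph X (ℂ × ℂ)) (p : X)
    (T : (ℂ × ℂ) ≃L[ℂ] (ℂ × ℂ)) (x : X) : centredChart c p T x = T (c x - c p) := by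
  simp [centredChart, sub_eq_add_neg]

lemma centredChart_symm_apply (c : OpenPartialHomeomorph X (ℂ × ℂ)) (p : X)
    (T : (ℂ × ℂ) ≃L[ℂ] (ℂ × ℂ)) (z : ℂ × ℂ) :
    (centredChart c p T).symm z = c.symm (T.symm z + c p) := by
  simp [centredChart, Homeomorph.addRight_symm]

variable [ChartedSpace (ℂ × ℂ) X]

lemma contMDiffAt_symm {c : OpenPartialHomeomorph X (ℂ × ℂ)} [IsManifold 𝓘(ℂ, ℂ × ℂ) ω X]
    (hc : c ∈ IsManifold.maximalAtlas 𝓘(ℂ, ℂ × ℂ) ω X) {z : ℂ × ℂ} (hz : z ∈ c.target) :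
    ContMDiffAt 𝓘(ℂ, ℂ × ℂ) 𝓘(ℂ, ℂ × ℂ) ω c.symm z :=
  contMDiffAt_symm_of_mem_maximalAtlas hc hz

lemma analyticAt_chart_comp {E : Type*} [NormedAddCommGroup E] [NormedSpace ℂ E]
    [CompleteSpace E] {c : OpenPartialHomeomorph X (ℂ × ℂ)} [IsManifold 𝓘(ℂ, ℂ × ℂ) ω X]
    (hc : c ∈ IsManifold.maximalAtlas 𝓘(ℂ, ℂ × ℂ) ω X) {κ : E → X} {z : E}
    (hκ : ContMDiffAt 𝓘(ℂ, E) 𝓘(ℂ, ℂ × ℂ) ω κ z) (hz : κ z ∈ c.source) :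
    AnalyticAt ℂ (fun w => c (κ w)) z :=
  ((contMDiffAt_of_mem_maximalAtlas hc hz).comp z hκ).contDiffAt.analyticAt

lemma analyticAt_chart_comp_symm {c c' : OpenPartialHomeomorph X (ℂ × ℂ)}
    [IsManifold 𝓘(ℂ, ℂ × ℂ) ω X]
    (hc : c ∈ IsManifold.maximalAtlas 𝓘(ℂ, ℂ × ℂ) ω X)
    (hc' : c' ∈ IsManifold.maximalAtlas 𝓘(ℂ, ℂ × ℂ) ω X) {g : X → X}
    (hg : ContMDiff 𝓘(ℂ, ℂ × ℂ) 𝓘(ℂ, ℂ × ℂ) ω g) {z : ℂ × ℂ} (hz : z ∈ c.target)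
    (hz' : g (c.symm z) ∈ c'.source) : AnalyticAt ℂ (fun w => c' (g (c.symm w))) z :=
  analyticAt_chart_comp hc' ((hg _).comp z (contMDiffAt_symm hc hz)) hz'

lemma isCentredChart_centredChart [IsManifold 𝓘(ℂ, ℂ × ℂ) ω X]
    {c : OpenPartialHomeomorph X (ℂ × ℂ)} {p : X}
    (hc : c ∈ IsManifold.maximalAtlas 𝓘(ℂ, ℂ × ℂ) ω X) (hp : p ∈ c.source)
    (T : (ℂ × ℂ) ≃L[ℂ] (ℂ × ℂ)) : IsCentredChart (centredChart c p T) p := by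
  refine ⟨?_, hp, by rw [centredChart_apply, sub_self, map_zero]⟩
  refine OpenPartialHomeomorph.mem_maximalAtlas_of_contMDiffOn (I := 𝓘(ℂ, ℂ × ℂ)) (n := ω)
    (M := X) _ ?_ ?_
  · have h1 : ContMDiffOn 𝓘(ℂ, ℂ × ℂ) 𝓘(ℂ, ℂ × ℂ) ω c c.source :=
      contMDiffOn_of_mem_maximalAtlas hc
    have h2 : ContMDiff 𝓘(ℂ, ℂ × ℂ) 𝓘(ℂ, ℂ × ℂ) ω fun z : ℂ × ℂ => T (z - c p) := by
      refine ContDiff.contMDiff ?_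
      fun_prop
    refine (h2.comp_contMDiffOn h1).congr fun x _ => ?_
    exact centredChart_apply c p T x
  · have h1 : ContMDiffOn 𝓘(ℂ, ℂ × ℂ) 𝓘(ℂ, ℂ × ℂ) ω c.symm c.target :=
      contMDiffOn_symm_of_mem_maximalAtlas hc
    have h2 : ContMDiff 𝓘(ℂ, ℂ × ℂ) 𝓘(ℂ, ℂ × ℂ) ω fun z : ℂ × ℂ => T.symm z + c p := by
      refine ContDiff.contMDiff ?_
      fun_prop
    refine (h1.comp h2.contMDiffOn (s := (centredChart c p T).target) ?_).congr fun x _ => ?_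
    · intro z hz
      simpa [centredChart, Homeomorph.addRight_symm] using hz
    · exact centredChart_symm_apply c p T x

end Charts

/-! ### Volume forms in charts -/

lemma alternating_apply_comb {V : Type*} [AddCommGroup V] [Module ℂ V] (φ : V [⋀^Fin 2]→ₗ[ℂ] ℂ)
    (v w : V) (a b c d : ℂ) :
    φ ![a • v + b • w, c • v + d • w] = (a * d - c * b) * φ ![v, w] := by
  have hswap : ∀ x y : V, φ ![x, y] = -φ ![y, x] := fun x y => by
    have := φ.map_swap ![y, x] (i := 0) (j := 1) (by decide)
    rw [← this]
    congr 1
    funext i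
    fin_cases i <;> rfl
  have hself : ∀ x : V, φ ![x, x] = 0 := fun x =>
    φ.map_eq_zero_of_eq ![x, x] (i := 0) (j := 1) rfl (by decide)
  have hl : ∀ (s t : ℂ) (x y u : V), φ ![s • x + t • y, u] = s * φ ![x, u] + t * φ ![y, u] := by
    intro s t x y u
    rw [AlternatingMap.map_vecCons_add, AlternatingMap.map_vecCons_smul,
      AlternatingMap.map_vecCons_smul]
    rfl
  rw [hl, hswap v, hswap w (c • v + d • w), hl, hl, hself, hself, hswap w v]
  ring

section Forms

variable {X : Type*} [TopologicalSpace X] [ChartedSpace (ℂ × ℂ) X]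

/-- The value of a form, as a function of a point and two vectors of the model space. -/
def TwoForm.eval (η : TwoForm X) (x : X) (v w : ℂ × ℂ) : ℂ := η x ![v, w]

lemma TwoForm.eval_comp (η : TwoForm X) (x : X) (M L : ℂ × ℂ →L[ℂ] ℂ × ℂ) :
    η.eval x (M (L (1, 0))) (M (L (0, 1))) = det₂ L * η.eval x (M (1, 0)) (M (0, 1)) := by
  have key : ∀ v : ℂ × ℂ, M v = v.1 • M (1, 0) + v.2 • M (0, 1) := fun v => by
    rw [← map_smul, ← map_smul, ← map_add]
    congr 1
    ext <;> simp
  rw [key (L (1, 0)), key (L (0, 1))]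
  have := alternating_apply_comb (η x) (M (1, 0)) (M (0, 1)) (L (1, 0)).1 (L (1, 0)).2 (L (0, 1)).1
    (L (0, 1)).2
  exact this

variable [IsManifold 𝓘(ℂ, ℂ × ℂ) ω X]

/-- Change of variables for the coefficients of a form. -/
lemma TwoForm.coeff_mul_det₂ (η : TwoForm X) {c c' : OpenPartialHomeomorph X (ℂ × ℂ)}
    (hc : c ∈ IsManifold.maximalAtlas 𝓘(ℂ, ℂ × ℂ) ω X)
    (hc' : c' ∈ IsManifold.maximalAtlas 𝓘(ℂ, ℂ × ℂ) ω X) {g : X → X}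
    (hg : ContMDiff 𝓘(ℂ, ℂ × ℂ) 𝓘(ℂ, ℂ × ℂ) ω g) {z : ℂ × ℂ} (hz : z ∈ c.target)
    (hz' : g (c.symm z) ∈ c'.source) :
    η.coeff c' (c' (g (c.symm z))) * det₂ (fderiv ℂ (fun w => c' (g (c.symm w))) z) =
      η.eval (g (c.symm z))
        (mfderiv 𝓘(ℂ, ℂ × ℂ) 𝓘(ℂ, ℂ × ℂ) g (c.symm z)
          (mfderiv 𝓘(ℂ, ℂ × ℂ) 𝓘(ℂ, ℂ × ℂ) c.symm z ((1, 0) : ℂ × ℂ)))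
        (mfderiv 𝓘(ℂ, ℂ × ℂ) 𝓘(ℂ, ℂ × ℂ) g (c.symm z)
          (mfderiv 𝓘(ℂ, ℂ × ℂ) 𝓘(ℂ, ℂ × ℂ) c.symm z ((0, 1) : ℂ × ℂ))) := by
  set ψ : ℂ × ℂ → ℂ × ℂ := fun w => c' (g (c.symm w)) with hψ
  have hs : ContMDiffAt 𝓘(ℂ, ℂ × ℂ) 𝓘(ℂ, ℂ × ℂ) ω c.symm z := contMDiffAt_symm hc hz
  have hs' : ContMDiffAt 𝓘(ℂ, ℂ × ℂ) 𝓘(ℂ, ℂ × ℂ) ω c'.symm (ψ z) :=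
    contMDiffAt_symm hc' (c'.map_source hz')
  have hψa : AnalyticAt ℂ ψ z := analyticAt_chart_comp_symm hc hc' hg hz hz'
  have hgc : ContMDiffAt 𝓘(ℂ, ℂ × ℂ) 𝓘(ℂ, ℂ × ℂ) ω (g ∘ c.symm) z := (hg _).comp z hs
  have hω : (ω : WithTop ℕ∞) ≠ 0 := by simp
  have e1 : mfderiv 𝓘(ℂ, ℂ × ℂ) 𝓘(ℂ, ℂ × ℂ) (g ∘ c.symm) z =
      (mfderiv 𝓘(ℂ, ℂ × ℂ) 𝓘(ℂ, ℂ × ℂ) g (c.symm z)).comp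
        (mfderiv 𝓘(ℂ, ℂ × ℂ) 𝓘(ℂ, ℂ × ℂ) c.symm z) :=
    mfderiv_comp z ((hg _).mdifferentiableAt hω) (hs.mdifferentiableAt hω)
  have e2 : mfderiv 𝓘(ℂ, ℂ × ℂ) 𝓘(ℂ, ℂ × ℂ) (c'.symm ∘ ψ) z =
      (mfderiv 𝓘(ℂ, ℂ × ℂ) 𝓘(ℂ, ℂ × ℂ) c'.symm (ψ z)).comp
        (mfderiv 𝓘(ℂ, ℂ × ℂ) 𝓘(ℂ, ℂ × ℂ) ψ z) :=
    mfderiv_comp z (hs'.mdifferentiableAt hω) hψa.differentiableAt.mdifferentiableAt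
  -- Differentiating this local identity expresses the pushed-forward coordinate frame through the
  -- Jacobian of `ψ`.
  have e3 : (c'.symm ∘ ψ) =ᶠ[𝓝 z] (g ∘ c.symm) :=
    eventually_symm_chart_comp hgc.continuousAt hz'
  have e4 : ∀ v : ℂ × ℂ, (mfderiv 𝓘(ℂ, ℂ × ℂ) 𝓘(ℂ, ℂ × ℂ) g (c.symm z)
      (mfderiv 𝓘(ℂ, ℂ × ℂ) 𝓘(ℂ, ℂ × ℂ) c.symm z v) : ℂ × ℂ) =
      mfderiv 𝓘(ℂ, ℂ × ℂ) 𝓘(ℂ, ℂ × ℂ) c'.symm (ψ z) (fderiv ℂ ψ z v) := by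
    intro v
    have h := e3.mfderiv_eq (I := 𝓘(ℂ, ℂ × ℂ)) (I' := 𝓘(ℂ, ℂ × ℂ))
    have h' : (mfderiv 𝓘(ℂ, ℂ × ℂ) 𝓘(ℂ, ℂ × ℂ) (g ∘ c.symm) z v : ℂ × ℂ) =
      mfderiv 𝓘(ℂ, ℂ × ℂ) 𝓘(ℂ, ℂ × ℂ) (c'.symm ∘ ψ) z v :=
        (congrArg (fun L : ℂ × ℂ →L[ℂ] ℂ × ℂ => L v) h).symm
    rw [e1, e2, mfderiv_eq_fderiv] at h'
    exact h'
  have e5 : c'.symm (ψ z) = g (c.symm z) := c'.left_inv hz'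
  have e6 := TwoForm.eval_comp η (g (c.symm z)) (mfderiv 𝓘(ℂ, ℂ × ℂ) 𝓘(ℂ, ℂ × ℂ) c'.symm (ψ z))
    (fderiv ℂ ψ z)
  refine Eq.trans ?_ (e6.symm.trans ?_)
  · rw [mul_comm]
    congr 1
    change η.eval (c'.symm (ψ z)) _ _ = _
    rw [e5]
    rfl
  · exact congrArg₂ (η.eval (g (c.symm z))) (e4 (1, 0)).symm (e4 (0, 1)).symm

/-- The coordinate vectors span the tangent space, so a form vanishing on them is zero. -/
lemma TwoForm.coeff_ne_zero {η : TwoForm X} (hη : ∀ x, η x ≠ 0)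
    {c : OpenPartialHomeomorph X (ℂ × ℂ)}
    (hc : c ∈ IsManifold.maximalAtlas 𝓘(ℂ, ℂ × ℂ) ω X) {z : ℂ × ℂ} (hz : z ∈ c.target) :
    η.coeff c z ≠ 0 := by
  intro h0
  have hω : (ω : WithTop ℕ∞) ≠ 0 := by simp
  have hs := (contMDiffAt_symm hc hz).mdifferentiableAt hω
  have hd : MDifferentiableAt 𝓘(ℂ, ℂ × ℂ) 𝓘(ℂ, ℂ × ℂ) c (c.symm z) :=
    (contMDiffAt_of_mem_maximalAtlas hc (c.map_target hz)).mdifferentiableAt hω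
  have hcc : (c.symm ∘ c) =ᶠ[𝓝 (c.symm z)] id := by
    filter_upwards [c.open_source.mem_nhds (c.map_target hz)] with x hx using c.left_inv hx
  have hs' : MDifferentiableAt 𝓘(ℂ, ℂ × ℂ) 𝓘(ℂ, ℂ × ℂ) c.symm (c (c.symm z)) := by
    rwa [c.right_inv hz]
  have e1 := mfderiv_comp (c.symm z) hs' hd
  rw [hcc.mfderiv_eq, mfderiv_id, c.right_inv hz] at e1
  refine hη (c.symm z) (AlternatingMap.ext fun m => ?_)
  let D : ℂ × ℂ →L[ℂ] ℂ × ℂ := mfderiv 𝓘(ℂ, ℂ × ℂ) 𝓘(ℂ, ℂ × ℂ) c.symm z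
  let D' : ℂ × ℂ →L[ℂ] ℂ × ℂ := mfderiv 𝓘(ℂ, ℂ × ℂ) 𝓘(ℂ, ℂ × ℂ) c (c.symm z)
  have e2 : ∀ v : ℂ × ℂ, D (D' v) = v := fun v =>
    (congrArg (fun L : ℂ × ℂ →L[ℂ] ℂ × ℂ => L v) e1).symm
  obtain ⟨v, hv⟩ : ∃ v : ℂ × ℂ, v = m 0 := ⟨_, rfl⟩
  obtain ⟨w, hw⟩ : ∃ w : ℂ × ℂ, w = m 1 := ⟨_, rfl⟩
  have e3 := TwoForm.eval_comp η (c.symm z) D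
    (((ContinuousLinearMap.fst ℂ ℂ ℂ).smulRight (D' v)) +
      (ContinuousLinearMap.snd ℂ ℂ ℂ).smulRight (D' w))
  have e4 : η.eval (c.symm z) (D (1, 0)) (D (0, 1)) = 0 := h0
  rw [e4, mul_zero] at e3
  simp only [_root_.add_apply, ContinuousLinearMap.smulRight_apply,
    ContinuousLinearMap.coe_fst', ContinuousLinearMap.coe_snd', one_smul, zero_smul, add_zero,
    zero_add, e2] at e3
  rw [AlternatingMap.zero_apply, ← e3, hv, hw]
  change η (c.symm z) m = η (c.symm z) ![m 0, m 1]
  congr 1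
  funext i
  fin_cases i <;> rfl

/-- `TwoForm.IsHolomorphic` concerns only charts of the atlas. Charts of the maximal atlas follow by
comparison with a preferred chart, through `TwoForm.coeff_mul_det₂` for the identity map. -/
lemma TwoForm.IsHolomorphic.differentiableAt_coeff {η : TwoForm X} (hη : η.IsHolomorphic)
    {c : OpenPartialHomeomorph X (ℂ × ℂ)}
    (hc : c ∈ IsManifold.maximalAtlas 𝓘(ℂ, ℂ × ℂ) ω X) {z : ℂ × ℂ} (hz : z ∈ c.target) :
    DifferentiableAt ℂ (η.coeff c) z := by
  set c' := chartAt (ℂ × ℂ) (c.symm z) with hc'def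
  have hc' : c' ∈ IsManifold.maximalAtlas 𝓘(ℂ, ℂ × ℂ) ω X := IsManifold.chart_mem_maximalAtlas _
  have hz' : c.symm z ∈ c'.source := mem_chart_source _ _
  have hid : ContMDiff 𝓘(ℂ, ℂ × ℂ) 𝓘(ℂ, ℂ × ℂ) ω (id : X → X) := contMDiff_id
  have hψ : AnalyticAt ℂ (fun w => c' (c.symm w)) z :=
    analyticAt_chart_comp_symm hc hc' hid hz hz'
  have h1 : DifferentiableAt ℂ (η.coeff c') (c' (c.symm z)) :=
    (hη c' (chart_mem_atlas _ _)).differentiableAt (c'.open_target.mem_nhds (c'.map_source hz'))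
  have h2 : DifferentiableAt ℂ (fun w => det₂ (fderiv ℂ (fun w => c' (c.symm w)) w)) z := by
    have hf := hψ.fderiv.differentiableAt
    have h3 : ∀ v : ℂ × ℂ,
        DifferentiableAt ℂ (fun w => fderiv ℂ (fun w => c' (c.symm w)) w v) z :=
      fun v => hf.clm_apply (differentiableAt_const v)
    exact ((h3 (1, 0)).fst.mul (h3 (0, 1)).snd).sub ((h3 (0, 1)).fst.mul (h3 (1, 0)).snd)
  have h4 : DifferentiableAt ℂ (fun w => η.coeff c' (c' (c.symm w)) *
      det₂ (fderiv ℂ (fun w => c' (c.symm w)) w)) z :=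
    (DifferentiableAt.fun_comp' (f := fun w => c' (c.symm w)) z h1 hψ.differentiableAt).mul h2
  refine h4.congr_of_eventuallyEq ?_
  have hcont : ContinuousAt c.symm z := c.continuousAt_symm hz
  filter_upwards [c.open_target.mem_nhds hz, hcont.eventually (c'.open_source.mem_nhds hz')]
    with w hw hw'
  have := η.coeff_mul_det₂ hc hc' hid hw hw'
  refine Eq.trans ?_ this.symm
  simp only [id]
  rw [mfderiv_id]
  rfl

end Forms

/-! ### Invariant arcs tangent to the eigendirection of eigenvalue one -/

lemma HasMapJet.fderiv_apply {F : ℂ × ℂ → ℂ × ℂ} {δ a b c d e m : ℂ}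
    (h : HasMapJet F δ a b c d e m) (hF : AnalyticAt ℂ F 0) (v : ℂ × ℂ) :
    fderiv ℂ F 0 v = (v.1, δ * v.2) := by
  obtain ⟨R₁, S₁, -, -, h₁⟩ := h.1.exists_fderiv (analyticAt_fst.comp hF)
  obtain ⟨R₂, S₂, -, -, h₂⟩ := h.2.exists_fderiv (analyticAt_snd.comp hF)
  have p₁ : fderiv ℂ (fun z => (F z).1) 0 (1, 0) = 1 := h₁.self_of_nhds.1.trans (by simp)
  have q₁ : fderiv ℂ (fun z => (F z).1) 0 (0, 1) = 0 := h₁.self_of_nhds.2.trans (by simp)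
  have p₂ : fderiv ℂ (fun z => (F z).2) 0 (1, 0) = 0 := h₂.self_of_nhds.1.trans (by simp)
  have q₂ : fderiv ℂ (fun z => (F z).2) 0 (0, 1) = δ := h₂.self_of_nhds.2.trans (by simp)
  have hv : v = v.1 • ((1 : ℂ), (0 : ℂ)) + v.2 • ((0 : ℂ), (1 : ℂ)) := by ext <;> simp
  refine Prod.ext ?_ ?_
  · rw [fderiv_fst_apply hF.differentiableAt, hv, map_add, map_smul, map_smul, p₁, q₁]
    simp
  · rw [fderiv_snd_apply hF.differentiableAt, hv, map_add, map_smul, map_smul, p₂, q₂]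
    simp [mul_comm]

lemma exists_analytic_localInverse {g : ℂ → ℂ} {a : ℂ} (hg : AnalyticAt ℂ g a)
    (hg' : deriv g a ≠ 0) :
    ∃ ψ : ℂ → ℂ, AnalyticAt ℂ ψ (g a) ∧ ψ (g a) = a ∧ HasDerivAt ψ (deriv g a)⁻¹ (g a) ∧
      (∀ᶠ t in 𝓝 a, ψ (g t) = t) ∧ ∀ᶠ x in 𝓝 (g a), g (ψ x) = x :=
  ⟨_, hg.analyticAt_localInverse hg', HasStrictFDerivAt.localInverse_apply_image ..,
    (hg.hasStrictDerivAt.to_localInverse hg').hasDerivAt,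
    hg.hasStrictDerivAt.eventually_left_inverse hg',
    hg.hasStrictDerivAt.eventually_right_inverse hg'⟩

/-- An analytic function which is multiplied asymptotically by `μ ≠ 1` under a reparametrization
tangent to the identity vanishes. -/
lemma eventually_eq_zero_of_isLittleO {w u : ℂ → ℂ} {μ : ℂ} (hw : AnalyticAt ℂ w 0)
    (hu : HasDerivAt u 1 0) (hu0 : u 0 = 0) (hμ : μ ≠ 1)
    (h : (fun t => w (u t) - μ * w t) =o[𝓝 0] w) : ∀ᶠ t in 𝓝 0, w t = 0 := by
  by_contra hne
  -- Otherwise `w = t^k g` with `g 0 ≠ 0`, and `w (u t) / w t` tends to `u'(0)^k = 1`, not to `μ`.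
  obtain ⟨k, g, hg, hg0, e⟩ := (hw.exists_eventuallyEq_pow_smul_nonzero_iff).2 hne
  have hut : Filter.Tendsto u (𝓝 0) (𝓝 0) := by
    have := hu.continuousAt.tendsto
    rwa [hu0] at this
  have h1 : Filter.Tendsto (fun t => u t / t) (𝓝[≠] 0) (𝓝 1) := by
    have := hu.tendsto_slope_zero
    simp only [zero_add, hu0, sub_zero, smul_eq_mul] at this
    simpa only [div_eq_inv_mul] using this
  have hgt : Filter.Tendsto g (𝓝[≠] 0) (𝓝 (g 0)) :=
    hg.continuousAt.tendsto.mono_left nhdsWithin_le_nhds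
  have hgut : Filter.Tendsto (fun t => g (u t)) (𝓝[≠] 0) (𝓝 (g 0)) :=
    (hg.continuousAt.tendsto.comp hut).mono_left nhdsWithin_le_nhds
  have h2 : Filter.Tendsto (fun t => (u t / t) ^ k * (g (u t) / g t) - μ) (𝓝[≠] 0)
      (𝓝 (1 - μ)) := by
    have := ((h1.pow k).mul (hgut.div hgt hg0)).sub_const μ
    simpa [div_self hg0] using this
  have h3 := (h.mono (nhdsWithin_le_nhds (s := {0}ᶜ))).tendsto_div_nhds_zero
  have h4 := tendsto_nhds_unique (h2.congr' ?_) h3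
  · exact hμ (sub_eq_zero.1 h4).symm
  · filter_upwards [self_mem_nhdsWithin, e.filter_mono nhdsWithin_le_nhds,
      (hut.eventually e).filter_mono nhdsWithin_le_nhds, hgt.eventually_ne hg0] with t ht et eut hgt
    have ht0 : t ≠ 0 := ht
    rw [et, eut]
    simp only [sub_zero, smul_eq_mul]
    have : t ^ k ≠ 0 := pow_ne_zero _ ht0
    rw [div_pow]
    field_simp

/-- An arc which is invariant under `F^[n]` with derivative `1` is invariant under `F`. -/
lemma HasMapJet.exists_reparametrization {F : ℂ × ℂ → ℂ × ℂ} {δ a b c d e m : ℂ}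
    (h : HasMapJet F δ a b c d e m) (hF : AnalyticAt ℂ F 0) (hF0 : F 0 = 0) {n : ℕ}
    (hδ : δ ^ n ≠ 1) {Γ : ℂ → ℂ × ℂ} (hΓ : AnalyticAt ℂ Γ 0) (hΓ0 : Γ 0 = 0)
    (hΓ' : deriv Γ 0 ≠ 0) {u : ℂ → ℂ} (hu : HasDerivAt u 1 0) (hu0 : u 0 = 0)
    (hinv : ∀ᶠ t in 𝓝 (0 : ℂ), F^[n] (Γ t) = Γ (u t)) :
    ∃ u' : ℂ → ℂ, HasDerivAt u' 1 0 ∧ u' 0 = 0 ∧ ∀ᶠ t in 𝓝 (0 : ℂ), F (Γ t) = Γ (u' t) := by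
  obtain ⟨dn, hH⟩ := h.iterate hF hF0 n
  have hHa : AnalyticAt ℂ F^[n] 0 := analyticAt_iterate hF hF0 n
  have hH0 : F^[n] 0 = 0 := Function.iterate_fixed hF0 n
  set H := F^[n]
  set v := deriv Γ 0 with hv
  have hΓd : HasDerivAt Γ v 0 := hΓ.differentiableAt.hasDerivAt
  have hut : Filter.Tendsto u (𝓝 0) (𝓝 0) := by
    have := hu.continuousAt.tendsto
    rwa [hu0] at this
  have hΓt : Filter.Tendsto Γ (𝓝 0) (𝓝 0) := by
    have := hΓ.continuousAt.tendsto
    rwa [hΓ0] at this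
  have hFt : Filter.Tendsto F (𝓝 0) (𝓝 0) := by
    have := hF.continuousAt.tendsto
    rwa [hF0] at this
  -- The tangent vector is fixed by the differential of `F^[n]`, whose other eigenvalue `δ ^ n`
  -- differs from `1`. Hence the arc is a graph over the `x`-axis.
  have hv2 : v.2 = 0 := by
    have e1 : HasDerivAt (fun t => H (Γ t)) (fderiv ℂ H 0 v) 0 :=
      HasFDerivAt.comp_hasDerivAt (0 : ℂ) (f := Γ)
        (by rw [hΓ0]; exact hHa.differentiableAt.hasFDerivAt) hΓd
    have e2 : HasDerivAt (fun t => Γ (u t)) ((1 : ℂ) • v) 0 :=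
      HasDerivAt.scomp (0 : ℂ) (by rw [hu0]; exact hΓd) hu
    have e3 := e1.unique (e2.congr_of_eventuallyEq hinv)
    rw [hH.fderiv_apply hHa, one_smul] at e3
    have e4 := congrArg Prod.snd e3
    have e5 : (δ ^ n - 1) * v.2 = 0 := by
      simp only at e4
      linear_combination e4
    exact (mul_eq_zero.1 e5).resolve_left (sub_ne_zero.2 hδ)
  have hv1 : v.1 ≠ 0 := fun h1 => hΓ' (Prod.ext h1 hv2)
  have hΓ1 : AnalyticAt ℂ (fun t => (Γ t).1) 0 := analyticAt_fst.comp hΓ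
  have hΓ1d : HasDerivAt (fun t => (Γ t).1) v.1 0 := hΓd.fst
  obtain ⟨ψ, hψ, hψ0, hψd, hψl, hψr⟩ :=
    exists_analytic_localInverse hΓ1 (by rw [hΓ1d.deriv]; exact hv1)
  rw [hΓ1d.deriv] at hψd
  simp only [hΓ0, Prod.fst_zero] at hψ hψ0 hψd hψr
  have hψt : Filter.Tendsto ψ (𝓝 0) (𝓝 0) := by
    have := hψ.continuousAt.tendsto
    rwa [hψ0] at this
  let φ : ℂ → ℂ := fun x => (Γ (ψ x)).2
  have hφ : AnalyticAt ℂ φ 0 := by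
    have : AnalyticAt ℂ (fun x => Γ (ψ x)) 0 :=
      AnalyticAt.fun_comp (f := ψ) (by rw [hψ0]; exact hΓ) hψ
    exact analyticAt_snd.comp this
  have hφ0 : φ 0 = 0 := by simp [φ, hψ0, hΓ0]
  -- A local equation of the arc. The composite `W ∘ H` also vanishes on the arc and has
  -- `y`-derivative `δ ^ n` at the origin.
  let W : ℂ × ℂ → ℂ := fun z => z.2 - φ z.1
  have hW : AnalyticAt ℂ W 0 :=
    analyticAt_snd.sub (AnalyticAt.fun_comp (g := φ) (f := Prod.fst) (by exact hφ) analyticAt_fst)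
  have hW01 : fderiv ℂ W 0 (0, 1) = 1 := by
    have e1 : HasDerivAt (fun y : ℂ => W (0, y)) (fderiv ℂ W 0 (0, 1)) 0 :=
      HasFDerivAt.comp_hasDerivAt (0 : ℂ) (f := fun y : ℂ => ((0 : ℂ), y))
        hW.differentiableAt.hasFDerivAt ((hasDerivAt_const _ _).prodMk (hasDerivAt_id 0))
    exact e1.unique ((hasDerivAt_id (0 : ℂ)).sub_const (φ 0))
  have hWΓ : ∀ᶠ t in 𝓝 (0 : ℂ), W (Γ t) = 0 := by
    filter_upwards [hψl] with t ht
    simp [W, φ, ht]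
  have hgraph : ∀ᶠ x in 𝓝 (0 : ℂ), (x, φ x) = Γ (ψ x) := by
    filter_upwards [hψr] with x hx
    exact Prod.ext hx.symm rfl
  have hK : AnalyticAt ℂ (fun z => W (H z)) 0 :=
    AnalyticAt.fun_comp (f := H) (by rw [hH0]; exact hW) hHa
  have hKd : fderiv ℂ (fun z => W (H z)) 0 (0, 1) = δ ^ n := by
    have e1 : HasFDerivAt (fun z => W (H z)) ((fderiv ℂ W 0).comp (fderiv ℂ H 0)) 0 :=
      HasFDerivAt.comp (0 : ℂ × ℂ) (by rw [hH0]; exact hW.differentiableAt.hasFDerivAt)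
        hHa.differentiableAt.hasFDerivAt
    rw [e1.fderiv, ContinuousLinearMap.comp_apply, hH.fderiv_apply hHa]
    have : ((0 : ℂ), δ ^ n * 1) = δ ^ n • ((0 : ℂ), (1 : ℂ)) := by ext <;> simp
    simp only [this, map_smul, hW01]
    simp
  have hK0 : ∀ᶠ x in 𝓝 (0 : ℂ), W (H (x, φ x)) = 0 := by
    filter_upwards [hgraph, hψt.eventually hinv, (hut.comp hψt).eventually hWΓ] with x hx hx' hx''
    rw [hx, hx']
    exact hx''
  let w : ℂ → ℂ := fun t => W (F (Γ t))
  have hFΓ : AnalyticAt ℂ (fun t => F (Γ t)) 0 :=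
    AnalyticAt.fun_comp (f := Γ) (by rw [hΓ0]; exact hF) hΓ
  have hw : AnalyticAt ℂ w 0 :=
    AnalyticAt.fun_comp (f := fun t => F (Γ t)) (by rw [hΓ0, hF0]; exact hW) hFΓ
  have hFΓt : Filter.Tendsto (fun t => F (Γ t)) (𝓝 0) (𝓝 0) := hFt.comp hΓt
  have hxt : Filter.Tendsto (fun t => (F (Γ t)).1) (𝓝 0) (𝓝 0) :=
    (continuous_fst.tendsto' (0 : ℂ × ℂ) 0 rfl).comp hFΓt
  have hφt : Filter.Tendsto (fun x : ℂ => (x, φ x)) (𝓝 0) (𝓝 0) := by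
    have : ContinuousAt (fun x : ℂ => (x, φ x)) 0 := continuousAt_id.prodMk hφ.continuousAt
    have := this.tendsto
    rwa [hφ0] at this
  -- Because `F` and `H` commute, `w (u t) = W (H (F (Γ t)))`. Compare `F (Γ t)` with the point of
  -- the graph above the same `x`: they differ by `w t` vertically, and `W ∘ H` vanishes at the
  -- latter.
  have hlittle : (fun t => w (u t) - δ ^ n * w t) =o[𝓝 0] w := by
    have hs := hK.hasStrictFDerivAt.isLittleO.comp_tendsto
      (hFΓt.prodMk_nhds (hφt.comp hxt) : Filter.Tendsto
        (fun t => (F (Γ t), ((F (Γ t)).1, φ (F (Γ t)).1))) (𝓝 0) (𝓝 ((0 : ℂ × ℂ), (0 : ℂ × ℂ))))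
    have hd : ∀ t, F (Γ t) - ((F (Γ t)).1, φ (F (Γ t)).1) = w t • ((0 : ℂ), (1 : ℂ)) := by
      intro t
      ext <;> simp [w, W]
    refine (hs.congr' (g₂ := fun t => w t • ((0 : ℂ), (1 : ℂ))) ?_ ?_).trans_isBigO ?_
    · filter_upwards [hxt.eventually hK0, hinv] with t ht ht'
      simp only [Function.comp_apply]
      rw [hd, ht, map_smul, hKd]
      have : F (Γ (u t)) = H (F (Γ t)) := (congrArg F ht'.symm).trans
        ((Function.iterate_succ_apply' F n _).symm.trans (Function.iterate_succ_apply F n _))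
      simp only [w, this, smul_eq_mul]
      ring
    · exact Filter.Eventually.of_forall hd
    · exact Asymptotics.IsBigO.of_bound 1 (Filter.Eventually.of_forall fun t => by
        simp [Prod.norm_def])
  have hzero := eventually_eq_zero_of_isLittleO hw hu hu0 hδ hlittle
  refine ⟨fun t => ψ (F (Γ t)).1, ?_, by simp [hΓ0, hF0, hψ0], ?_⟩
  · have e1 : HasDerivAt (fun t => F (Γ t)) (fderiv ℂ F 0 v) 0 :=
      HasFDerivAt.comp_hasDerivAt (0 : ℂ) (f := Γ)
        (by rw [hΓ0]; exact hF.differentiableAt.hasFDerivAt) hΓd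
    rw [h.fderiv_apply hF] at e1
    have e2 : HasDerivAt (fun t => (F (Γ t)).1) v.1 0 := e1.fst
    have e3 := HasDerivAt.comp (0 : ℂ) (h₂ := ψ) (h := fun t => (F (Γ t)).1)
      (by simp only [hΓ0, hF0, Prod.fst_zero]; exact hψd) e2
    rwa [inv_mul_cancel₀ hv1] at e3
  · filter_upwards [hzero, hxt.eventually hgraph] with t ht ht'
    rw [← ht']
    refine Prod.ext rfl ?_
    exact sub_eq_zero.1 ht

/-! ### Diagonalization -/

/-- The determinant is `δ` and `δ` is an eigenvalue, so the other eigenvalue is `1`; distinct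
eigenvalues give an eigenbasis. -/
lemma exists_diagonalization {L : ℂ × ℂ →L[ℂ] ℂ × ℂ} {δ : ℂ} (hδ0 : δ ≠ 0) (hδ1 : δ ≠ 1)
    (hdet : det₂ L = δ) {v : ℂ × ℂ} (hv : v ≠ 0) (hLv : L v = δ • v) :
    ∃ T : (ℂ × ℂ) ≃L[ℂ] (ℂ × ℂ), ∀ z, T (L z) = ((T z).1, δ * (T z).2) := by
  obtain ⟨p, hp⟩ : ∃ p, (L (1, 0)).1 = p := ⟨_, rfl⟩
  obtain ⟨r, hr⟩ : ∃ r, (L (1, 0)).2 = r := ⟨_, rfl⟩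
  obtain ⟨q, hq⟩ : ∃ q, (L (0, 1)).1 = q := ⟨_, rfl⟩
  obtain ⟨s, hs⟩ : ∃ s, (L (0, 1)).2 = s := ⟨_, rfl⟩
  rw [det₂, hp, hq, hr, hs] at hdet
  have hL : ∀ z : ℂ × ℂ, L z = (p * z.1 + q * z.2, r * z.1 + s * z.2) := by
    intro z
    have hz : z = z.1 • ((1 : ℂ), (0 : ℂ)) + z.2 • ((0 : ℂ), (1 : ℂ)) := by ext <;> simp
    conv_lhs => rw [hz, map_add, map_smul, map_smul]
    ext
    · simp [hp, hq, mul_comm]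
    · simp [hr, hs, mul_comm]
  rw [hL] at hLv
  have e1 : p * v.1 + q * v.2 = δ * v.1 := congrArg Prod.fst hLv
  have e2 : r * v.1 + s * v.2 = δ * v.2 := congrArg Prod.snd hLv
  have hchar : (p - δ) * (s - δ) - q * r = 0 := by
    by_cases h1 : v.1 = 0
    · have h2 : v.2 ≠ 0 := fun h2 => hv (Prod.ext h1 h2)
      refine (mul_eq_zero.1 (?_ : _ * v.2 = 0)).resolve_right h2
      linear_combination (p - δ) * e2 - r * e1
    · refine (mul_eq_zero.1 (?_ : _ * v.1 = 0)).resolve_right h1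
      linear_combination (s - δ) * e1 - q * e2
  have htr : p + s = 1 + δ := by
    refine mul_left_cancel₀ hδ0 ?_
    linear_combination hdet - hchar
  have hone : (p - 1) * (s - 1) - q * r = 0 := by linear_combination hdet - htr
  obtain ⟨w, hw, hLw⟩ : ∃ w : ℂ × ℂ, w ≠ 0 ∧ L w = w := by
    -- The vector `(q, 1 - p)` is fixed by `L`; in the one case where it is zero, `(1 - s, r)`
    -- replaces it.
    by_cases h1 : q = 0 ∧ p = 1
    · obtain ⟨rfl, rfl⟩ := h1
      refine ⟨(1 - s, r), fun h0 => ?_, ?_⟩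
      · have h2 : 1 - s = 0 := congrArg Prod.fst h0
        exact hδ1 (by linear_combination -htr - h2)
      · rw [hL]
        ext <;> simp
        ring
    · refine ⟨(q, 1 - p), fun h0 => h1 ?_, ?_⟩
      · have h2 : q = 0 := congrArg Prod.fst h0
        have h3 : 1 - p = 0 := congrArg Prod.snd h0
        exact ⟨h2, (sub_eq_zero.1 h3).symm⟩
      · rw [hL]
        ext
        · simp only; ring
        · simp only; linear_combination -hone
  let B : ℂ × ℂ →ₗ[ℂ] ℂ × ℂ :=
    (LinearMap.fst ℂ ℂ ℂ).smulRight w + (LinearMap.snd ℂ ℂ ℂ).smulRight v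
  have hB : ∀ z : ℂ × ℂ, B z = z.1 • w + z.2 • v := fun z => rfl
  have hLB : ∀ z : ℂ × ℂ, L (B z) = B (z.1, δ * z.2) := by
    intro z
    rw [hB, hB, map_add, map_smul, map_smul, hLw, hL v, hLv, smul_smul, mul_comm z.2]
  have hBi : Function.Injective B := by
    rw [injective_iff_map_eq_zero]
    intro z hz
    have h1 := hLB z
    rw [hz, map_zero, hB] at h1
    rw [hB] at hz
    have h2 : ((δ - 1) * z.2) • v = 0 := by
      have : ((δ - 1) * z.2) • v = (z.1 • w + (δ * z.2) • v) - (z.1 • w + z.2 • v) := by module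
      rw [this, hz, sub_zero]
      exact h1.symm
    have h3 : z.2 = 0 :=
      (mul_eq_zero.1 ((smul_eq_zero.1 h2).resolve_right hv)).resolve_left (sub_ne_zero.2 hδ1)
    rw [h3, zero_smul, add_zero] at hz
    exact Prod.ext ((smul_eq_zero.1 hz).resolve_right hw) h3
  let e := (LinearEquiv.ofInjectiveEndo B hBi).toContinuousLinearEquiv
  have he : ∀ z, e z = B z := fun z => rfl
  refine ⟨e.symm, fun z => ?_⟩
  obtain ⟨y, rfl⟩ := e.surjective z
  rw [ContinuousLinearEquiv.symm_apply_eq, ContinuousLinearEquiv.symm_apply_apply, he, he, hLB]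

section Surface

variable {X : Type*} [TopologicalSpace X] [ChartedSpace (ℂ × ℂ) X]

/-! ### Special eigenvalues -/

lemma contMDiff_iterate {f : X → X} (hf : ContMDiff 𝓘(ℂ, ℂ × ℂ) 𝓘(ℂ, ℂ × ℂ) ω f) (n : ℕ) :
    ContMDiff 𝓘(ℂ, ℂ × ℂ) 𝓘(ℂ, ℂ × ℂ) ω f^[n] := by
  induction n with
  | zero => exact contMDiff_id
  | succ n ih => exact ih.comp hf

lemma IsSpecialEigenvalue.iterate {f : X → X} {δ : ℂ} (h : IsSpecialEigenvalue f δ)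
    (hf : ContMDiff 𝓘(ℂ, ℂ × ℂ) 𝓘(ℂ, ℂ × ℂ) ω f) (n : ℕ) :
    IsSpecialEigenvalue f^[n] (δ ^ n) := by
  obtain ⟨η, hη, hη0, h⟩ := h
  refine ⟨η, hη, hη0, ?_⟩
  have hω : (ω : WithTop ℕ∞) ≠ 0 := by simp
  induction n with
  | zero =>
    intro x v w
    rw [Function.iterate_zero, mfderiv_id, pow_zero, one_mul]
    rfl
  | succ n ih =>
    intro x v w
    have e1 : mfderiv 𝓘(ℂ, ℂ × ℂ) 𝓘(ℂ, ℂ × ℂ) (f^[n] ∘ f) x =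
        (mfderiv 𝓘(ℂ, ℂ × ℂ) 𝓘(ℂ, ℂ × ℂ) f^[n] (f x)).comp
          (mfderiv 𝓘(ℂ, ℂ × ℂ) 𝓘(ℂ, ℂ × ℂ) f x) :=
      mfderiv_comp x ((contMDiff_iterate hf n).contMDiffAt.mdifferentiableAt hω)
        (hf.contMDiffAt.mdifferentiableAt hω)
    have e2 := ih (f x) (mfderiv 𝓘(ℂ, ℂ × ℂ) 𝓘(ℂ, ℂ × ℂ) f x v)
      (mfderiv 𝓘(ℂ, ℂ × ℂ) 𝓘(ℂ, ℂ × ℂ) f x w)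
    rw [h x v w, ← mul_assoc, ← pow_succ] at e2
    rw [Function.iterate_succ, e1]
    exact e2

/-- The function `w` is the coefficient of the invariant form in the chart. -/
lemma IsSpecialEigenvalue.exists_volume [IsManifold 𝓘(ℂ, ℂ × ℂ) ω X]
    {f : X → X} {δ : ℂ} (h : IsSpecialEigenvalue f δ)
    (hf : ContMDiff 𝓘(ℂ, ℂ × ℂ) 𝓘(ℂ, ℂ × ℂ) ω f) {p : X} (hp : f p = p)
    {c : OpenPartialHomeomorph X (ℂ × ℂ)} (hc : IsCentredChart c p) :
    ∃ w : ℂ × ℂ → ℂ, DifferentiableAt ℂ w 0 ∧ w 0 ≠ 0 ∧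
      ∀ᶠ z in 𝓝 (0 : ℂ × ℂ), w (localRep c f z) * det₂ (fderiv ℂ (localRep c f) z) = δ * w z := by
  obtain ⟨η, hη, hη0, h⟩ := h
  have h0 : (0 : ℂ × ℂ) ∈ c.target := hc.map_eq_zero ▸ c.map_source hc.mem_source
  have hp0 : c.symm 0 = p := by rw [← hc.map_eq_zero, c.left_inv hc.mem_source]
  refine ⟨η.coeff c, hη.differentiableAt_coeff hc.mem_maximalAtlas h0,
    TwoForm.coeff_ne_zero hη0 hc.mem_maximalAtlas h0, ?_⟩
  have hcont : ContinuousAt (fun z => f (c.symm z)) 0 :=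
    hf.continuous.continuousAt.comp (c.continuousAt_symm h0)
  have hmem : f (c.symm 0) ∈ c.source := by rw [hp0, hp]; exact hc.mem_source
  filter_upwards [c.open_target.mem_nhds h0, hcont.eventually (c.open_source.mem_nhds hmem)]
    with z hz hz'
  exact (η.coeff_mul_det₂ hc.mem_maximalAtlas hc.mem_maximalAtlas hf hz hz').trans (h _ _ _)

/-! ### Local representations near a fixed point -/

lemma IsCentredChart.zero_mem_target {c : OpenPartialHomeomorph X (ℂ × ℂ)} {p : X}
    (hc : IsCentredChart c p) : (0 : ℂ × ℂ) ∈ c.target :=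
  hc.map_eq_zero ▸ c.map_source hc.mem_source

lemma IsCentredChart.symm_zero {c : OpenPartialHomeomorph X (ℂ × ℂ)} {p : X}
    (hc : IsCentredChart c p) : c.symm 0 = p := by
  rw [← hc.map_eq_zero, c.left_inv hc.mem_source]

lemma IsCentredChart.localRep_zero {c : OpenPartialHomeomorph X (ℂ × ℂ)} {p : X}
    (hc : IsCentredChart c p) {f : X → X} (hp : f p = p) : localRep c f 0 = 0 := by
  rw [localRep, hc.symm_zero, hp, hc.map_eq_zero]

lemma IsCentredChart.analyticAt_localRep [IsManifold 𝓘(ℂ, ℂ × ℂ) ω X]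
    {c : OpenPartialHomeomorph X (ℂ × ℂ)} {p : X}
    (hc : IsCentredChart c p) {f : X → X} (hf : ContMDiff 𝓘(ℂ, ℂ × ℂ) 𝓘(ℂ, ℂ × ℂ) ω f)
    (hp : f p = p) : AnalyticAt ℂ (localRep c f) 0 :=
  analyticAt_chart_comp_symm hc.mem_maximalAtlas hc.mem_maximalAtlas hf hc.zero_mem_target
    (by rw [hc.symm_zero, hp]; exact hc.mem_source)

lemma IsCentredChart.localRep_iterate {c : OpenPartialHomeomorph X (ℂ × ℂ)} {p : X}
    (hc : IsCentredChart c p) {f : X → X} (hf : Continuous f) (hp : f p = p) (n : ℕ) :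
    localRep c f^[n] =ᶠ[𝓝 0] (localRep c f)^[n] := by
  induction n with
  | zero =>
    filter_upwards [c.open_target.mem_nhds hc.zero_mem_target] with z hz
    exact c.right_inv hz
  | succ n ih =>
    have hcont : ContinuousAt (fun z => f^[n] (c.symm z)) 0 :=
      (hf.iterate n).continuousAt.comp (c.continuousAt_symm hc.zero_mem_target)
    have hmem : f^[n] (c.symm 0) ∈ c.source := by
      rw [hc.symm_zero, Function.iterate_fixed hp]; exact hc.mem_source
    filter_upwards [ih, eventually_symm_chart_comp hcont hmem] with z hz hz'
    rw [Function.iterate_succ_apply', ← hz]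
    simp only [localRep] at hz' ⊢
    rw [hz', Function.iterate_succ_apply']

/-! ### Rational curves -/

lemma deriv_chart_comp_ne_zero [IsManifold 𝓘(ℂ, ℂ × ℂ) ω X]
    {c : OpenPartialHomeomorph X (ℂ × ℂ)}
    (hc : c ∈ IsManifold.maximalAtlas 𝓘(ℂ, ℂ × ℂ) ω X) {κ : ℂ → X} {a : ℂ}
    (hκ : ContMDiff 𝓘(ℂ, ℂ) 𝓘(ℂ, ℂ × ℂ) ω κ)
    (hκ' : mfderiv 𝓘(ℂ, ℂ) 𝓘(ℂ, ℂ × ℂ) κ a ≠ 0) (ha : κ a ∈ c.source) :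
    deriv (fun t => c (κ t)) a ≠ 0 := by
  intro h0
  have hω : (ω : WithTop ℕ∞) ≠ 0 := by simp
  have hΓ : AnalyticAt ℂ (fun t => c (κ t)) a := analyticAt_chart_comp hc hκ.contMDiffAt ha
  have hs : MDifferentiableAt 𝓘(ℂ, ℂ × ℂ) 𝓘(ℂ, ℂ × ℂ) c.symm (c (κ a)) :=
    (contMDiffAt_symm hc (c.map_source ha)).mdifferentiableAt hω
  have e1 := mfderiv_comp (I := 𝓘(ℂ, ℂ)) (I' := 𝓘(ℂ, ℂ × ℂ)) (I'' := 𝓘(ℂ, ℂ × ℂ))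
    (f := fun t => c (κ t)) a hs hΓ.differentiableAt.mdifferentiableAt
  have e2 : c.symm ∘ (fun t => c (κ t)) =ᶠ[𝓝 a] κ :=
    eventually_symm_chart_comp hκ.continuous.continuousAt ha
  have e3 : fderiv ℂ (fun t => c (κ t)) a = 0 := by
    ext1
    simpa using h0
  have e4 : mfderiv 𝓘(ℂ, ℂ) 𝓘(ℂ, ℂ × ℂ) (fun t => c (κ t)) a = 0 := mfderiv_eq_fderiv.trans e3
  rw [e2.mfderiv_eq, e4, ContinuousLinearMap.comp_zero] at e1
  exact hκ' e1

lemma sphereInv_zero : sphereInv 0 = OnePoint.infty := if_pos rfl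

lemma sphereInv_of_ne {w : ℂ} (hw : w ≠ 0) : sphereInv w = ((w⁻¹ : ℂ) : OnePoint ℂ) := if_neg hw

/-- The inversion `z ↦ 1 / z` of the Riemann sphere. -/
def sphereSwap : OnePoint ℂ → OnePoint ℂ
  | OnePoint.infty => ((0 : ℂ) : OnePoint ℂ)
  | OnePoint.some w => sphereInv w

lemma sphereSwap_coe (w : ℂ) : sphereSwap (w : OnePoint ℂ) = sphereInv w := rfl

lemma sphereSwap_sphereInv (w : ℂ) : sphereSwap (sphereInv w) = (w : OnePoint ℂ) := by
  by_cases hw : w = 0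
  · rw [hw, sphereInv_zero]
    rfl
  · rw [sphereInv_of_ne hw, sphereSwap_coe, sphereInv_of_ne (inv_ne_zero hw), inv_inv]

lemma sphereSwap_involutive : Function.Involutive sphereSwap := by
  intro x
  induction x using OnePoint.rec with
  | infty =>
    change sphereSwap ((0 : ℂ) : OnePoint ℂ) = _
    rw [sphereSwap_coe, sphereInv_zero]
  | coe w => rw [sphereSwap_coe, sphereSwap_sphereInv]

/-- Moves the point at infinity to a finite parameter, so that local arguments need only the
coordinate `z`. -/
lemma IsParametrization.swap {ι : OnePoint ℂ → X} {E : Set X} (h : IsParametrization ι E) :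
    IsParametrization (ι ∘ sphereSwap) E where
  injective := h.injective.comp sphereSwap_involutive.injective
  range_eq := by rw [sphereSwap_involutive.surjective.range_comp, h.range_eq]
  holomorphic := h.holomorphic_infty
  immersion := h.immersion_infty
  holomorphic_infty := by
    simp only [Function.comp_apply, sphereSwap_sphereInv]
    exact h.holomorphic
  immersion_infty := by
    intro w
    have e : (fun w : ℂ => (ι ∘ sphereSwap) (sphereInv w)) = fun w : ℂ => ι (w : OnePoint ℂ) := by
      funext w
      rw [Function.comp_apply, sphereSwap_sphereInv]
    rw [e]
    exact h.immersion w

lemma IsParametrization.continuous {ι : OnePoint ℂ → X} {E : Set X} (h : IsParametrization ι E) :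
    Continuous ι := by
  rw [OnePoint.continuous_iff]
  refine ⟨?_, h.holomorphic.continuous⟩
  have h1 : Filter.Tendsto (fun w : ℂ => ι (sphereInv w)) (𝓝 0) (𝓝 (ι OnePoint.infty)) :=
    h.holomorphic_infty.continuous.tendsto' _ _ (by rw [sphereInv_zero])
  have h2 : Filter.Tendsto (fun z : ℂ => z⁻¹) (Filter.coclosedCompact ℂ) (𝓝 0) := by
    rw [Filter.coclosedCompact_eq_cocompact, ← Metric.cobounded_eq_cocompact]
    exact Filter.tendsto_inv₀_cobounded
  refine (h1.comp h2).congr' ?_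
  have h3 : ∀ᶠ z : ℂ in Filter.coclosedCompact ℂ, z ≠ 0 := by
    rw [Filter.coclosedCompact_eq_cocompact]
    exact (Set.finite_singleton (0 : ℂ)).isCompact.compl_mem_cocompact
  filter_upwards [h3] with z hz
  simp only [Function.comp_apply]
  rw [sphereInv_of_ne (inv_ne_zero hz), inv_inv]

lemma IsParametrization.isClosed [T2Space X] {ι : OnePoint ℂ → X} {E : Set X} (h : IsParametrization ι E) :
    IsClosed E := by
  rw [← h.range_eq]
  exact (isCompact_range h.continuous).isClosed

lemma IsParametrization.analyticAt [IsManifold 𝓘(ℂ, ℂ × ℂ) ω X]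
    {ι : OnePoint ℂ → X} {E : Set X} (h : IsParametrization ι E)
    {c : OpenPartialHomeomorph X (ℂ × ℂ)} {a : ℂ} (hc : IsCentredChart c (ι (a : OnePoint ℂ))) :
    AnalyticAt ℂ (fun t : ℂ => c (ι (t : OnePoint ℂ))) a :=
  analyticAt_chart_comp hc.mem_maximalAtlas h.holomorphic.contMDiffAt hc.mem_source

/-- A holomorphic retraction onto a curve, near one of its points. -/
lemma IsParametrization.exists_retraction [IsManifold 𝓘(ℂ, ℂ × ℂ) ω X] [T2Space X]
    {ι : OnePoint ℂ → X} {E : Set X}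
    (h : IsParametrization ι E) {a : ℂ} {c : OpenPartialHomeomorph X (ℂ × ℂ)}
    (hc : IsCentredChart c (ι (a : OnePoint ℂ))) :
    ∃ r : ℂ × ℂ → ℂ, AnalyticAt ℂ r 0 ∧ r 0 = a ∧
      ∀ᶠ x in 𝓝 (ι (a : OnePoint ℂ)), x ∈ E ↔ c (ι (r (c x) : ℂ)) = c x := by
  have hΓ := h.analyticAt hc
  set Γ : ℂ → ℂ × ℂ := fun t => c (ι (t : OnePoint ℂ)) with hΓdef
  have hΓa : Γ a = 0 := hc.map_eq_zero
  have hΓ' : deriv Γ a ≠ 0 :=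
    deriv_chart_comp_ne_zero hc.mem_maximalAtlas h.holomorphic (h.immersion a) hc.mem_source
  obtain ⟨L, hL⟩ : ∃ L : ℂ × ℂ →L[ℂ] ℂ, L (deriv Γ a) ≠ 0 := by
    by_cases h1 : (deriv Γ a).1 = 0
    · exact ⟨ContinuousLinearMap.snd ℂ ℂ ℂ, fun h2 => hΓ' (Prod.ext h1 h2)⟩
    · exact ⟨ContinuousLinearMap.fst ℂ ℂ ℂ, h1⟩
  have hLΓ : AnalyticAt ℂ (fun t => L (Γ t)) a := (L.analyticAt _).comp hΓ
  have hLΓd : HasDerivAt (fun t => L (Γ t)) (L (deriv Γ a)) a :=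
    L.hasFDerivAt.comp_hasDerivAt a hΓ.differentiableAt.hasDerivAt
  obtain ⟨ψ, hψ, hψ0, -, hψl, -⟩ :=
    exists_analytic_localInverse hLΓ (by rw [hLΓd.deriv]; exact hL)
  simp only [hΓa, map_zero] at hψ hψ0
  have hr : AnalyticAt ℂ (fun z => ψ (L z)) 0 :=
    AnalyticAt.fun_comp (f := L) (by rw [map_zero]; exact hψ) (L.analyticAt 0)
  refine ⟨fun z => ψ (L z), hr, by simp only [map_zero, hψ0], ?_⟩
  -- The retraction inverts the parametrization only on `D`. The image of the complement of `D` is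
  -- compact and misses `ι a` by injectivity, so points of `E` close to `ι a` have parameters in
  -- `D`.
  obtain ⟨D, hD, hDo, haD⟩ := eventually_nhds_iff.1 hψl
  have hU : IsOpen (((↑) : ℂ → OnePoint ℂ) '' D) :=
    OnePoint.isOpenEmbedding_coe.isOpenMap _ hDo
  have hK : IsClosed (ι '' (((↑) : ℂ → OnePoint ℂ) '' D)ᶜ) :=
    (hU.isClosed_compl.isCompact.image h.continuous).isClosed
  have hnot : ι (a : OnePoint ℂ) ∉ ι '' (((↑) : ℂ → OnePoint ℂ) '' D)ᶜ := by
    rintro ⟨y, hy, hya⟩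
    rw [h.injective hya] at hy
    exact hy ⟨a, haD, rfl⟩
  have hcx : ContinuousAt (fun x => c x) (ι (a : OnePoint ℂ)) := c.continuousAt hc.mem_source
  have hrx : ContinuousAt (fun x => ι ((ψ (L (c x)) : ℂ) : OnePoint ℂ)) (ι (a : OnePoint ℂ)) := by
    refine (h.continuous.comp OnePoint.continuous_coe).continuousAt.comp ?_
    exact ContinuousAt.comp_of_eq (g := fun z => ψ (L z)) hr.continuousAt hcx hc.map_eq_zero
  have hrx0 : ι ((ψ (L (c (ι (a : OnePoint ℂ)))) : ℂ) : OnePoint ℂ) ∈ c.source := by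
    rw [hc.map_eq_zero, map_zero, hψ0]; exact hc.mem_source
  filter_upwards [hK.isOpen_compl.mem_nhds hnot, c.open_source.mem_nhds hc.mem_source,
    hrx.eventually (c.open_source.mem_nhds hrx0)] with x hx hxs hxr
  constructor
  · intro hxE
    rw [← h.range_eq] at hxE
    obtain ⟨y, rfl⟩ := hxE
    by_cases hy : y ∈ ((↑) : ℂ → OnePoint ℂ) '' D
    · obtain ⟨t, ht, rfl⟩ := hy
      have : ψ (L (c (ι (t : OnePoint ℂ)))) = t := hD t ht
      rw [this]
    · exact absurd ⟨y, hy, rfl⟩ hx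
  · intro hxE
    rw [← c.injOn hxr hxs hxE, ← h.range_eq]
    exact ⟨_, rfl⟩

/-- A holomorphic arc which starts on a rational curve remains on it. -/
lemma IsParametrization.mem_of_eventually_mem [IsManifold 𝓘(ℂ, ℂ × ℂ) ω X] [T2Space X]
    {ι : OnePoint ℂ → X} {E : Set X}
    (h : IsParametrization ι E) {j : ℂ → X} (hj : ContMDiff 𝓘(ℂ, ℂ) 𝓘(ℂ, ℂ × ℂ) ω j)
    {t₀ : ℂ} (h0 : ∀ᶠ t in 𝓝 t₀, j t ∈ E) (t : ℂ) : j t ∈ E := by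
  -- This set is open by construction. At a limit point, the retraction turns membership in `E` into
  -- an equality of analytic functions, so the identity theorem shows that it is closed.
  let S : Set ℂ := {t | ∀ᶠ s in 𝓝 t, j s ∈ E}
  have hSE : S ⊆ j ⁻¹' E := fun t ht => ht.self_of_nhds
  have hSo : IsOpen S := isOpen_iff_eventually.2 fun t ht => eventually_eventually_nhds.2 ht
  have hSc : IsClosed S := by
    rw [← closure_subset_iff_isClosed]
    intro t ht
    by_contra htS
    have htE : j t ∈ E := by
      have := closure_mono hSE ht
      rwa [(h.isClosed.preimage hj.continuous).closure_eq] at this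
    obtain ⟨κ, a, hκ, hκa⟩ : ∃ (κ : OnePoint ℂ → X) (a : ℂ), IsParametrization κ E ∧
        κ (a : OnePoint ℂ) = j t := by
      rw [← h.range_eq] at htE
      obtain ⟨y, hy⟩ := htE
      induction y using OnePoint.rec with
      | infty => exact ⟨_, 0, h.swap, by
          rw [Function.comp_apply, sphereSwap_coe, sphereInv_zero, hy]⟩
      | coe a => exact ⟨ι, a, h, hy⟩
    let c := centredChart (chartAt (ℂ × ℂ) (j t)) (j t) (ContinuousLinearEquiv.refl ℂ (ℂ × ℂ))
    have hc : IsCentredChart c (j t) :=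
      isCentredChart_centredChart (IsManifold.chart_mem_maximalAtlas _) (mem_chart_source _ _) _
    obtain ⟨r, hr, hr0, hrE⟩ := hκ.exists_retraction (c := c) (by rw [hκa]; exact hc)
    rw [hκa] at hrE
    have h1 : AnalyticAt ℂ (fun s => c (j s)) t :=
      analyticAt_chart_comp hc.mem_maximalAtlas hj.contMDiffAt hc.mem_source
    have h2 : AnalyticAt ℂ (fun s => r (c (j s))) t :=
      AnalyticAt.fun_comp (f := fun s => c (j s)) (by rw [hc.map_eq_zero]; exact hr) h1
    have h3 : AnalyticAt ℂ (fun s => c (κ ((r (c (j s)) : ℂ) : OnePoint ℂ))) t :=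
      AnalyticAt.fun_comp (g := fun u : ℂ => c (κ (u : OnePoint ℂ))) (f := fun s => r (c (j s)))
        (by rw [hc.map_eq_zero, hr0]; exact hκ.analyticAt (by rw [hκa]; exact hc)) h2
    have h4 : ∀ᶠ s in 𝓝 t, j s ∈ E ↔ c (κ ((r (c (j s)) : ℂ) : OnePoint ℂ)) = c (j s) :=
      hj.continuous.continuousAt.eventually hrE
    have h5 : ∃ᶠ s in 𝓝[≠] t, c (κ ((r (c (j s)) : ℂ) : OnePoint ℂ)) = c (j s) := by
      have h6 : ∃ᶠ s in 𝓝[≠] t, s ∈ S := by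
        rw [mem_closure_iff_frequently] at ht
        rw [frequently_nhdsWithin_iff]
        exact ht.mono fun s hs => ⟨hs, fun hst => htS (hst ▸ hs)⟩
      refine (h6.and_eventually (h4.filter_mono nhdsWithin_le_nhds)).mono fun s hs => ?_
      exact hs.2.1 (hSE hs.1)
    have h6 := (h3.frequently_eq_iff_eventually_eq h1).1 h5
    refine htS ?_
    filter_upwards [h4, h6] with s hs hs' using hs.2 hs'
  have : S = Set.univ := IsClopen.eq_univ ⟨hSc, hSo⟩ ⟨t₀, h0⟩
  exact hSE (this ▸ Set.mem_univ t)

lemma IsParametrization.mapsTo_of_eventually [IsManifold 𝓘(ℂ, ℂ × ℂ) ω X] [T2Space X]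
    {ι : OnePoint ℂ → X} {E : Set X}
    (h : IsParametrization ι E) {f : X → X} (hf : ContMDiff 𝓘(ℂ, ℂ × ℂ) 𝓘(ℂ, ℂ × ℂ) ω f)
    {t₀ : ℂ} (h0 : ∀ᶠ t : ℂ in 𝓝 t₀, f (ι (t : OnePoint ℂ)) ∈ E) : Set.MapsTo f E E := by
  have h1 : ∀ t : ℂ, f (ι (t : OnePoint ℂ)) ∈ E :=
    h.mem_of_eventually_mem (hf.comp h.holomorphic) h0
  have h2 : IsClosed {y : OnePoint ℂ | f (ι y) ∈ E} :=
    h.isClosed.preimage (hf.continuous.comp h.continuous)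
  intro x hx
  rw [← h.range_eq] at hx
  obtain ⟨y, rfl⟩ := hx
  exact OnePoint.denseRange_coe.induction_on y h2 h1

end Surface

/-- A point of `E` is `f^[n] y = f (f^[n-1] y)`, and `f^[n-1] y` stays in `E`. -/
lemma image_eq_of_iterate {X : Type*} {f : X → X} {E : Set X} {n : ℕ} (hn : 1 ≤ n) (hE : f^[n] '' E = E)
    (h : Set.MapsTo f E E) : f '' E = E := by
  refine Set.Subset.antisymm h.image_subset ?_
  obtain ⟨m, rfl⟩ : ∃ m, n = m + 1 := ⟨n - 1, by omega⟩
  intro x hx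
  rw [← hE] at hx
  obtain ⟨y, hy, rfl⟩ := hx
  rw [Function.iterate_succ_apply']
  exact ⟨_, h.iterate m hy, rfl⟩

/-! ### Arithmetic of the special eigenvalue -/

lemma aeval_eq_zero_of_isConjRoot {x y : ℂ} (h : IsConjRoot ℚ x y) {q : Polynomial ℚ}
    (hq : Polynomial.aeval y q = 0) : Polynomial.aeval x q = 0 := by
  obtain ⟨s, hs⟩ := minpoly.dvd ℚ y hq
  have h' : minpoly ℚ x = minpoly ℚ y := h
  rw [hs, ← h', map_mul, minpoly.aeval, zero_mul]

lemma ne_zero_of_isConjRoot_salem {l : ℝ} (hl : IsSalemNumber l) {δ : ℂ}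
    (h : IsConjRoot ℚ (l : ℂ) δ) : δ ≠ 0 := by
  rintro rfl
  have := aeval_eq_zero_of_isConjRoot h (q := Polynomial.X) (by simp)
  rw [Polynomial.aeval_X, Complex.ofReal_eq_zero] at this
  linarith [hl.1]

/-- A relation `δ ^ n = 1` over `ℚ` would pass to the conjugate `l > 1`. -/
lemma pow_ne_one_of_isConjRoot_salem {l : ℝ} (hl : IsSalemNumber l) {δ : ℂ}
    (h : IsConjRoot ℚ (l : ℂ) δ) {n : ℕ} (hn : 1 ≤ n) : δ ^ n ≠ 1 := by
  intro h1
  have := aeval_eq_zero_of_isConjRoot h (q := Polynomial.X ^ n - 1) (by simp [h1])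
  rw [map_sub, map_pow, Polynomial.aeval_X, map_one, sub_eq_zero] at this
  have h2 : l ^ n = 1 := by exact_mod_cast this
  exact (one_lt_pow₀ hl.1 (by omega)).ne' h2

/-! ### Jets of maps with diagonal differential -/

/-- A diagonal differential is enough: the invariant curve need not be straightened to define the
jet. -/
lemma exists_hasMapJet {F : ℂ × ℂ → ℂ × ℂ} {δ : ℂ} (hF : AnalyticAt ℂ F 0) (hF0 : F 0 = 0)
    (hd : ∀ v, fderiv ℂ F 0 v = (v.1, δ * v.2)) : ∃ a b c d e m, HasMapJet F δ a b c d e m := by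
  have h1 : AnalyticAt ℂ (fun z => (F z).1) 0 := analyticAt_fst.comp hF
  have h2 : AnalyticAt ℂ (fun z => (F z).2) 0 := analyticAt_snd.comp hF
  obtain ⟨p₁, p₂, p₃, q₀, q₁, hp⟩ := exists_hasWeightedJet h1 (by rw [hF0]; rfl)
  obtain ⟨u₁, u₂, u₃, v₀, v₁, hu⟩ := exists_hasWeightedJet h2 (by rw [hF0]; rfl)
  obtain ⟨R₁, S₁, -, -, e₁⟩ := hp.exists_fderiv h1
  obtain ⟨R₂, S₂, -, -, e₂⟩ := hu.exists_fderiv h2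
  have f₁ : ∀ v, fderiv ℂ (fun z => (F z).1) (0, 0) v = v.1 := fun v => by
    have := fderiv_fst_apply hF.differentiableAt v
    rw [hd v] at this
    exact this.symm
  have f₂ : ∀ v, fderiv ℂ (fun z => (F z).2) (0, 0) v = δ * v.2 := fun v => by
    have := fderiv_snd_apply hF.differentiableAt v
    rw [hd v] at this
    exact this.symm
  have e₁ := e₁.self_of_nhds
  have e₂ := e₂.self_of_nhds
  simp only [f₁, f₂] at e₁ e₂
  obtain ⟨r₁, r₂⟩ := e₁
  obtain ⟨r₃, r₄⟩ := e₂
  have s₁ : p₁ = 1 := by linear_combination -r₁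
  have s₂ : q₀ = 0 := by linear_combination -r₂
  have s₃ : u₁ = 0 := by linear_combination -r₃
  have s₄ : v₀ = δ := by linear_combination -r₄
  subst s₁ s₂ s₃ s₄
  exact ⟨_, _, _, _, _, _, hp, hu⟩

/-! ### Changes of charts and multiplicities -/

section Surface

variable {X : Type*} [TopologicalSpace X]

lemma localRep_centredChart (c : OpenPartialHomeomorph X (ℂ × ℂ)) (p : X)
    (T : (ℂ × ℂ) ≃L[ℂ] (ℂ × ℂ)) (f : X → X) (z : ℂ × ℂ) :
    localRep (centredChart c p T) f (T z) =
      T (localRep (centredChart c p (ContinuousLinearEquiv.refl ℂ (ℂ × ℂ))) f z) := by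
  simp only [localRep, centredChart_apply, centredChart_symm_apply,
    ContinuousLinearEquiv.symm_apply_apply]
  rfl

variable [ChartedSpace (ℂ × ℂ) X]

lemma IsCentredChart.eventually_localRep_comp {c c' : OpenPartialHomeomorph X (ℂ × ℂ)} {p : X}
    (hc : IsCentredChart c p) (hc' : IsCentredChart c' p) {f : X → X} (hf : Continuous f)
    (hp : f p = p) :
    ∀ᶠ z in 𝓝 (0 : ℂ × ℂ), localRep c' f (c' (c.symm z)) = c' (c.symm (localRep c f z)) := by
  have h1 : ContinuousAt c.symm 0 := c.continuousAt_symm hc.zero_mem_target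
  have h2 : ContinuousAt (fun z => f (c.symm z)) 0 := hf.continuousAt.comp h1
  filter_upwards [eventually_symm_chart_comp (c := c') h1 (by rw [hc.symm_zero]; exact hc'.mem_source),
    eventually_symm_chart_comp (c := c) h2 (by rw [hc.symm_zero, hp]; exact hc.mem_source)]
    with z hz hz'
  rw [localRep, hz, localRep, hz']

lemma IsCentredChart.analyticAt_transition [IsManifold 𝓘(ℂ, ℂ × ℂ) ω X]
    {c c' : OpenPartialHomeomorph X (ℂ × ℂ)} {p : X}
    (hc : IsCentredChart c p) (hc' : IsCentredChart c' p) :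
    AnalyticAt ℂ (fun z => c' (c.symm z)) 0 :=
  analyticAt_chart_comp_symm hc.mem_maximalAtlas hc'.mem_maximalAtlas
    (contMDiff_id (I := 𝓘(ℂ, ℂ × ℂ))) hc.zero_mem_target
    (by rw [hc.symm_zero]; exact hc'.mem_source)

lemma IsCentredChart.injective_fderiv_transition [IsManifold 𝓘(ℂ, ℂ × ℂ) ω X]
    {c c' : OpenPartialHomeomorph X (ℂ × ℂ)} {p : X}
    (hc : IsCentredChart c p) (hc' : IsCentredChart c' p) :
    Function.Injective (fderiv ℂ (fun z => c' (c.symm z)) 0) := by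
  have h1 : HasFDerivAt (fun z => c (c'.symm z)) (fderiv ℂ (fun z => c (c'.symm z)) 0)
      (c' (c.symm 0)) := by
    rw [hc.symm_zero, hc'.map_eq_zero]
    exact (hc'.analyticAt_transition hc).differentiableAt.hasFDerivAt
  have h2 := HasFDerivAt.comp (f := fun z => c' (c.symm z)) (0 : ℂ × ℂ) h1
    (hc.analyticAt_transition hc').differentiableAt.hasFDerivAt
  have h3 : (fun z => c (c'.symm z)) ∘ (fun z => c' (c.symm z)) =ᶠ[𝓝 0] id := by
    filter_upwards [c.open_target.mem_nhds hc.zero_mem_target,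
      eventually_symm_chart_comp (c := c') (c.continuousAt_symm hc.zero_mem_target)
        (by rw [hc.symm_zero]; exact hc'.mem_source)] with z hz hz'
    simp only [Function.comp_apply, hz', id]
    exact c.right_inv hz
  have h4 := h2.unique ((hasFDerivAt_id (0 : ℂ × ℂ)).congr_of_eventuallyEq h3)
  refine Function.LeftInverse.injective (g := fderiv ℂ (fun z => c (c'.symm z)) 0) fun v => ?_
  exact congrArg (fun L : ℂ × ℂ →L[ℂ] ℂ × ℂ => L v) h4

/-- The preferred chart at `p`, translated so that `p` becomes the origin. -/
def translatedChart (p : X) : OpenPartialHomeomorph X (ℂ × ℂ) :=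
  centredChart (chartAt (ℂ × ℂ) p) p (ContinuousLinearEquiv.refl ℂ (ℂ × ℂ))

lemma multiplicity_eq (f : X → X) (p : X) :
    multiplicity f p = localMultiplicity (localRep (translatedChart p) f) := by
  rw [multiplicity]
  congr 1
  funext z
  rw [translatedChart, localRep, localRep, centredChart_apply, centredChart_symm_apply]
  rfl

lemma isCentredChart_translatedChart [IsManifold 𝓘(ℂ, ℂ × ℂ) ω X]
    (p : X) : IsCentredChart (translatedChart p) p :=
  isCentredChart_centredChart (IsManifold.chart_mem_maximalAtlas _) (mem_chart_source _ _) _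

lemma HasMapJet.ne_zero_of_multiplicity [IsManifold 𝓘(ℂ, ℂ × ℂ) ω X]
    {f : X → X}
    (hf : ContMDiff 𝓘(ℂ, ℂ × ℂ) 𝓘(ℂ, ℂ × ℂ) ω f) {p : X} (hp : f p = p)
    {c : OpenPartialHomeomorph X (ℂ × ℂ)} (hc : IsCentredChart c p) {δ a b c₃ d e m : ℂ}
    (h : HasMapJet (localRep c f) δ a b c₃ d e m) (hδ : δ ≠ 1) (hmu : multiplicity f p = 2) :
    a ≠ 0 := by
  have hc' := isCentredChart_translatedChart p
  exact h.ne_zero_of_localMultiplicity hδ (hc'.analyticAt_localRep hf hp)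
    (hc.analyticAt_transition hc') (by rw [hc.symm_zero, hc'.map_eq_zero])
    (hc.injective_fderiv_transition hc') (hc.analyticAt_localRep hf hp).continuousAt
    (hc.localRep_zero hp) (hc.eventually_localRep_comp hc' hf.continuous hp)
    (by rw [← multiplicity_eq, hmu])

lemma HasMapJet.multiplicity_eq_two [IsManifold 𝓘(ℂ, ℂ × ℂ) ω X]
    {f : X → X}
    (hf : ContMDiff 𝓘(ℂ, ℂ × ℂ) 𝓘(ℂ, ℂ × ℂ) ω f) {p : X} (hp : f p = p)
    {T : (ℂ × ℂ) ≃L[ℂ] (ℂ × ℂ)} {δ a b c₃ d e m : ℂ}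
    (h : HasMapJet (localRep (centredChart (chartAt (ℂ × ℂ) p) p T) f) δ a b c₃ d e m)
    (ha : a ≠ 0) (hδ : δ ≠ 1) : multiplicity f p = 2 := by
  have hc' := isCentredChart_translatedChart p
  have hc : IsCentredChart (centredChart (chartAt (ℂ × ℂ) p) p T) p :=
    isCentredChart_centredChart (IsManifold.chart_mem_maximalAtlas _) (mem_chart_source _ _) T
  rw [multiplicity_eq]
  refine le_antisymm ?_ ?_
  · exact h.localMultiplicity_le_two ha hδ (hc'.analyticAt_localRep hf hp) T
      (Filter.Eventually.of_forall fun z => localRep_centredChart _ _ _ _ _)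
  · exact h.two_le_localMultiplicity (hc'.analyticAt_localRep hf hp)
      (hc.analyticAt_transition hc') (by rw [hc.symm_zero, hc'.map_eq_zero])
      (hc.injective_fderiv_transition hc') (hc.analyticAt_localRep hf hp).continuousAt
      (hc.localRep_zero hp) (hc.eventually_localRep_comp hc' hf.continuous hp)

/-! ### The differential at a fixed point -/

/-- At the fixed point the volume densities on the two sides agree and cancel. In particular the
special eigenvalue is unique. -/
lemma IsSpecialEigenvalue.det₂_eq [IsManifold 𝓘(ℂ, ℂ × ℂ) ω X]
    {f : X → X} {δ : ℂ} (h : IsSpecialEigenvalue f δ)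
    (hf : ContMDiff 𝓘(ℂ, ℂ × ℂ) 𝓘(ℂ, ℂ × ℂ) ω f) {p : X} (hp : f p = p)
    {c : OpenPartialHomeomorph X (ℂ × ℂ)} (hc : IsCentredChart c p) :
    det₂ (fderiv ℂ (localRep c f) 0) = δ := by
  obtain ⟨w, -, hw0, hw⟩ := h.exists_volume hf hp hc
  have := hw.self_of_nhds
  rw [hc.localRep_zero hp, mul_comm] at this
  exact mul_right_cancel₀ hw0 this

lemma IsParametrization.eventually_localRep {ι : OnePoint ℂ → X} {E : Set X}
    (h : IsParametrization ι E) {c : OpenPartialHomeomorph X (ℂ × ℂ)} {f : X → X} {u : ℂ → ℂ}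
    (hc : IsCentredChart c (ι ((0 : ℂ) : OnePoint ℂ)))
    (hu : ∀ᶠ z : ℂ in 𝓝 (0 : ℂ), f (ι (z : OnePoint ℂ)) = ι ((u z : ℂ) : OnePoint ℂ)) :
    ∀ᶠ t : ℂ in 𝓝 (0 : ℂ), localRep c f (c (ι (t : OnePoint ℂ))) = c (ι ((u t : ℂ) : OnePoint ℂ)) := by
  filter_upwards [hu, eventually_symm_chart_comp (c := c)
    (h.holomorphic.continuous.continuousAt (x := 0)) hc.mem_source] with t ht ht'
  rw [localRep, ht', ht]

lemma IsParametrization.apply_zero {ι : OnePoint ℂ → X} {E : Set X}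
    (h : IsParametrization ι E) {f : X → X} {u : ℂ → ℂ}
    (hf : f (ι ((0 : ℂ) : OnePoint ℂ)) = ι ((0 : ℂ) : OnePoint ℂ))
    (hu : ∀ᶠ z : ℂ in 𝓝 (0 : ℂ), f (ι (z : OnePoint ℂ)) = ι ((u z : ℂ) : OnePoint ℂ)) :
    u 0 = 0 := by
  have h1 := hu.self_of_nhds
  rw [hf] at h1
  exact (OnePoint.coe_injective (h.injective h1)).symm

lemma HasCurveDeriv.exists_eigenvector [IsManifold 𝓘(ℂ, ℂ × ℂ) ω X]
    {f : X → X} {p : X} (hp : f p = p)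
    (hf : ContMDiff 𝓘(ℂ, ℂ × ℂ) 𝓘(ℂ, ℂ × ℂ) ω f) {E : Set X} {μ : ℂ} (h : HasCurveDeriv f E p μ)
    {c : OpenPartialHomeomorph X (ℂ × ℂ)} (hc : IsCentredChart c p) :
    ∃ v : ℂ × ℂ, v ≠ 0 ∧ fderiv ℂ (localRep c f) 0 v = μ • v := by
  obtain ⟨ι, hι, rfl, u, hu, hud⟩ := h
  have hu0 := hι.apply_zero hp hu
  have hΓ : HasDerivAt (fun t : ℂ => c (ι (t : OnePoint ℂ))) _ 0 :=
    (hι.analyticAt hc).differentiableAt.hasDerivAt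
  refine ⟨_, deriv_chart_comp_ne_zero hc.mem_maximalAtlas hι.holomorphic (hι.immersion 0)
    hc.mem_source, ?_⟩
  have hF := (hc.analyticAt_localRep hf hp).differentiableAt.hasFDerivAt
  have e1 := HasFDerivAt.comp_hasDerivAt (0 : ℂ) (f := fun t : ℂ => c (ι (t : OnePoint ℂ)))
    (by rw [hc.map_eq_zero]; exact hF) hΓ
  have e2 := HasDerivAt.scomp (0 : ℂ) (g₁ := fun t : ℂ => c (ι (t : OnePoint ℂ))) (h := u)
    (by rw [hu0]; exact hΓ) hud
  exact e1.unique (e2.congr_of_eventuallyEq (hι.eventually_localRep hc hu))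

/-- At a fixed point on a curve with multiplier `δ`, there are linear coordinates in which the
differential is diagonal with eigenvalues `1` and `δ`. -/
lemma exists_chart_hasMapJet [IsManifold 𝓘(ℂ, ℂ × ℂ) ω X]
    {f : X → X} {δ : ℂ} (h : IsSpecialEigenvalue f δ) (hδ0 : δ ≠ 0)
    (hδ1 : δ ≠ 1) (hf : ContMDiff 𝓘(ℂ, ℂ × ℂ) 𝓘(ℂ, ℂ × ℂ) ω f) {p : X} (hp : f p = p) {E : Set X}
    (hE : HasCurveDeriv f E p δ) :
    ∃ (T : (ℂ × ℂ) ≃L[ℂ] (ℂ × ℂ)) (a b c₃ d e m : ℂ),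
      HasMapJet (localRep (centredChart (chartAt (ℂ × ℂ) p) p T) f) δ a b c₃ d e m := by
  have hc' := isCentredChart_translatedChart p
  obtain ⟨v, hv, hLv⟩ := hE.exists_eigenvector hp hf hc'
  obtain ⟨T, hT⟩ := exists_diagonalization hδ0 hδ1 (h.det₂_eq hf hp hc') hv hLv
  have hc : IsCentredChart (centredChart (chartAt (ℂ × ℂ) p) p T) p :=
    isCentredChart_centredChart (IsManifold.chart_mem_maximalAtlas _) (mem_chart_source _ _) T
  refine ⟨T, exists_hasMapJet (hc.analyticAt_localRep hf hp) (hc.localRep_zero hp) fun v => ?_⟩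
  have e1 : localRep (centredChart (chartAt (ℂ × ℂ) p) p T) f =
      fun z => T (localRep (translatedChart p) f (T.symm z)) := by
    funext z
    rw [translatedChart, ← localRep_centredChart, ContinuousLinearEquiv.apply_symm_apply]
  have e2 : HasFDerivAt (fun z => localRep (translatedChart p) f (T.symm z))
      ((fderiv ℂ (localRep (translatedChart p) f) 0).comp (T.symm : ℂ × ℂ →L[ℂ] ℂ × ℂ)) 0 :=
    HasFDerivAt.comp (0 : ℂ × ℂ) (f := T.symm) (g := localRep (translatedChart p) f)
      (by rw [map_zero]; exact (hc'.analyticAt_localRep hf hp).differentiableAt.hasFDerivAt)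
      T.symm.hasFDerivAt
  have e3 := (T.hasFDerivAt (x := localRep (translatedChart p) f (T.symm 0))).comp
    (0 : ℂ × ℂ) e2
  have e4 : fderiv ℂ (localRep (centredChart (chartAt (ℂ × ℂ) p) p T) f) 0 v =
      T (fderiv ℂ (localRep (translatedChart p) f) 0 (T.symm v)) := by
    rw [e1]
    exact congrArg (fun L : ℂ × ℂ →L[ℂ] ℂ × ℂ => L v) e3.fderiv
  rw [e4, hT, ContinuousLinearEquiv.apply_symm_apply]

/-! ### Iterates -/

lemma IsCentredChart.hasMapJet_iterate [IsManifold 𝓘(ℂ, ℂ × ℂ) ω X]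
    {f : X → X} {c : OpenPartialHomeomorph X (ℂ × ℂ)} {p : X}
    (hc : IsCentredChart c p) (hf : ContMDiff 𝓘(ℂ, ℂ × ℂ) 𝓘(ℂ, ℂ × ℂ) ω f) (hp : f p = p)
    {δ a b c₃ d e m : ℂ} (h : HasMapJet (localRep c f) δ a b c₃ d e m) (n : ℕ) :
    ∃ dn : ℂ, HasMapJet (localRep c f^[n]) (δ ^ n) (n * a) (b * ∑ j ∈ Finset.range n, δ ^ j)
      (n * (n - 1) * a ^ 2 + n * c₃ +
        m * b * ∑ k ∈ Finset.range n, ∑ j ∈ Finset.range k, δ ^ j) dn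
      (n * e * δ ^ (n - 1)) (m * ∑ j ∈ Finset.range n, δ ^ j) := by
  obtain ⟨dn, hn⟩ := h.iterate (hc.analyticAt_localRep hf hp) (hc.localRep_zero hp) n
  exact ⟨dn, hn.congr (hc.localRep_iterate hf.continuous hp n).symm⟩

lemma IsInvariantCurve.iterate {f : X → X} {E : Set X} (h : IsInvariantCurve f E) (n : ℕ) :
    IsInvariantCurve f^[n] E :=
  ⟨h.1, by rw [Set.image_iterate_eq, Function.iterate_fixed h.2]⟩

lemma HasCurveDeriv.iterate {f : X → X} {E : Set X} {p : X} {μ : ℂ} (h : HasCurveDeriv f E p μ)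
    (hp : f p = p) (n : ℕ) : HasCurveDeriv f^[n] E p (μ ^ n) := by
  obtain ⟨ι, hι, rfl, u, hu, hud⟩ := h
  have hu0 := hι.apply_zero hp hu
  refine ⟨ι, hι, rfl, u^[n], ?_, HasDerivAt.iterate 0 hud hu0 n⟩
  have hut : Filter.Tendsto u (𝓝 0) (𝓝 0) := by
    have := hud.continuousAt.tendsto
    rwa [hu0] at this
  induction n with
  | zero => exact Filter.Eventually.of_forall fun _ => rfl
  | succ n ih =>
    filter_upwards [hu, hut.eventually ih] with t ht ht'
    rw [Function.iterate_succ_apply, Function.iterate_succ_apply, ht, ht']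

/-- A curve through `p` which is invariant under `f^[n]` with multiplier `1` is already invariant
under `f` with multiplier `1`. -/
lemma isInvariantCurve_of_iterate [IsManifold 𝓘(ℂ, ℂ × ℂ) ω X]
    [T2Space X] {f : X → X}
    (hf : ContMDiff 𝓘(ℂ, ℂ × ℂ) 𝓘(ℂ, ℂ × ℂ) ω f) {p : X} (hp : f p = p)
    {c : OpenPartialHomeomorph X (ℂ × ℂ)} (hc : IsCentredChart c p) {δ a b c₃ d e m : ℂ}
    (h : HasMapJet (localRep c f) δ a b c₃ d e m) {n : ℕ} (hn : 1 ≤ n) (hδ : δ ^ n ≠ 1)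
    {E : Set X} (hE : IsInvariantCurve f^[n] E) (hE1 : HasCurveDeriv f^[n] E p 1) :
    IsInvariantCurve f E ∧ HasCurveDeriv f E p 1 := by
  obtain ⟨ι, hι, rfl, u, hu, hud⟩ := hE1
  have hu0 := hι.apply_zero (Function.iterate_fixed hp n) hu
  have hΓ := hι.analyticAt hc
  have hΓt : Filter.Tendsto (fun t : ℂ => c (ι (t : OnePoint ℂ))) (𝓝 0) (𝓝 0) := by
    have := hΓ.continuousAt.tendsto
    rwa [hc.map_eq_zero] at this
  have hinv : ∀ᶠ t : ℂ in 𝓝 (0 : ℂ),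
      (localRep c f)^[n] (c (ι (t : OnePoint ℂ))) = c (ι ((u t : ℂ) : OnePoint ℂ)) := by
    filter_upwards [hι.eventually_localRep hc hu,
      hΓt.eventually (hc.localRep_iterate hf.continuous hp n)] with t ht ht'
    rw [← ht', ht]
  obtain ⟨u', hu', hu'0, e'⟩ := h.exists_reparametrization (hc.analyticAt_localRep hf hp)
    (hc.localRep_zero hp) hδ hΓ hc.map_eq_zero
    (deriv_chart_comp_ne_zero hc.mem_maximalAtlas hι.holomorphic (hι.immersion 0) hc.mem_source)
    hud hu0 hinv
  have hcι : ContinuousAt (fun t : ℂ => ι (t : OnePoint ℂ)) 0 :=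
    hι.holomorphic.continuous.continuousAt
  have hcu : ContinuousAt (fun t : ℂ => ι ((u' t : ℂ) : OnePoint ℂ)) 0 :=
    ContinuousAt.comp_of_eq (g := fun t : ℂ => ι (t : OnePoint ℂ)) hcι hu'.continuousAt hu'0
  have hcf : ContinuousAt (fun t : ℂ => f (ι (t : OnePoint ℂ))) 0 := hf.continuous.continuousAt.comp hcι
  have key : ∀ᶠ t : ℂ in 𝓝 (0 : ℂ), f (ι (t : OnePoint ℂ)) = ι ((u' t : ℂ) : OnePoint ℂ) := by
    filter_upwards [e', eventually_symm_chart_comp (c := c) hcι hc.mem_source,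
      hcu.eventually (c.open_source.mem_nhds (by simp only [hu'0]; exact hc.mem_source)),
      hcf.eventually (c.open_source.mem_nhds (by simp only [hp]; exact hc.mem_source))] with t ht h1 h2 h3
    rw [localRep, h1] at ht
    exact c.injOn h3 h2 ht
  -- The local inclusion near `p` spreads over the whole curve by analytic continuation.
  have hmaps : Set.MapsTo f E E := hι.mapsTo_of_eventually hf (t₀ := 0) (by
    filter_upwards [key] with t ht
    rw [ht, ← hι.range_eq]
    exact ⟨_, rfl⟩)
  exact ⟨⟨⟨ι, hι⟩, image_eq_of_iterate hn hE.2 hmaps⟩, ι, hι, rfl, u', key, hu'⟩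

end Surface

/-! ### Closed form of the residue of an iterate -/

/-- The left side is the residue formula for the jet of `F^[n]`, with `e = -2 a δ` and with `δ b` in
the role of the coefficient of `x²`. -/
lemma index_formula {δ a b c m : ℂ} {n : ℕ} (hn : 1 ≤ n) (ha : a ≠ 0) (hδ : δ ^ n ≠ 1) :
    ((n * (n - 1) * a ^ 2 + n * c +
        m * (δ * b) * ∑ k ∈ Finset.range n, ∑ j ∈ Finset.range k, δ ^ j) * (1 - δ ^ n) -
      n * a * (n * (-2 * a * δ) * δ ^ (n - 1)) +
      m * (∑ j ∈ Finset.range n, δ ^ j) * (δ * b * ∑ j ∈ Finset.range n, δ ^ j)) /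
        ((n * a) ^ 2 * (1 - δ ^ n) ^ 2) =
    ((n : ℂ) - 1 + ((n : ℂ) + 1) * δ ^ n + (∑ k ∈ Finset.range n, δ ^ k) *
      (((1 - δ) * c + δ * m * b) / a ^ 2)) / ((n : ℂ) * (1 - δ ^ n) ^ 2) := by
  have hn0 : (n : ℂ) ≠ 0 := Nat.cast_ne_zero.2 (by omega)
  have hδ' : 1 - δ ^ n ≠ 0 := sub_ne_zero.2 (Ne.symm hδ)
  have hT : ∀ k : ℕ, (1 - δ) * ∑ j ∈ Finset.range k, δ ^ j = 1 - δ ^ k := mul_neg_geom_sum δ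
  have hQ : (1 - δ) * ∑ k ∈ Finset.range n, ∑ j ∈ Finset.range k, δ ^ j =
      n - ∑ j ∈ Finset.range n, δ ^ j := by
    rw [Finset.mul_sum, Finset.sum_congr rfl fun k _ => hT k, Finset.sum_sub_distrib]
    simp
  have hpow : δ * δ ^ (n - 1) = δ ^ n := by
    rw [← pow_succ', Nat.sub_add_cancel hn]
  have hTn := hT n
  clear hT
  generalize ∑ k ∈ Finset.range n, ∑ j ∈ Finset.range k, δ ^ j = Q at *
  generalize ∑ j ∈ Finset.range n, δ ^ j = S at *
  generalize δ ^ (n - 1) = r at *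
  generalize δ ^ n = D at *
  -- With `(1 - δ) S = 1 - D` and `(1 - δ) Q = n - S`, the terms in `m b` combine to `n δ m b S`.
  -- Thus the numerator is divisible by `n`, and one factor `n` cancels.
  have hN : (n * (n - 1) * a ^ 2 + n * c + m * (δ * b) * Q) * (1 - D) -
      n * a * (n * (-2 * a * δ) * r) + m * S * (δ * b * S) =
      n * (a ^ 2 * (n - 1 + (n + 1) * D) + S * ((1 - δ) * c + δ * m * b)) := by
    linear_combination -(n * c + m * δ * b * Q) * hTn + m * δ * b * S * hQ +
      2 * n ^ 2 * a ^ 2 * hpow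
  rw [hN]
  field_simp

end K3Dyn
end

/-! ### Iterates and indices at a type II point -/

theorem theorem6p6 {X : Type*} [TopologicalSpace X] [ChartedSpace (ℂ × ℂ) X]
    [K3Dyn.IsK3Surface X] (f : X ≃ₘ^ω⟮𝓘(ℂ, ℂ × ℂ), 𝓘(ℂ, ℂ × ℂ)⟯ X)
    (δ : ℂ) (hδ : K3Dyn.IsSpecialEigenvalue (⇑f) δ)
    (hsalem : ∃ l : ℝ, K3Dyn.IsSalemNumber l ∧ IsConjRoot ℚ (l : ℂ) δ)
    (p : X) (hp : K3Dyn.IsTypeII (⇑f) p) (hmu : K3Dyn.multiplicity (⇑f) p = 2) :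
    (∀ n : ℕ, 1 ≤ n →
      K3Dyn.IsTypeII ((⇑f)^[n]) p ∧ K3Dyn.multiplicity ((⇑f)^[n]) p = 2) ∧
    ∀ (E : Set X) (c : OpenPartialHomeomorph X (ℂ × ℂ)) (g₁ g₂ : ℂ × ℂ → ℂ),
      K3Dyn.IsInvariantCurve (⇑f) E → p ∈ E → K3Dyn.HasCurveDeriv (⇑f) E p δ →
      K3Dyn.IsNormalForm (⇑f) p E δ c g₁ g₂ →
        K3Dyn.taylorCoeff g₁ 1 0 ≠ 0 ∧
        ∀ n : ℕ, 1 ≤ n →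
          K3Dyn.HasHolomorphicIndex ((⇑f)^[n]) p
            (((n : ℂ) - 1 + ((n : ℂ) + 1) * δ ^ n +
                (∑ k ∈ Finset.range n, δ ^ k) * K3Dyn.theta δ g₁ g₂) /
              ((n : ℂ) * (1 - δ ^ n) ^ 2)) := by
  obtain ⟨l, hl, hlδ⟩ := hsalem
  have hδ0 : δ ≠ 0 := K3Dyn.ne_zero_of_isConjRoot_salem hl hlδ
  have hδn : ∀ n : ℕ, 1 ≤ n → δ ^ n ≠ 1 :=
    fun n hn => K3Dyn.pow_ne_one_of_isConjRoot_salem hl hlδ hn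
  have hδ1 : δ ≠ 1 := by simpa using hδn 1 le_rfl
  have hf : ContMDiff 𝓘(ℂ, ℂ × ℂ) 𝓘(ℂ, ℂ × ℂ) ω f := f.contMDiff
  have hfp : f p = p := hp.1.1
  refine ⟨fun n hn => ?_, fun E c g₁ g₂ _ _ _ hnf => ?_⟩
  · obtain ⟨E, hE, hpE, δ', hδ', hEδ⟩ := hp.2.2
    -- Both eigenvalues are the determinant of the differential at `p`.
    obtain rfl : δ' = δ := (hδ'.det₂_eq hf hfp (K3Dyn.isCentredChart_translatedChart p)).symm.trans
      (hδ.det₂_eq hf hfp (K3Dyn.isCentredChart_translatedChart p))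
    obtain ⟨T, a, b, c₃, d, e, m, hjet⟩ := K3Dyn.exists_chart_hasMapJet hδ hδ0 hδ1 hf hfp hEδ
    have hc : K3Dyn.IsCentredChart (K3Dyn.centredChart (chartAt (ℂ × ℂ) p) p T) p :=
      K3Dyn.isCentredChart_centredChart (IsManifold.chart_mem_maximalAtlas _)
        (mem_chart_source _ _) T
    have ha : a ≠ 0 := hjet.ne_zero_of_multiplicity hf hfp hc hδ1 hmu
    have hfn := K3Dyn.contMDiff_iterate hf n
    have hfnp : f^[n] p = p := Function.iterate_fixed hfp n
    obtain ⟨dn, hjetn⟩ := hc.hasMapJet_iterate hf hfp hjet n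
    have hn0 : (n : ℂ) ≠ 0 := Nat.cast_ne_zero.2 (by omega)
    have hmun : K3Dyn.multiplicity f^[n] p = 2 :=
      hjetn.multiplicity_eq_two hfn hfnp (mul_ne_zero hn0 ha) (hδn n hn)
    have hexc : K3Dyn.IsExceptional f^[n] p :=
      ⟨hfnp, hmun.ge, by rw [hmun]; decide, E, hE.iterate n, hpE⟩
    refine ⟨⟨hexc, ?_, E, hE.iterate n, hpE, _, hδ.iterate hf n, hEδ.iterate hfp n⟩, hmun⟩
    rintro ⟨-, E', hE', hpE', hE'1⟩
    obtain ⟨h1, h2⟩ := K3Dyn.isInvariantCurve_of_iterate hf hfp hc hjet hn (hδn n hn) hE' hE'1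
    exact hp.2.1 ⟨hp.1, E', h1, hpE', h2⟩
  · have hc := hnf.centred
    have hjet := K3Dyn.hasMapJet_of_eventuallyEq hnf.analytic_fst hnf.analytic_snd hnf.fst_zero
      hnf.snd_zero hnf.rep
    have ha := hjet.ne_zero_of_multiplicity hf hfp hc hδ1 hmu
    refine ⟨ha, fun n hn => ⟨c, hc, ?_⟩⟩
    obtain ⟨w, hw, hw0, hvol⟩ := hδ.exists_volume hf hfp hc
    have he := hjet.eq_of_volume (hc.analyticAt_localRep hf hfp) (hc.localRep_zero hfp) hw hw0 hvol
    -- Substituting `e = -2 a δ` before iterating eliminates `b₀₁` from the index.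
    rw [he] at hjet
    obtain ⟨dn, hjetn⟩ := hc.hasMapJet_iterate hf hfp hjet n
    have hn0 : (n : ℂ) ≠ 0 := Nat.cast_ne_zero.2 (by omega)
    have hres := hjetn.hasResidue (mul_ne_zero hn0 ha) (hδn n hn)
    rw [K3Dyn.index_formula hn ha (hδn n hn)] at hres
    exact hres
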